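/- Let $N\ge 1$, $d\ge 2$, $\hbar,m>0$. Let $V:(\mathbb R^d)^N\to\mathbb R$ be measurable, bounded and invariant under permutations of its $N$ arguments. Let $\mathcal Q=\{S\subset\mathbb R^d:\#S=N\}$ be the space of unordered configurations, with the Riemannian manifold structure obtained from $\mathbb R^{Nd}_{\neq}=\{(x_1,\dots,x_N): x_j\ne x_k \text{ for } j\neq k\}$ through the covering $\pi(x_1,\dots,x_N)=\{x_1,\dots,x_N\}$, and with its volume measure $dq$. The function $V$ is also regarded as a function on $\mathcal Q$. Let $F$ be a fermionic line bundle over $\mathcal Q$, i.e. a smooth complex line bundle with Hermitian inner products $(\cdot,\cdot)_q$ on the fibers and a metric connection, such that the holonomy of every closed piecewise smooth curve $\alpha$ in $\mathcal Q$ is the sign of the permutation of $\alpha(0)$ defined by $\alpha$. Let $L^2(F)$ be the space of measurable cross-sections $\psi$ with $\int_{\mathcal Q}(\psi(q),\psi(q))_q\,dq<\infty$ modulo equality almost everywhere, and let $(Q_F(A)\psi)(q)=1_A(q)\psi(q)$ for measurable $A\subseteq\mathcal Q$. Let $\tilde H_F=-\frac{\hbar^2}{2m}\Delta+V$ on the smooth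 cross-sections of $F$ with compact support, where $\Delta\psi=g^{ab}D_aD_b\psi$ is the Laplacian of the connection of $F$ and the Riemannian metric $g$. Let $\mathrm{Anti}\,L^2(\mathbb R^{Nd})$ be the space of anti-symmetric functions in $L^2((\mathbb R^d)^N,\mathbb C)$, let $Q_{\mathrm{Anti}}(A)\hat\psi=1_{\pi^{-1}(A)}\hat\psi$, and let $\tilde H_{\mathrm{Anti}}=-\frac{\hbar^2}{2m}\Delta+V$ (with the usual Laplacian) on the anti-symmetric functions in $C_0^\infty(\mathbb R^{Nd})$. Then $\tilde H_{\mathrm{Anti}}$ has exactly one self-adjoint extension $H_{\mathrm{Anti}}$ in $\mathrm{Anti}\,L^2(\mathbb R^{Nd})$, and there is a self-adjoint extension $H_F$ of $\tilde H_F$ in $L^2(F)$ such that $(L^2(F),H_F,Q_F)$ and $(\mathrm{Anti}\,L^2(\mathbb R^{Nd}),H_{\mathrm{Anti}},Q_{\mathrm{Anti}})$ are quantum triples (a Hilbert space, a self-adjoint operator in it, and a projection-valued measure on $\mathcal Q$ acting on it) and are equivalent, $$(L^2(F),H_F,Q_F)\sim(\mathrm{Anti}\,L^2(\mathbb R^{Nd}),H_{\mathrm{Anti}},Q_{\mathrm{Anti}}).$$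 In detail: the pull-back $\hat F=\pi_*F$ to $\mathbb R^{Nd}_{\neq}$ has a global trivialization, i.e. a family of unitary maps $\hat I_{\hat q}:F_{\pi(\hat q)}\to\mathbb C$, $\hat q\in\mathbb R^{Nd}_{\neq}$, that is compatible with parallel transport along every piecewise smooth curve. For every such $\hat I$, the formula $$(U\psi)(x_1,\dots,x_N)=\frac1{\sqrt{N!}}\,\hat I_{(x_1,\dots,x_N)}\,\psi(\{x_1,\dots,x_N\})$$ (almost everywhere) defines a unitary isomorphism $U:L^2(F)\to\mathrm{Anti}\,L^2(\mathbb R^{Nd})$ with $$U(\mathscr D(H_F))=\mathscr D(H_{\mathrm{Anti}}),\qquad H_{\mathrm{Anti}}=UH_FU^{-1},\qquad Q_{\mathrm{Anti}}(A)=U\,Q_F(A)\,U^{-1}$$ for all measurable $A\subseteq\mathcal Q$, where $\mathscr D$ denotes the domain. -/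

import Mathlib

open MeasureTheory Function
open scoped ContDiff InnerProductSpace

universe u v

noncomputable section

/-! ## Configuration spaces -/

/-- The space `(ℝᵈ)ᴺ = ℝᴺᵈ` of `N`-tuples `x = (x₁, …, x_N)` of points of `ℝᵈ`, with its Euclidean
inner product and Lebesgue measure. -/
abbrev Conf (N d : ℕ) : Type := PiLp 2 (fun _ : Fin N => EuclideanSpace ℝ (Fin d))

/-- The ordered configurations without collisions (`x_j ≠ x_k` for `j ≠ k`). -/
abbrev OConf (N d : ℕ) : Type := {x : Conf N d // Injective x}

/-- The unordered configurations: the `N`-element subsets of `ℝᵈ`. -/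
def UConf (N d : ℕ) : Type := {S : Finset (EuclideanSpace ℝ (Fin d)) // S.card = N}

variable {N d : ℕ}

/-- Relabelling of the particles, `(x₁, …, x_N) ↦ (x_{σ(1)}, …, x_{σ(N)})`. -/
def permute (σ : Equiv.Perm (Fin N)) : Conf N d ≃ₗᵢ[ℝ] Conf N d :=
  LinearIsometryEquiv.piLpCongrLeft 2 ℝ (EuclideanSpace ℝ (Fin d)) σ.symm

@[simp] theorem permute_apply (σ : Equiv.Perm (Fin N)) (x : Conf N d) (j : Fin N) :
    permute σ x j = x (σ j) := by
  simp [permute, LinearIsometryEquiv.piLpCongrLeft_apply, Equiv.piCongrLeft'_apply]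

/-- Relabelling of a collision-free configuration. -/
def OConf.permute (σ : Equiv.Perm (Fin N)) (x : OConf N d) : OConf N d :=
  ⟨_root_.permute σ x.1, fun i j h => σ.injective (x.2 (by simpa using h))⟩

/-- The projection `π(x₁, …, x_N) = {x₁, …, x_N}` from ordered to unordered configurations. -/
def proj (x : OConf N d) : UConf N d :=
  ⟨Finset.univ.map ⟨fun j => x.1 j, x.2⟩, by simp⟩

theorem proj_eq_iff (x y : OConf N d) :
    proj x = proj y ↔ ∃ σ : Equiv.Perm (Fin N), y = OConf.permute σ x := by
  constructor
  · intro h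
    have h1 : ∀ j, ∃ k, x.1 k = y.1 j := by
      intro j
      have : y.1 j ∈ (proj y).1 := by simp [proj]
      rw [← h] at this
      simpa [proj] using this
    choose f hf using h1
    have finj : Injective f := by
      intro a b hab
      apply y.2
      simp only [← hf, hab]
    refine ⟨Equiv.ofBijective f (Finite.injective_iff_bijective.1 finj), ?_⟩
    apply Subtype.ext
    ext1 j
    simp [OConf.permute, hf]
  · rintro ⟨σ, rfl⟩
    apply Subtype.ext
    ext v
    simp only [proj, OConf.permute, Finset.mem_map, Finset.mem_univ, true_and,
      Embedding.coeFn_mk, permute_apply]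
    constructor
    · rintro ⟨j, rfl⟩
      exact ⟨σ.symm j, by simp⟩
    · rintro ⟨j, rfl⟩
      exact ⟨σ j, rfl⟩

theorem proj_permute (σ : Equiv.Perm (Fin N)) (x : OConf N d) :
    proj (OConf.permute σ x) = proj x :=
  ((proj_eq_iff _ _).2 ⟨σ, rfl⟩).symm

theorem proj_surjective : Surjective (proj : OConf N d → UConf N d) := by
  rintro ⟨S, hS⟩
  let e := (S.equivFinOfCardEq hS).symm
  refine ⟨⟨WithLp.toLp 2 fun j => (e j : EuclideanSpace ℝ (Fin d)), fun i j h =>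
    e.injective (Subtype.ext h)⟩, ?_⟩
  apply Subtype.ext
  ext v
  simp only [proj, Finset.mem_map, Finset.mem_univ, true_and, Embedding.coeFn_mk]
  constructor
  · rintro ⟨j, rfl⟩
    exact (e j).2
  · intro hv
    exact ⟨e.symm ⟨v, hv⟩, by simp⟩

/-- A choice of an ordering for every unordered configuration. -/
def ordering (q : UConf N d) : OConf N d := surjInv proj_surjective q

theorem proj_ordering (q : UConf N d) : proj (ordering q) = q := surjInv_eq proj_surjective q

/-- The topology (and manifold structure) of the unordered configuration space is that of the
quotient of the ordered collision-free configurations by the permutations. -/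
instance : TopologicalSpace (UConf N d) := .coinduced proj inferInstance

instance : MeasurableSpace (UConf N d) := borel _

instance : BorelSpace (UConf N d) := ⟨rfl⟩

theorem continuous_permute (σ : Equiv.Perm (Fin N)) :
    Continuous (OConf.permute σ : OConf N d → OConf N d) :=
  Continuous.subtype_mk ((permute σ).continuous.comp continuous_subtype_val) _

theorem isQuotientMap_proj : Topology.IsQuotientMap (proj : OConf N d → UConf N d) :=
  ⟨⟨rfl⟩, proj_surjective⟩

theorem isOpenMap_proj : IsOpenMap (proj : OConf N d → UConf N d) := by
  intro W hW
  rw [← isQuotientMap_proj.isOpen_preimage]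
  have : proj ⁻¹' (proj '' W) = ⋃ σ : Equiv.Perm (Fin N), OConf.permute σ ⁻¹' W := by
    ext x
    simp only [Set.mem_preimage, Set.mem_image, Set.mem_iUnion]
    constructor
    · rintro ⟨y, hy, hxy⟩
      obtain ⟨σ, rfl⟩ := (proj_eq_iff _ _).1 hxy.symm
      exact ⟨σ, hy⟩
    · rintro ⟨σ, hσ⟩
      exact ⟨_, hσ, proj_permute σ x⟩
  rw [this]
  exact isOpen_iUnion fun σ => hW.preimage (continuous_permute σ)

instance : SecondCountableTopology (UConf N d) :=
  isQuotientMap_proj.secondCountableTopology isOpenMap_proj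

theorem measurable_proj : Measurable (proj : OConf N d → UConf N d) :=
  isQuotientMap_proj.continuous.measurable

theorem isOpen_setOf_injective : IsOpen {x : Conf N d | Injective x} := by
  have : {x : Conf N d | Injective x} = ⋂ i : Fin N, ⋂ j : Fin N, {x | x i = x j → i = j} := by
    ext x
    simp [Injective]
  rw [this]
  refine isOpen_iInter_of_finite fun i => isOpen_iInter_of_finite fun j => ?_
  by_cases h : i = j
  · simp [h]
  · simp only [h, imp_false]
    exact (isClosed_eq (PiLp.continuous_apply 2 _ i) (PiLp.continuous_apply 2 _ j)).isOpen_compl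

/-- The Riemannian volume measure on the unordered configuration space. The projection `proj` is an
`N!`-to-one local isometry, so the push-forward of Lebesgue measure counts every piece of volume
`N!` times; see `volume_image_proj`. -/
instance : MeasureSpace (UConf N d) where
  volume := (N.factorial : ENNReal)⁻¹ •
    Measure.map proj (Measure.comap (Subtype.val : OConf N d → Conf N d) volume)

theorem permute_eq_self_iff (σ : Equiv.Perm (Fin N)) (x : OConf N d) :
    OConf.permute σ x = x ↔ σ = 1 := by
  constructor
  · intro h
    ext j
    have h1 : (OConf.permute σ x).1 j = x.1 j := by rw [h]
    simpa using congrArg Fin.val (x.2 (by simpa [OConf.permute] using h1 : x.1 (σ j) = x.1 j))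
  · rintro rfl
    apply Subtype.ext
    ext1 j
    simp [OConf.permute]

theorem permute_permute (σ τ : Equiv.Perm (Fin N)) (x : OConf N d) :
    OConf.permute σ (OConf.permute τ x) = OConf.permute (τ * σ) x := by
  apply Subtype.ext
  ext1 j
  simp [OConf.permute]

theorem volume_image_proj {B : Set (OConf N d)} (hB : IsOpen B) (hinj : Set.InjOn proj B) :
    volume (proj '' B) = volume (Subtype.val '' B : Set (Conf N d)) := by
  have hme : MeasurableEmbedding (Subtype.val : OConf N d → Conf N d) :=
    MeasurableEmbedding.subtype_coe isOpen_setOf_injective.measurableSet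
  have h1 : proj ⁻¹' (proj '' B) = ⋃ σ : Equiv.Perm (Fin N), OConf.permute σ ⁻¹' B := by
    ext x
    simp only [Set.mem_preimage, Set.mem_image, Set.mem_iUnion]
    constructor
    · rintro ⟨y, hy, hxy⟩
      obtain ⟨σ, rfl⟩ := (proj_eq_iff _ _).1 hxy.symm
      exact ⟨σ, hy⟩
    · rintro ⟨σ, hσ⟩
      exact ⟨_, hσ, proj_permute σ x⟩
  have h2 : Pairwise (Disjoint on fun σ : Equiv.Perm (Fin N) => OConf.permute σ ⁻¹' B) := by
    intro σ τ hστ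
    refine Set.disjoint_left.2 fun x hx hx' => hστ ?_
    have h := hinj hx hx' (by rw [proj_permute, proj_permute])
    have h' := congrArg (OConf.permute τ⁻¹) h
    rw [permute_permute, permute_permute, mul_inv_cancel, (permute_eq_self_iff 1 x).2 rfl,
      permute_eq_self_iff] at h'
    exact mul_inv_eq_one.1 h'
  have h3 : ∀ σ : Equiv.Perm (Fin N),
      Measure.comap (Subtype.val : OConf N d → Conf N d) volume (OConf.permute σ ⁻¹' B) =
        volume (Subtype.val '' B : Set (Conf N d)) := by
    intro σ
    rw [hme.comap_apply, ← ((permute σ).measurePreserving).measure_preimage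
      (hme.measurableSet_image.2 hB.measurableSet).nullMeasurableSet]
    congr 1
    ext x
    simp only [Set.mem_image, Set.mem_preimage, Subtype.exists, exists_and_right, exists_eq_right]
    constructor
    · rintro ⟨hx, h⟩
      exact ⟨(OConf.permute σ ⟨x, hx⟩).2, h⟩
    · rintro ⟨hx, h⟩
      refine ⟨fun i j hij => ?_, h⟩
      have := @hx (σ.symm i) (σ.symm j) (by simpa using hij)
      simpa using this
  change ((N.factorial : ENNReal)⁻¹ • Measure.map proj _) (proj '' B) = _
  rw [Measure.smul_apply, Measure.map_apply measurable_proj (isOpenMap_proj B hB).measurableSet,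
    h1, measure_iUnion h2 fun σ => (hB.preimage (continuous_permute σ)).measurableSet,
    tsum_fintype, Finset.sum_congr rfl fun σ _ => h3 σ, Finset.sum_const, Finset.card_univ,
    Fintype.card_perm, Fintype.card_fin, nsmul_eq_mul, smul_eq_mul, ← mul_assoc,
    ENNReal.inv_mul_cancel (by exact_mod_cast N.factorial_ne_zero) (ENNReal.natCast_ne_top _),
    one_mul]

/-- The set `π⁻¹(A)` of (collision-free) orderings of the configurations in `A`. -/
def preim (A : Set (UConf N d)) : Set (Conf N d) := {x | ∃ h : Injective x, proj ⟨x, h⟩ ∈ A}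

open Classical in
/-- The lift `f ∘ π` of a function `f` on unordered configurations to ordered collision-free
configurations, extended by zero to all of `ℝᴺᵈ`. -/
def pullback (f : UConf N d → ℂ) (x : Conf N d) : ℂ :=
  if h : Injective x then f (proj ⟨x, h⟩) else 0

/-- The standard orthonormal basis vectors of `ℝᴺᵈ`: the `k`-th unit vector in the place of
particle `j`. -/
def unitVec (j : Fin N) (k : Fin d) : Conf N d :=
  WithLp.toLp 2 (Pi.single j (EuclideanSpace.single k (1 : ℝ)))

/-! ## Hermitian line bundles over the unordered configuration space -/

set_option linter.checkUnivs false in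
/-- A smooth Hermitian line bundle with metric connection over the unordered configuration space.
It consists of one-dimensional complex inner product spaces `Fiber q`, and an atlas of local unitary
frames `frame i` over open sets `baseSet i` with smooth transition functions. The connection is
given in the frame `e = frame i` by a smooth 1-form `form i`, through
`∇_v (u e) = (∂_v u + i (form i)(v) u) e`. The form is real because the connection is
metric and `e` is unitary. Functions and forms on `baseSet i` are described by their lifts to
ordered configurations, on which `proj` is a local diffeomorphism. -/
structure HermitianLineBundle (N d : ℕ) where
  Fiber : UConf N d → Type u
  [normed : ∀ q, NormedAddCommGroup (Fiber q)]
  [innerProd : ∀ q, InnerProductSpace ℂ (Fiber q)]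
  finrank_eq_one : ∀ q, Module.finrank ℂ (Fiber q) = 1
  /-- labels of the local frames -/
  Index : Type v
  baseSet : Index → Set (UConf N d)
  isOpen_baseSet : ∀ i, IsOpen (baseSet i)
  /-- a frame around each point -/
  indexAt : UConf N d → Index
  mem_baseSet_at : ∀ q, q ∈ baseSet (indexAt q)
  frame : Index → ∀ q, Fiber q
  norm_frame : ∀ i, ∀ q ∈ baseSet i, ‖frame i q‖ = 1
  smooth_transition : ∀ i j, ContDiffOn ℝ ∞ (pullback fun q => ⟪frame i q, frame j q⟫_ℂ)
    (preim (baseSet i ∩ baseSet j))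
  form : Index → Conf N d → Conf N d →L[ℝ] ℝ
  smooth_form : ∀ i, ContDiffOn ℝ ∞ (form i) (preim (baseSet i))
  /-- `form i` is the lift of a 1-form on `baseSet i` -/
  form_permute : ∀ i, ∀ x ∈ preim (baseSet i), ∀ (σ : Equiv.Perm (Fin N)) (v : Conf N d),
    form i (permute σ x) (permute σ v) = form i x v
  /-- the forms of two frames describe the same connection: if `frame j = g • frame i` then
  `dg = i (form j - form i) g` -/
  form_transition : ∀ i j, ∀ x ∈ preim (baseSet i ∩ baseSet j), ∀ v : Conf N d,
    fderiv ℝ (pullback fun q => ⟪frame i q, frame j q⟫_ℂ) x v =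
      Complex.I * (form j x v - form i x v) * pullback (fun q => ⟪frame i q, frame j q⟫_ℂ) x

namespace HermitianLineBundle

attribute [instance] HermitianLineBundle.normed HermitianLineBundle.innerProd

variable (F : HermitianLineBundle.{u, v} N d)

/-- The coefficient of the cross-section `ψ` in the local frame `i`. -/
def coeff (i : F.Index) (ψ : ∀ q, F.Fiber q) (q : UConf N d) : ℂ := ⟪F.frame i q, ψ q⟫_ℂ

/-! ### Parallel transport and holonomy -/

/-- `s` is a parallel section of `F` along the piecewise smooth curve `α = π ∘ γ`, where
`γ : [0,1] → OConf N d` (only the times in `[0,1]` matter). As `π` is a covering, every piecewise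
smooth curve in the unordered configuration space is of this form. -/
def IsParallelAlong (γ : ℝ → OConf N d) (s : ∀ τ, F.Fiber (proj (γ τ))) : Prop :=
  ∃ (n : ℕ) (t : Fin (n + 1) → ℝ), StrictMono t ∧ t 0 = 0 ∧ t (Fin.last n) = 1 ∧
    ∀ k : Fin n, ContDiffOn ℝ ∞ (fun τ => (γ τ).1) (Set.Icc (t k.castSucc) (t k.succ)) ∧
      ∀ i, ∀ τ ∈ Set.Icc (t k.castSucc) (t k.succ), proj (γ τ) ∈ F.baseSet i →
        HasDerivWithinAt (fun τ' => ⟪F.frame i (proj (γ τ')), s τ'⟫_ℂ)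
          (-(Complex.I * F.form i (γ τ).1
              (derivWithin (fun τ' => (γ τ').1) (Set.Icc (t k.castSucc) (t k.succ)) τ) *
            ⟪F.frame i (proj (γ τ)), s τ⟫_ℂ))
          (Set.Icc (t k.castSucc) (t k.succ)) τ

/-- `F` is the fermionic line bundle: the holonomy of every closed curve `α` is the sign of the
permutation defined by `α`. If `α` is lifted to the curve `γ` of ordered configurations, then `α` is
closed iff `γ(1)` is a relabelling of `γ(0)`, and the permutation of `α(0)` defined by `α` sends the
starting point `γ(0)_j` to the end point `γ(1)_j = γ(0)_{σ(j)}`, so that its sign is that of `σ`. -/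
def IsFermionic : Prop :=
  ∀ (γ : ℝ → OConf N d) (s : ∀ τ, F.Fiber (proj (γ τ))), F.IsParallelAlong γ s →
    ∀ (σ : Equiv.Perm (Fin N)) (h : γ 1 = OConf.permute σ (γ 0)),
      cast (congrArg F.Fiber ((congrArg proj h).trans (proj_permute σ (γ 0)))) (s 1) =
        ((Equiv.Perm.sign σ : ℤ) : ℂ) • s 0

/-- A global trivialization of the pull-back of `F` to the ordered collision-free configurations:
unitary maps of the fibers onto `ℂ`, compatible with parallel transport along all curves. -/
structure Trivialization where
  toFun : ∀ x : OConf N d, F.Fiber (proj x) ≃ₗᵢ[ℂ] ℂ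
  parallel : ∀ (γ : ℝ → OConf N d) (s : ∀ τ, F.Fiber (proj (γ τ))), F.IsParallelAlong γ s →
    toFun (γ 1) (s 1) = toFun (γ 0) (s 0)

/-! ### The Hilbert space of square-integrable cross-sections -/

/-- Measurability of a cross-section (in the local frames). -/
def IsMeasurable (ψ : ∀ q, F.Fiber q) : Prop :=
  ∀ i, Measurable fun q : F.baseSet i => F.coeff i ψ q

variable {F}

theorem inner_eq_coeff_mul (i : F.Index) {q : UConf N d} (hq : q ∈ F.baseSet i)
    (φ ψ : ∀ q, F.Fiber q) :
    ⟪φ q, ψ q⟫_ℂ = (starRingEnd ℂ) (F.coeff i φ q) * F.coeff i ψ q := by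
  have hn := F.norm_frame i q hq
  have h0 : F.frame i q ≠ 0 := by
    intro h
    simp [h] at hn
  obtain ⟨c, hc⟩ := (finrank_eq_one_iff_of_nonzero' _ h0).1 (F.finrank_eq_one q) (ψ q)
  have h1 : ⟪F.frame i q, F.frame i q⟫_ℂ = 1 := by
    rw [inner_self_eq_norm_sq_to_K, hn]
    simp
  rw [coeff, coeff, ← hc, inner_smul_right, inner_smul_right, h1, inner_conj_symm]
  ring

theorem IsMeasurable.inner {φ ψ : ∀ q, F.Fiber q} (hφ : F.IsMeasurable φ) (hψ : F.IsMeasurable ψ) :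
    Measurable fun q => ⟪φ q, ψ q⟫_ℂ := by
  obtain ⟨T, hT, hTU⟩ := TopologicalSpace.isOpen_iUnion_countable F.baseSet F.isOpen_baseSet
  have hcov : ∀ q, ∃ i ∈ T, q ∈ F.baseSet i := by
    intro q
    have : q ∈ ⋃ i, F.baseSet i := Set.mem_iUnion.2 ⟨_, F.mem_baseSet_at q⟩
    rw [← hTU] at this
    simpa using this
  intro S hS
  have : (fun q => ⟪φ q, ψ q⟫_ℂ) ⁻¹' S = ⋃ i ∈ T, Subtype.val ''
      ((fun q : F.baseSet i => (starRingEnd ℂ) (F.coeff i φ q) * F.coeff i ψ q) ⁻¹' S) := by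
    ext q
    simp only [Set.mem_preimage, Set.mem_iUnion, Set.mem_image, Subtype.exists, exists_and_right,
      exists_eq_right, exists_prop]
    constructor
    · intro h
      obtain ⟨i, hi, hq⟩ := hcov q
      exact ⟨i, ⟨hi, hq⟩, by rwa [← inner_eq_coeff_mul i hq]⟩
    · rintro ⟨i, ⟨hi, hq⟩, h⟩
      rwa [inner_eq_coeff_mul i hq]
  rw [this]
  refine MeasurableSet.biUnion hT fun i _ => ?_
  refine MeasurableSet.subtype_image (F.isOpen_baseSet i).measurableSet ?_
  exact ((Complex.continuous_conj.measurable.comp (hφ i)).mul (hψ i)) hS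

theorem IsMeasurable.norm {ψ : ∀ q, F.Fiber q} (hψ : F.IsMeasurable ψ) :
    Measurable fun q => ‖ψ q‖ := by
  have h := (hψ.inner hψ).norm.sqrt
  convert h using 2 with q
  rw [inner_self_eq_norm_sq_to_K]
  simp

variable (F)

/-- The measurable cross-sections `ψ` with `∫ ⟪ψ(q), ψ(q)⟫_q dq < ∞`. -/
def sqIntegrable : Submodule ℂ (∀ q, F.Fiber q) where
  carrier := {ψ | F.IsMeasurable ψ ∧ Integrable (fun q => ‖ψ q‖ ^ 2)}
  zero_mem' := by
    refine ⟨fun i => ?_, by simp⟩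
    simp [coeff]
  add_mem' := by
    rintro φ ψ ⟨hφ, hφ'⟩ ⟨hψ, hψ'⟩
    have hm : F.IsMeasurable (φ + ψ) := fun i => by
      simp only [coeff, Pi.add_apply, inner_add_right]
      exact (hφ i).add (hψ i)
    refine ⟨hm, ((hφ'.add hψ').const_mul 2).mono' (hm.norm.pow_const 2).aestronglyMeasurable ?_⟩
    filter_upwards with q
    have h1 : ‖φ q + ψ q‖ ≤ ‖φ q‖ + ‖ψ q‖ := norm_add_le _ _
    simp only [Pi.add_apply, norm_pow, norm_norm]
    nlinarith [sq_nonneg (‖φ q‖ - ‖ψ q‖), norm_nonneg (φ q + ψ q)]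
  smul_mem' := by
    rintro c ψ ⟨hψ, hψ'⟩
    refine ⟨fun i => ?_, ?_⟩
    · simpa [coeff, inner_smul_right] using (hψ i).const_mul c
    · simpa [norm_smul, mul_pow] using hψ'.const_mul (‖c‖ ^ 2)

/-- The space of square-integrable cross-sections, before identifying a.e. equal ones. -/
def SqIntSection : Type u := F.sqIntegrable

instance : AddCommGroup F.SqIntSection := inferInstanceAs (AddCommGroup F.sqIntegrable)

instance : Module ℂ F.SqIntSection := inferInstanceAs (Module ℂ F.sqIntegrable)

variable {F}

theorem integrable_inner (φ ψ : F.SqIntSection) : Integrable fun q => ⟪φ.1 q, ψ.1 q⟫_ℂ := by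
  refine (φ.2.2.add ψ.2.2).mono' (φ.2.1.inner ψ.2.1).aestronglyMeasurable ?_
  filter_upwards with q
  have h1 : ‖⟪φ.1 q, ψ.1 q⟫_ℂ‖ ≤ ‖φ.1 q‖ * ‖ψ.1 q‖ := norm_inner_le_norm _ _
  simp only [Pi.add_apply]
  nlinarith [sq_nonneg (‖φ.1 q‖ - ‖ψ.1 q‖), sq_nonneg (‖φ.1 q‖), sq_nonneg (‖ψ.1 q‖)]

/-- The (semi-definite) inner product `⟨φ, ψ⟩ = ∫ ⟪φ(q), ψ(q)⟫_q dq`. -/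
instance sqIntCore : PreInnerProductSpace.Core ℂ F.SqIntSection where
  inner φ ψ := ∫ q, ⟪φ.1 q, ψ.1 q⟫_ℂ
  conj_inner_symm φ ψ := by
    rw [← integral_conj]
    simp only [inner_conj_symm]
  re_inner_nonneg φ := by
    have h : (∫ q, ⟪φ.1 q, φ.1 q⟫_ℂ) = ((∫ q, ‖φ.1 q‖ ^ 2 : ℝ) : ℂ) := by
      rw [← integral_complex_ofReal]
      congr 1
      ext q
      rw [inner_self_eq_norm_sq_to_K]
      simp
    rw [h]
    simpa using integral_nonneg fun q => sq_nonneg ‖φ.1 q‖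
  add_left φ ψ χ := by
    rw [← integral_add (integrable_inner φ χ) (integrable_inner ψ χ)]
    congr 1
    ext q
    exact inner_add_left _ _ _
  smul_left φ ψ c := by
    rw [← integral_const_mul]
    congr 1
    ext q
    exact inner_smul_left _ _ _

instance : SeminormedAddCommGroup F.SqIntSection :=
  InnerProductSpace.Core.toSeminormedAddCommGroup (𝕜 := ℂ)

instance : InnerProductSpace ℂ F.SqIntSection := InnerProductSpace.ofCore sqIntCore

theorem norm_sq_sqIntSection (φ : F.SqIntSection) : ‖φ‖ ^ 2 = ∫ q, ‖φ.1 q‖ ^ 2 := by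
  have h : ⟪φ, φ⟫_ℂ = ((∫ q, ‖φ.1 q‖ ^ 2 : ℝ) : ℂ) := by
    change (∫ q, ⟪φ.1 q, φ.1 q⟫_ℂ) = _
    rw [← integral_complex_ofReal]
    congr 1
    ext q
    rw [inner_self_eq_norm_sq_to_K]
    simp
  rw [inner_self_eq_norm_sq_to_K] at h
  exact Complex.ofReal_injective (by simpa using h)

variable (F)

/-- The Hilbert space `L²(F)`: square-integrable cross-sections modulo those of norm zero, i.e.
modulo equality almost everywhere. -/
abbrev L2 : Type u := SeparationQuotient F.SqIntSection

variable {F} in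
/-- The class of a square-integrable cross-section. -/
abbrev toL2 (ψ : F.SqIntSection) : F.L2 := SeparationQuotient.mk ψ

theorem toL2_eq_iff (φ ψ : F.SqIntSection) : toL2 φ = toL2 ψ ↔ ∀ᵐ q, φ.1 q = ψ.1 q := by
  rw [SeparationQuotient.mk_eq_mk, Metric.inseparable_iff, dist_eq_norm, ← sq_eq_zero_iff,
    norm_sq_sqIntSection, integral_eq_zero_iff_of_nonneg (fun q => sq_nonneg _) (φ - ψ).2.2]
  refine Filter.eventually_congr (Filter.Eventually.of_forall fun q => ?_)
  have : (φ - ψ).1 q = φ.1 q - ψ.1 q := rfl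
  simp [this, sub_eq_zero]

/-! ### The position observable on `L²(F)` -/

open Classical in
/-- The cross-section `q ↦ 1_A(q) ψ(q)`. -/
def cutoff (A : Set (UConf N d)) (ψ : ∀ q, F.Fiber q) : ∀ q, F.Fiber q :=
  fun q => if q ∈ A then ψ q else 0

variable {F} in
theorem cutoff_mem {A : Set (UConf N d)} (hA : MeasurableSet A) {ψ : ∀ q, F.Fiber q}
    (hψ : ψ ∈ F.sqIntegrable) : F.cutoff A ψ ∈ F.sqIntegrable := by
  classical
  have hm : F.IsMeasurable (F.cutoff A ψ) := fun i => by
    have : (fun q : F.baseSet i => F.coeff i (F.cutoff A ψ) q) =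
        fun q : F.baseSet i => if (q : UConf N d) ∈ A then F.coeff i ψ q else 0 := by
      ext q
      by_cases h : (q : UConf N d) ∈ A <;> simp [coeff, cutoff, h]
    rw [this]
    exact Measurable.ite (measurable_subtype_coe hA) (hψ.1 i) measurable_const
  refine ⟨hm, hψ.2.mono' (hm.norm.pow_const 2).aestronglyMeasurable ?_⟩
  filter_upwards with q
  by_cases h : q ∈ A <;> simp [cutoff, h]

/-- The map `ψ ↦ 1_A ψ` on square-integrable cross-sections. -/
def cutoffLM (A : Set (UConf N d)) (hA : MeasurableSet A) :
    F.SqIntSection →ₗ[ℂ] F.SqIntSection where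
  toFun ψ := ⟨F.cutoff A ψ.1, cutoff_mem hA ψ.2⟩
  map_add' φ ψ := by
    apply Subtype.ext
    funext q
    change F.cutoff A (φ.1 + ψ.1) q = F.cutoff A φ.1 q + F.cutoff A ψ.1 q
    by_cases h : q ∈ A <;> simp [cutoff, h]
  map_smul' c ψ := by
    apply Subtype.ext
    funext q
    change F.cutoff A (c • ψ.1) q = c • F.cutoff A ψ.1 q
    by_cases h : q ∈ A <;> simp [cutoff, h]

theorem norm_cutoffLM_le (A : Set (UConf N d)) (hA : MeasurableSet A) (ψ : F.SqIntSection) :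
    ‖F.cutoffLM A hA ψ‖ ≤ 1 * ‖ψ‖ := by
  rw [one_mul, ← sq_le_sq₀ (norm_nonneg _) (norm_nonneg _), norm_sq_sqIntSection,
    norm_sq_sqIntSection]
  refine integral_mono (F.cutoffLM A hA ψ).2.2 ψ.2.2 fun q => ?_
  change ‖F.cutoff A ψ.1 q‖ ^ 2 ≤ _
  by_cases h : q ∈ A <;> simp [cutoff, h]

/-- The position observable `Q_F(A) ψ = 1_A ψ` on `L²(F)`. -/
def posObs (A : Set (UConf N d)) (hA : MeasurableSet A) : F.L2 →L[ℂ] F.L2 :=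
  SeparationQuotient.liftCLM
    ((SeparationQuotient.mkCLM ℂ F.SqIntSection).comp
      ((F.cutoffLM A hA).mkContinuous 1 (F.norm_cutoffLM_le A hA)))
    fun _ _ h => (h.map (ContinuousLinearMap.continuous _)).eq

theorem posObs_toL2 (A : Set (UConf N d)) (hA : MeasurableSet A) (ψ : F.SqIntSection) :
    F.posObs A hA (toL2 ψ) = toL2 ⟨F.cutoff A ψ.1, cutoff_mem hA ψ.2⟩ := rfl

/-! ### The Laplacian and the Hamiltonian -/

/-- Smooth cross-sections. -/
def IsSmooth (ψ : ∀ q, F.Fiber q) : Prop :=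
  ∀ i, ContDiffOn ℝ ∞ (pullback (F.coeff i ψ)) (preim (F.baseSet i))

/-- Cross-sections with compact support. -/
def HasCompactSupp (ψ : ∀ q, F.Fiber q) : Prop :=
  ∃ K : Set (UConf N d), IsCompact K ∧ ∀ q ∉ K, ψ q = 0

/-- The covariant derivative in direction `v`, in the local frame `i`. -/
def covDeriv (i : F.Index) (v : Conf N d) (f : Conf N d → ℂ) (x : Conf N d) : ℂ :=
  fderiv ℝ f x v + Complex.I * F.form i x v * f x

/-- The Laplacian `Δψ = gᵃᵇ D_a D_b ψ` of a smooth cross-section. Around `q` it is expressed in a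
local frame and in the Cartesian coordinates given by the local isometry `proj`, in which
`gᵃᵇ = δᵃᵇ` and the Levi-Civita connection is the trivial one. -/
def laplacian (ψ : ∀ q, F.Fiber q) (q : UConf N d) : F.Fiber q :=
  (∑ j : Fin N, ∑ k : Fin d,
    F.covDeriv (F.indexAt q) (unitVec j k)
      (F.covDeriv (F.indexAt q) (unitVec j k) (pullback (F.coeff (F.indexAt q) ψ)))
      (ordering q).1) • F.frame (F.indexAt q) q

/-- The (graph of the) operator `-(ħ²/2m) Δ + V` on the smooth cross-sections with compact
support. -/
def rawHamiltonian (ħ m : ℝ) (V : Conf N d → ℝ) : Set (F.L2 × F.L2) :=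
  {p | ∃ φ χ : F.SqIntSection, F.IsSmooth φ.1 ∧ F.HasCompactSupp φ.1 ∧
    (∀ q, χ.1 q = -((ħ ^ 2 / (2 * m) : ℝ) : ℂ) • F.laplacian φ.1 q +
      (V (ordering q).1 : ℂ) • φ.1 q) ∧ p = (toL2 φ, toL2 χ)}

end HermitianLineBundle

/-! ### Existence of the fermionic line bundle -/

section Existence

open Topology

/-- The sign of the ordering `x` relative to the chosen ordering of `{x₁, …, x_N}`. -/
def orderingSign (x : OConf N d) : ℂ :=
  ((Equiv.Perm.sign (Classical.choose ((proj_eq_iff (ordering (proj x)) x).1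
    (proj_ordering (proj x)))) : ℤ) : ℂ)

theorem orderingSign_permute (σ : Equiv.Perm (Fin N)) (x : OConf N d) :
    orderingSign (OConf.permute σ x) = ((Equiv.Perm.sign σ : ℤ) : ℂ) * orderingSign x := by
  have h1 := Classical.choose_spec ((proj_eq_iff (ordering (proj x)) x).1 (proj_ordering (proj x)))
  have h2 := Classical.choose_spec ((proj_eq_iff (ordering (proj (OConf.permute σ x)))
    (OConf.permute σ x)).1 (proj_ordering (proj (OConf.permute σ x))))
  unfold orderingSign
  set τ := Classical.choose ((proj_eq_iff (ordering (proj x)) x).1 (proj_ordering (proj x)))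
  set ρ := Classical.choose ((proj_eq_iff (ordering (proj (OConf.permute σ x)))
    (OConf.permute σ x)).1 (proj_ordering (proj (OConf.permute σ x))))
  have h3 : ρ = τ * σ := by
    rw [proj_permute] at h2
    have h4 : OConf.permute σ (OConf.permute τ (ordering (proj x))) =
        OConf.permute ρ (ordering (proj x)) := by
      rw [← h1]
      exact h2
    rw [permute_permute] at h4
    have h5 := congrArg (OConf.permute ρ⁻¹) h4
    rw [permute_permute, permute_permute, mul_inv_cancel, (permute_eq_self_iff 1 _).2 rfl,
      permute_eq_self_iff] at h5
    exact (mul_inv_eq_one.1 h5).symm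
  rw [h3, Equiv.Perm.sign_mul]
  push_cast
  ring

theorem orderingSign_cases (x : OConf N d) : orderingSign x = 1 ∨ orderingSign x = -1 := by
  unfold orderingSign
  rcases Int.units_eq_one_or (Equiv.Perm.sign (Classical.choose
    ((proj_eq_iff (ordering (proj x)) x).1 (proj_ordering (proj x))))) with h | h <;> simp [h]

theorem exists_nhd_injOn (x : OConf N d) :
    ∃ W : Set (OConf N d), IsOpen W ∧ x ∈ W ∧ Set.InjOn proj W := by
  have h : ∀ σ : Equiv.Perm (Fin N), ∃ W : Set (OConf N d), IsOpen W ∧ x ∈ W ∧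
      (σ ≠ 1 → ∀ y ∈ W, OConf.permute σ y ∉ W) := by
    intro σ
    by_cases hσ : σ = 1
    · exact ⟨Set.univ, isOpen_univ, trivial, fun h => absurd hσ h⟩
    · have hne : x ≠ OConf.permute σ x := fun h => hσ ((permute_eq_self_iff σ x).1 h.symm)
      obtain ⟨A, B, hA, hB, hxA, hxB, hAB⟩ := t2_separation hne
      exact ⟨A ∩ OConf.permute σ ⁻¹' B, hA.inter (hB.preimage (continuous_permute σ)), ⟨hxA, hxB⟩,
        fun _ y hy hy' => Set.disjoint_left.1 hAB hy'.1 hy.2⟩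
  choose W hW hxW hWσ using h
  refine ⟨⋂ σ, W σ, isOpen_iInter_of_finite hW, Set.mem_iInter.2 hxW, fun y hy z hz hyz => ?_⟩
  obtain ⟨σ, rfl⟩ := (proj_eq_iff _ _).1 hyz
  by_cases hσ : σ = 1
  · exact ((permute_eq_self_iff σ y).2 hσ).symm
  · exact absurd (Set.mem_iInter.1 hz σ) (hWσ σ hσ y (Set.mem_iInter.1 hy σ))

/-- A neighborhood on which `proj` is injective. -/
def sheet (x : OConf N d) : Set (OConf N d) := Classical.choose (exists_nhd_injOn x)

theorem isOpen_sheet (x : OConf N d) : IsOpen (sheet x) :=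
  (Classical.choose_spec (exists_nhd_injOn x)).1

theorem mem_sheet (x : OConf N d) : x ∈ sheet x := (Classical.choose_spec (exists_nhd_injOn x)).2.1

theorem injOn_sheet (x : OConf N d) : Set.InjOn proj (sheet x) :=
  (Classical.choose_spec (exists_nhd_injOn x)).2.2

open Classical in
/-- The local frame which on the sheet around `x` is given by `orderingSign`. -/
def sheetFrame (x : OConf N d) (q : UConf N d) : ℂ :=
  if h : ∃ y ∈ sheet x, proj y = q then orderingSign (Classical.choose h) else 1

theorem sheetFrame_cases (x : OConf N d) (q : UConf N d) :
    sheetFrame x q = 1 ∨ sheetFrame x q = -1 := by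
  unfold sheetFrame
  split_ifs
  · exact orderingSign_cases _
  · exact Or.inl rfl

theorem sheetFrame_proj (x y : OConf N d) (hy : y ∈ sheet x) :
    sheetFrame x (proj y) = orderingSign y := by
  have h : ∃ z ∈ sheet x, proj z = proj y := ⟨y, hy, rfl⟩
  have h1 := Classical.choose_spec h
  unfold sheetFrame
  rw [dif_pos h, injOn_sheet x h1.1 hy h1.2]

theorem sheetFrame_eventually (x z : OConf N d) (hz : proj z ∈ proj '' sheet x) :
    ∃ c : ℂ, c ≠ 0 ∧ ∀ᶠ z' in 𝓝 z, sheetFrame x (proj z') = c * orderingSign z' := by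
  obtain ⟨y, hy, hyz⟩ := hz
  obtain ⟨σ, rfl⟩ := (proj_eq_iff _ _).1 hyz.symm
  refine ⟨((Equiv.Perm.sign σ : ℤ) : ℂ), by simp, ?_⟩
  filter_upwards [(continuous_permute σ).continuousAt.preimage_mem_nhds
    ((isOpen_sheet x).mem_nhds hy)] with z' hz'
  rw [← proj_permute σ z', sheetFrame_proj x _ hz', orderingSign_permute]

theorem pullback_sheetFrame_eventually (x y : OConf N d) (z : Conf N d)
    (hz : z ∈ preim (proj '' sheet x ∩ proj '' sheet y)) :
    ∃ c : ℂ, pullback (fun q => ⟪sheetFrame x q, sheetFrame y q⟫_ℂ) =ᶠ[𝓝 z] fun _ => c := by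
  obtain ⟨hi, hx, hy⟩ := hz
  obtain ⟨c, -, hc⟩ := sheetFrame_eventually x _ hx
  obtain ⟨c', -, hc'⟩ := sheetFrame_eventually y _ hy
  refine ⟨(starRingEnd ℂ) c * c', ?_⟩
  have h := hc.and hc'
  have hO := isOpen_setOf_injective.isOpenEmbedding_subtypeVal (X := Conf N d)
  have h2 := hO.map_nhds_eq ⟨z, hi⟩
  rw [Filter.EventuallyEq, ← h2, Filter.eventually_map]
  filter_upwards [h] with w hw
  have h3 : pullback (fun q => ⟪sheetFrame x q, sheetFrame y q⟫_ℂ) w.1 =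
      ⟪sheetFrame x (proj w), sheetFrame y (proj w)⟫_ℂ := by
    unfold pullback
    rw [dif_pos w.2]
  rw [h3, hw.1, hw.2]
  rcases orderingSign_cases w with h | h <;> simp [h, mul_comm]

variable (N d) in
/-- A realization of the fermionic line bundle. -/
def fermionicLineBundle : HermitianLineBundle.{0, 0} N d where
  Fiber := fun _ => ℂ
  finrank_eq_one := fun _ => Module.finrank_self ℂ
  Index := OConf N d
  baseSet x := proj '' sheet x
  isOpen_baseSet x := isOpenMap_proj _ (isOpen_sheet x)
  indexAt := ordering
  mem_baseSet_at q := ⟨ordering q, mem_sheet _, proj_ordering q⟩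
  frame := sheetFrame
  norm_frame x q _ := by rcases sheetFrame_cases x q with h | h <;> simp [h]
  smooth_transition x y z hz := by
    obtain ⟨c, hc⟩ := pullback_sheetFrame_eventually x y z hz
    exact (contDiffAt_const.congr_of_eventuallyEq hc).contDiffWithinAt
  form := fun _ _ => 0
  smooth_form _ := contDiffOn_const
  form_permute _ _ _ _ _ := rfl
  form_transition x y z hz v := by
    obtain ⟨c, hc⟩ := pullback_sheetFrame_eventually x y z hz
    rw [hc.fderiv_eq]
    simp

theorem isFermionic_fermionicLineBundle : (fermionicLineBundle N d).IsFermionic := by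
  rintro γ s ⟨n, t, ht, ht0, ht1, hpar⟩ σ h
  let s' : ℝ → ℂ := fun τ => s τ
  let f : ℝ → ℂ := fun τ => orderingSign (γ τ) * s' τ
  have hconst : ∀ k : Fin n, f (t k.succ) = f (t k.castSucc) := by
    intro k
    obtain ⟨hγ, hs⟩ := hpar k
    have hlt : t k.castSucc < t k.succ := ht (Fin.castSucc_lt_succ)
    have hd : ∀ τ ∈ Set.Icc (t k.castSucc) (t k.succ),
        HasDerivWithinAt f 0 (Set.Icc (t k.castSucc) (t k.succ)) τ := by
      intro τ hτ
      have hmem : proj (γ τ) ∈ proj '' sheet (ordering (proj (γ τ))) :=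
        (fermionicLineBundle N d).mem_baseSet_at (proj (γ τ))
      have h1 := hs (ordering (proj (γ τ))) τ hτ hmem
      obtain ⟨c, hc0, hc⟩ := sheetFrame_eventually _ _ hmem
      have hcont : ContinuousWithinAt γ (Set.Icc (t k.castSucc) (t k.succ)) τ :=
        Topology.IsInducing.subtypeVal.continuousWithinAt_iff.2 (hγ.continuousOn τ hτ)
      have h2 := hcont.eventually hc
      have h3 : (fun τ' => ((starRingEnd ℂ) c) * f τ') =ᶠ[𝓝[Set.Icc (t k.castSucc) (t k.succ)] τ]
          fun τ' => ⟪sheetFrame (ordering (proj (γ τ))) (proj (γ τ')), s' τ'⟫_ℂ := by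
        filter_upwards [h2] with τ' h'
        rw [h']
        rcases orderingSign_cases (γ τ') with h | h <;> simp [f, h, mul_comm]
      have h4 : HasDerivWithinAt (fun τ' => ((starRingEnd ℂ) c) * f τ') 0
          (Set.Icc (t k.castSucc) (t k.succ)) τ := by
        refine HasDerivWithinAt.congr_of_eventuallyEq ?_ h3 (h3.self_of_nhdsWithin hτ)
        refine HasDerivWithinAt.congr_deriv (g' := (0 : ℂ)) h1 ?_
        change -(Complex.I * ((0 : ℝ) : ℂ) * _) = (0 : ℂ)
        simp
      have hc0' : (starRingEnd ℂ) c ≠ 0 := by simpa using hc0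
      have h5 := h4.const_mul ((starRingEnd ℂ) c)⁻¹
      simpa [← mul_assoc, inv_mul_cancel₀ hc0'] using h5
    refine constant_of_has_deriv_right_zero (fun τ hτ => (hd τ hτ).continuousWithinAt)
      (fun τ hτ => ?_) _ (Set.right_mem_Icc.2 hlt.le)
    have := (hd τ ⟨hτ.1, hτ.2.le⟩)
    exact this.mono_of_mem_nhdsWithin (Icc_mem_nhdsGE_of_mem hτ)
  have hall : ∀ k : Fin (n + 1), f (t k) = f (t 0) := by
    intro k
    induction k using Fin.induction with
    | zero => rfl
    | succ k ih => exact (hconst k).trans ih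
  have h01 := hall (Fin.last n)
  rw [ht0, ht1] at h01
  simp only [f] at h01
  rw [h, orderingSign_permute] at h01
  change s' 1 = ((Equiv.Perm.sign σ : ℤ) : ℂ) * s' 0
  have hσ : ((Equiv.Perm.sign σ : ℤ) : ℂ) * ((Equiv.Perm.sign σ : ℤ) : ℂ) = 1 := by
    rcases Int.units_eq_one_or (Equiv.Perm.sign σ) with h | h <;> simp [h]
  have ho : orderingSign (γ 0) * orderingSign (γ 0) = 1 := by
    rcases orderingSign_cases (γ 0) with h | h <;> simp [h]
  linear_combination ((Equiv.Perm.sign σ : ℤ) : ℂ) * orderingSign (γ 0) * h01 -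
    s' 1 * ((orderingSign (γ 0) * orderingSign (γ 0)) * hσ + ho) +
      ((Equiv.Perm.sign σ : ℤ) : ℂ) * s' 0 * ho

end Existence

/-! ## Anti-symmetric wave functions -/

theorem measurePreserving_permute (σ : Equiv.Perm (Fin N)) :
    MeasurePreserving (permute σ : Conf N d → Conf N d) volume volume :=
  (permute σ).measurePreserving

variable (N d) in
/-- The space of anti-symmetric square-integrable functions on `ℝᴺᵈ`. -/
def AntiL2 : Submodule ℂ (Lp ℂ 2 (volume : Measure (Conf N d))) where
  carrier := {f | ∀ σ : Equiv.Perm (Fin N), ∀ᵐ x,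
    f (permute σ x) = ((Equiv.Perm.sign σ : ℤ) : ℂ) * f x}
  zero_mem' := fun σ => by
    have h := Lp.coeFn_zero ℂ 2 (volume : Measure (Conf N d))
    filter_upwards [h, (measurePreserving_permute σ).quasiMeasurePreserving.ae h] with x h1 h2
    rw [h1, h2]; simp
  add_mem' := fun {f g} hf hg σ => by
    have h := Lp.coeFn_add f g
    filter_upwards [h, (measurePreserving_permute σ).quasiMeasurePreserving.ae h, hf σ, hg σ]
      with x h1 h2 h3 h4
    simp only [Pi.add_apply] at h1 h2
    rw [h1, h2, h3, h4, mul_add]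
  smul_mem' := fun c f hf σ => by
    have h := Lp.coeFn_smul c f
    filter_upwards [h, (measurePreserving_permute σ).quasiMeasurePreserving.ae h, hf σ]
      with x h1 h2 h3
    simp only [Pi.smul_apply, smul_eq_mul] at h1 h2
    rw [h1, h2, h3]
    ring

theorem measurableSet_preim {A : Set (UConf N d)} (hA : MeasurableSet A) :
    MeasurableSet (preim A) := by
  have : preim A = Subtype.val '' ((proj : OConf N d → UConf N d) ⁻¹' A) := by
    ext x
    simp [preim]
  rw [this]
  exact isOpen_setOf_injective.measurableSet.subtype_image (measurable_proj hA)

theorem permute_mem_preim (A : Set (UConf N d)) (σ : Equiv.Perm (Fin N)) (x : Conf N d) :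
    permute σ x ∈ preim A ↔ x ∈ preim A := by
  have key : ∀ (σ : Equiv.Perm (Fin N)) (x : Conf N d), x ∈ preim A → permute σ x ∈ preim A := by
    rintro σ x ⟨h, hx⟩
    refine ⟨(OConf.permute σ ⟨x, h⟩).2, ?_⟩
    have := proj_permute σ ⟨x, h⟩
    rw [← this] at hx
    exact hx
  refine ⟨fun h => ?_, key σ x⟩
  have := key σ⁻¹ _ h
  convert this
  ext1 j
  simp

theorem indicator_mem_antiL2 {A : Set (UConf N d)} (hA : MeasurableSet A) (f : AntiL2 N d) :
    ((Lp.memLp f.1).indicator (measurableSet_preim hA)).toLp _ ∈ AntiL2 N d := by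
  intro σ
  have h := ((Lp.memLp f.1).indicator (measurableSet_preim hA)).coeFn_toLp
  filter_upwards [h, (measurePreserving_permute σ).quasiMeasurePreserving.ae h, f.2 σ]
    with x h1 h2 h3
  rw [h1, h2]
  by_cases hx : x ∈ preim A
  · rw [Set.indicator_of_mem hx, Set.indicator_of_mem ((permute_mem_preim A σ x).2 hx), h3]
  · rw [Set.indicator_of_notMem hx,
      Set.indicator_of_notMem (fun h => hx ((permute_mem_preim A σ x).1 h)), mul_zero]

/-- The function `1_{π⁻¹(A)} f`. -/
def antiCutoff (A : Set (UConf N d)) (hA : MeasurableSet A) (f : AntiL2 N d) : AntiL2 N d :=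
  ⟨((Lp.memLp f.1).indicator (measurableSet_preim hA)).toLp _, indicator_mem_antiL2 hA f⟩

theorem antiCutoff_ae (A : Set (UConf N d)) (hA : MeasurableSet A) (f : AntiL2 N d) :
    (antiCutoff A hA f).1 =ᵐ[volume] (preim A).indicator f.1 :=
  ((Lp.memLp f.1).indicator (measurableSet_preim hA)).coeFn_toLp

/-- The map `f ↦ 1_{π⁻¹(A)} f` on anti-symmetric functions. -/
def antiCutoffLM (A : Set (UConf N d)) (hA : MeasurableSet A) : AntiL2 N d →ₗ[ℂ] AntiL2 N d where
  toFun f := antiCutoff A hA f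
  map_add' f g := by
    apply Subtype.ext
    apply Lp.ext
    filter_upwards [Lp.coeFn_add f.1 g.1, Lp.coeFn_add (antiCutoff A hA f).1 (antiCutoff A hA g).1,
      antiCutoff_ae A hA f, antiCutoff_ae A hA g, antiCutoff_ae A hA (f + g)] with x h1 h2 h3 h4 h5
    rw [Submodule.coe_add, h2, h5, Pi.add_apply, h3, h4]
    by_cases h : x ∈ preim A
    · simpa [h] using h1
    · simp [h]
  map_smul' c f := by
    apply Subtype.ext
    apply Lp.ext
    filter_upwards [Lp.coeFn_smul c f.1, Lp.coeFn_smul c (antiCutoff A hA f).1,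
      antiCutoff_ae A hA f, antiCutoff_ae A hA (c • f)] with x h1 h2 h3 h4
    rw [RingHom.id_apply, Submodule.coe_smul, h2, h4, Pi.smul_apply, h3]
    by_cases h : x ∈ preim A
    · simpa [h] using h1
    · simp [h]

theorem norm_antiCutoffLM_le (A : Set (UConf N d)) (hA : MeasurableSet A) (f : AntiL2 N d) :
    ‖antiCutoffLM A hA f‖ ≤ 1 * ‖f‖ := by
  rw [one_mul]
  refine Lp.norm_le_norm_of_ae_le ?_
  filter_upwards [antiCutoff_ae A hA f] with x hx
  exact (congrArg norm hx).trans_le (norm_indicator_le_norm_self _ _)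

/-- The unordered position observable `Q_Anti(A) f = 1_{π⁻¹(A)} f` on anti-symmetric functions. -/
def antiPosObs (A : Set (UConf N d)) (hA : MeasurableSet A) : AntiL2 N d →L[ℂ] AntiL2 N d :=
  (antiCutoffLM A hA).mkContinuous 1 (norm_antiCutoffLM_le A hA)

/-- The (graph of the) operator `-(ħ²/2m) Δ + V` on the anti-symmetric smooth functions with compact
support. -/
def antiRawHamiltonian (ħ m : ℝ) (V : Conf N d → ℝ) : Set (AntiL2 N d × AntiL2 N d) :=
  {p | ∃ f : Conf N d → ℂ, ContDiff ℝ ∞ f ∧ HasCompactSupport f ∧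
    (∀ (σ : Equiv.Perm (Fin N)) (x : Conf N d),
      f (permute σ x) = ((Equiv.Perm.sign σ : ℤ) : ℂ) * f x) ∧
    (∀ᵐ x, p.1.1 x = f x) ∧
    ∀ᵐ x, p.2.1 x = -((ħ ^ 2 / (2 * m) : ℝ) : ℂ) * Laplacian.laplacian f x + (V x : ℂ) * f x}

/-! ## Quantum triples -/

section QuantumTriples

variable {Ω : Type*} [MeasurableSpace Ω]
  {E : Type*} [NormedAddCommGroup E] [InnerProductSpace ℂ E]
  {E' : Type*} [NormedAddCommGroup E'] [InnerProductSpace ℂ E']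

/-- Projection-valued measures on `Ω` acting on `E`. -/
structure IsPVM (Q : ∀ A : Set Ω, MeasurableSet A → (E →L[ℂ] E)) : Prop where
  isProjection : ∀ A hA, (Q A hA : E →ₗ[ℂ] E).IsSymmetricProjection
  univ : Q Set.univ .univ = 1
  iUnion : ∀ (A : ℕ → Set Ω) (hA : ∀ n, MeasurableSet (A n)), Pairwise (Disjoint on A) →
    ∀ ψ : E, HasSum (fun n => Q (A n) (hA n) ψ) (Q (⋃ n, A n) (.iUnion hA) ψ)

/-- `H` is a self-adjoint operator in the Hilbert space `E` (in particular densely defined, by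
`IsSelfAdjoint.dense_domain`). -/
def IsSelfAdjointOp (H : E →ₗ.[ℂ] E) : Prop :=
  ∃ _ : CompleteSpace E, IsSelfAdjoint H

/-- `H` is a self-adjoint operator that extends the operator with graph `G`. -/
def IsSelfAdjointExtension (G : Set (E × E)) (H : E →ₗ.[ℂ] E) : Prop :=
  IsSelfAdjointOp H ∧ G ⊆ H.graph

/-- `(E, H, Q)` is a quantum triple: a Hilbert space, a self-adjoint operator and a PVM. -/
structure IsQuantumTriple (H : E →ₗ.[ℂ] E) (Q : ∀ A : Set Ω, MeasurableSet A → (E →L[ℂ] E)) :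
    Prop where
  complete : CompleteSpace E
  selfAdjoint : IsSelfAdjointOp H
  isPVM : IsPVM Q

/-- The unitary `U` is an equivalence of the triples `(E, H, Q)` and `(E', H', Q')`: it maps the
domain of `H` onto that of `H'`, `H' = U H U⁻¹`, and `Q'(A) = U Q(A) U⁻¹` for all measurable `A`. -/
structure IsTripleEquiv (U : E ≃ₗᵢ[ℂ] E')
    (H : E →ₗ.[ℂ] E) (Q : ∀ A : Set Ω, MeasurableSet A → (E →L[ℂ] E))
    (H' : E' →ₗ.[ℂ] E') (Q' : ∀ A : Set Ω, MeasurableSet A → (E' →L[ℂ] E')) : Prop where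
  domain : U '' (H.domain : Set E) = H'.domain
  hamiltonian : ∀ (φ : H.domain) (φ' : H'.domain), (φ' : E') = U φ → H' φ' = U (H φ)
  observable : ∀ (A : Set Ω) (hA : MeasurableSet A) (φ' : E'), Q' A hA φ' = U (Q A hA (U.symm φ'))

end QuantumTriples

end

/-!
# The fermionic line bundle and anti-symmetric wave functions

The Hamiltonian on anti-symmetric test functions is essentially self-adjoint. A pair `(g, h)` in the
graph of its adjoint satisfies `-(ħ²/2m) Δg = h - V g` weakly, first only against anti-symmetric
test functions but then against all of them, because pairing an anti-symmetric function with `φ` or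
with the anti-symmetrization of `φ` gives the same result up to the factor `N!`
(`exists_weakLaplacian_of_mem_adjointRel`). As `V` is bounded, `Δg` is in `L²`, and the Fourier
transform turns it into multiplication by a real function (`inner_weakLaplacian_symm`). Hence the
adjoint is symmetric, and it is the only self-adjoint extension
(`exists_unique_selfAdjointExtension`).

On the side of the bundle, `d ≥ 2` makes the space of collision-free ordered configurations
connected (`isPreconnected_setOf_injective`). Transporting a unit vector from a base point along
curves trivializes the pulled-back bundle, since a curve that closes among the ordered
configurations has holonomy `1` (`nonempty_trivialization`). In such a trivialization `I`, a local
frame becomes a phase `u` with `du = i A u`, where `A` is the connection form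
(`hasFDerivAt_phase`). So `u` is smooth, and multiplication by `u` intertwines `d + i A` with `d`.
Transport from `x` to a relabelling of `x` by `σ` multiplies by `sgn σ`, and therefore
`x ↦ I_x ψ(π(x))` is anti-symmetric for every cross-section `ψ` (`apply_permute`).

The collisions form a null set and `π` is `N!`-to-one, so `ψ ↦ (N!)^(-1/2) I ψ ∘ π` is isometric.
It is onto `Anti L²` because an anti-symmetric function can be read off at one ordering of each
configuration (`exists_liftLM_eq`). A smooth compactly supported cross-section vanishes near the
collisions, so that its lift is a test function on all of `ℝᴺᵈ`, whose Laplacian is the lift of the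
Laplacian of the bundle (`laplacian_lift`). The self-adjoint operator `H_F = U⁻¹ H_Anti U` thus
extends the Hamiltonian of the bundle (`unitary_mem_antiRawHamiltonian`). Two trivializations differ
by a constant phase, which leaves `U⁻¹ H_Anti U` unchanged (`unitary_eq_smul`), so one operator
`H_F` serves for all of them.
-/

noncomputable section

variable {N d : ℕ}

/-! ### Essential self-adjointness through the adjoint relation -/

section AbstractSelfAdjoint

variable {E : Type*} [NormedAddCommGroup E] [InnerProductSpace ℂ E]

/-- The graph of the adjoint of the operator whose graph is `S`, which need be neither densely
defined nor linear. -/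
def adjointRel (S : Set (E × E)) : Submodule ℂ (E × E) where
  carrier := {p | ∀ q ∈ S, ⟪q.2, p.1⟫_ℂ = ⟪q.1, p.2⟫_ℂ}
  zero_mem' := fun q _ => by simp
  add_mem' := fun {p p'} hp hp' q hq => by
    simp only [Prod.fst_add, Prod.snd_add, inner_add_right, hp q hq, hp' q hq]
  smul_mem' := fun c p hp q hq => by
    simp only [Prod.smul_fst, Prod.smul_snd, inner_smul_right, hp q hq]

theorem adjointRel_anti {S T : Set (E × E)} (h : S ⊆ T) : adjointRel T ≤ adjointRel S :=
  fun _ hp q hq => hp q (h hq)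

theorem coe_adjoint_eq_adjointRel (g : Submodule ℂ (E × E)) :
    g.adjoint = adjointRel (g : Set _) := by
  ext p
  rw [Submodule.mem_adjoint_iff]
  constructor
  · exact fun h q hq => sub_eq_zero.1 (h q.1 q.2 hq)
  · exact fun h a b hab => sub_eq_zero.2 (h (a, b) hab)

theorem IsSelfAdjointOp.graph_eq {H : E →ₗ.[ℂ] E} (hH : IsSelfAdjointOp H) :
    H.graph = adjointRel (H.graph : Set (E × E)) := by
  obtain ⟨hc, hs⟩ := hH
  rw [← coe_adjoint_eq_adjointRel, ← LinearPMap.adjoint_graph_eq_graph_adjoint hs.dense_domain,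
    LinearPMap.isSelfAdjoint_def.1 hs]

/-- A densely defined operator whose adjoint is symmetric and extends it has exactly one
self-adjoint extension, namely its adjoint. -/
theorem exists_unique_selfAdjointExtension [CompleteSpace E] {S : Set (E × E)}
    (hdense : ∀ h : E, (∀ q ∈ S, ⟪q.1, h⟫_ℂ = 0) → h = 0) (hle : S ⊆ adjointRel S)
    (hsymm : ∀ p ∈ adjointRel S, ∀ q ∈ adjointRel S, ⟪q.2, p.1⟫_ℂ = ⟪q.1, p.2⟫_ℂ) :
    ∃ H : E →ₗ.[ℂ] E, IsSelfAdjointExtension S H ∧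
      ∀ H' : E →ₗ.[ℂ] E, IsSelfAdjointExtension S H' → H' = H := by
  have hval : ∀ p ∈ adjointRel S, p.1 = 0 → p.2 = 0 := fun p hp h0 =>
    hdense _ fun q hq => by rw [← hp q hq, h0, inner_zero_right]
  have hg : (adjointRel S).toLinearPMap.graph = adjointRel S :=
    Submodule.toLinearPMap_graph_eq _ hval
  have hself : adjointRel (adjointRel S : Set (E × E)) = adjointRel S :=
    le_antisymm (adjointRel_anti hle) fun p hp q hq => hsymm p hp q hq
  have hdom : Dense ((adjointRel S).toLinearPMap.domain : Set E) := by
    rw [Submodule.dense_iff_topologicalClosure_eq_top, Submodule.topologicalClosure_eq_top_iff,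
      Submodule.eq_bot_iff]
    intro h hh
    refine hdense h fun q hq => (Submodule.mem_orthogonal _ _).1 hh _ ?_
    have : q ∈ (adjointRel S).toLinearPMap.graph := by rw [hg]; exact hle hq
    exact LinearPMap.mem_domain_of_mem_graph this
  refine ⟨(adjointRel S).toLinearPMap, ⟨⟨inferInstance, ?_⟩, ?_⟩, ?_⟩
  · rw [LinearPMap.isSelfAdjoint_def]
    apply LinearPMap.eq_of_eq_graph
    rw [LinearPMap.adjoint_graph_eq_graph_adjoint hdom, coe_adjoint_eq_adjointRel, hg, hself]
  · rw [hg]; exact hle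
  · intro H' hH'
    apply LinearPMap.eq_of_eq_graph
    have h1 : H'.graph ≤ adjointRel S := hH'.1.graph_eq.trans_le (adjointRel_anti hH'.2)
    rw [hg]
    refine le_antisymm h1 ?_
    rw [hH'.1.graph_eq]
    exact hself.symm.trans_le (adjointRel_anti h1)

end AbstractSelfAdjoint

/-! ### The weak Laplacian on `L²` is symmetric -/

section WeakLaplacian

open scoped SchwartzMap Laplacian FourierTransform Topology
open Filter

variable {E : Type*} [NormedAddCommGroup E] [InnerProductSpace ℝ E]

theorem norm_iteratedFDeriv_comp_smul_le {χ : E → ℝ} (hχ : ContDiff ℝ ∞ χ) {c : ℝ} (hc : |c| ≤ 1)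
    (i : ℕ) (x : E) :
    ‖iteratedFDeriv ℝ i (fun y => χ (c • y)) x‖ ≤ ‖iteratedFDeriv ℝ i χ (c • x)‖ := by
  have h := ContinuousLinearMap.iteratedFDeriv_comp_right (c • ContinuousLinearMap.id ℝ E) hχ x
    (i := i) (by exact_mod_cast le_top)
  have h' : (χ ∘ (c • ContinuousLinearMap.id ℝ E)) = fun y => χ (c • y) := by
    ext y; simp
  rw [h'] at h
  rw [h]
  refine (ContinuousMultilinearMap.norm_compContinuousLinearMap_le _ _).trans ?_
  have h1 : ‖c • ContinuousLinearMap.id ℝ E‖ ≤ 1 := by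
    rw [norm_smul]
    exact mul_le_one₀ hc (norm_nonneg _) ContinuousLinearMap.norm_id_le
  have h2 : ∏ _j : Fin i, ‖c • ContinuousLinearMap.id ℝ E‖ ≤ 1 :=
    Finset.prod_le_one (fun _ _ => norm_nonneg _) fun _ _ => h1
  simpa using mul_le_mul_of_nonneg_left h2 (norm_nonneg (iteratedFDeriv ℝ i χ (c • x)))

variable [FiniteDimensional ℝ E]

theorem norm_laplacian_le (f : E → ℂ) (x : E) :
    ‖Δ f x‖ ≤ Module.finrank ℝ E * ‖iteratedFDeriv ℝ 2 f x‖ := by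
  rw [InnerProductSpace.laplacian_eq_iteratedFDeriv_orthonormalBasis f (stdOrthonormalBasis ℝ E)]
  refine (norm_sum_le _ _).trans ?_
  refine (Finset.sum_le_card_nsmul _ _ ‖iteratedFDeriv ℝ 2 f x‖ fun i _ => ?_).trans_eq (by simp)
  refine (ContinuousMultilinearMap.le_opNorm _ _).trans_eq ?_
  simp [Fin.prod_univ_two]

variable [MeasurableSpace E] [BorelSpace E]

theorem integrable_norm_iteratedFDeriv_mul (φ : 𝓢(E, ℂ)) {g : E → ℂ} (hg : MemLp g 2) (n : ℕ) :
    Integrable fun x => ‖iteratedFDeriv ℝ n φ x‖ * ‖g x‖ := by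
  obtain ⟨C, hC, hbound⟩ := φ.decay 0 n
  have hcont : Continuous fun x => ‖iteratedFDeriv ℝ n φ x‖ :=
    ((φ.smooth n).continuous_iteratedFDeriv le_rfl).norm
  have hi : Integrable fun x => C * (‖x‖ ^ 0 * ‖iteratedFDeriv ℝ n φ x‖) + ‖g x‖ ^ 2 :=
    ((φ.integrable_pow_mul_iteratedFDeriv volume 0 n).const_mul C).add hg.norm.integrable_sq
  refine hi.mono' (hcont.aestronglyMeasurable.mul hg.1.norm) ?_
  filter_upwards with x
  have h1 := hbound x
  simp only [pow_zero, one_mul] at h1 ⊢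
  rw [Real.norm_of_nonneg (by positivity)]
  nlinarith [sq_nonneg (‖iteratedFDeriv ℝ n φ x‖ - ‖g x‖), norm_nonneg (g x),
    norm_nonneg (iteratedFDeriv ℝ n φ x)]

/-- A weak Laplacian in `L²`, tested on smooth functions with compact support, can also be tested
on Schwartz functions. -/
theorem integral_laplacian_mul_of_hasCompactSupport {g k : E → ℂ} (hg : MemLp g 2) (hk : MemLp k 2)
    (h : ∀ φ : E → ℂ, ContDiff ℝ ∞ φ → HasCompactSupport φ →
      ∫ x, Δ φ x * g x = ∫ x, φ x * k x) (φ : 𝓢(E, ℂ)) :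
    ∫ x, Δ (φ : E → ℂ) x * g x = ∫ x, φ x * k x := by
  let χ : ContDiffBump (0 : E) := ⟨1, 2, one_pos, one_lt_two⟩
  have hχ : ContDiff ℝ ∞ χ := χ.contDiff
  have hM : ∀ i : ℕ, ∃ M, ∀ x, ‖iteratedFDeriv ℝ i χ x‖ ≤ M := fun i =>
    (hχ.continuous_iteratedFDeriv (by exact_mod_cast le_top)).bounded_above_of_compact_support
      (χ.hasCompactSupport.iteratedFDeriv i)
  choose M hM using hM
  let c : ℕ → ℝ := fun n => ((n : ℝ) + 1)⁻¹
  have hc0 : ∀ n, 0 < c n := fun n => by positivity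
  have hc1 : ∀ n, |c n| ≤ 1 := fun n => by
    rw [abs_of_pos (hc0 n)]
    exact inv_le_one_of_one_le₀ (by linarith [n.cast_nonneg (α := ℝ)])
  let χn : ℕ → E → ℝ := fun n x => χ (c n • x)
  let φn : ℕ → E → ℂ := fun n x => χn n x • φ x
  have hχn : ∀ n, ContDiff ℝ ∞ (χn n) := fun n => hχ.comp (contDiff_const_smul _)
  have hφn : ∀ n, ContDiff ℝ ∞ (φn n) := fun n => (hχn n).smul (φ.smooth _)
  have hφc : ∀ n, HasCompactSupport (φn n) := fun n =>
    (χ.hasCompactSupport.comp_smul (hc0 n).ne').smul_right (f' := φ)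
  have hone : ∀ x, ∀ᶠ n in atTop, φn n =ᶠ[𝓝 x] φ := by
    intro x
    obtain ⟨n₀, hn₀⟩ := exists_nat_gt ‖x‖
    filter_upwards [eventually_ge_atTop n₀] with n hn
    have hx : ‖x‖ < n + 1 := by
      have : (n₀ : ℝ) ≤ n := by exact_mod_cast hn
      linarith
    filter_upwards [continuous_norm.continuousAt.preimage_mem_nhds (Iio_mem_nhds hx)] with y hy
    have hy' : ‖y‖ < n + 1 := hy
    have : χ (c n • y) = 1 := by
      refine χ.one_of_mem_closedBall ?_
      rw [mem_closedBall_zero_iff, norm_smul, Real.norm_of_nonneg (hc0 n).le]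
      change ((n : ℝ) + 1)⁻¹ * ‖y‖ ≤ 1
      rw [inv_mul_le_iff₀ (by positivity)]
      linarith
    simp [φn, χn, this]
  -- The second derivatives of `χ(x / n) φ(x)` are bounded by those of `φ`, uniformly in `n`.
  have hbound : ∀ n x, ‖iteratedFDeriv ℝ 2 (φn n) x‖ ≤
      ∑ i ∈ Finset.range 3, ((2).choose i : ℝ) * M i * ‖iteratedFDeriv ℝ (2 - i) φ x‖ := by
    intro n x
    have h2 : ContDiff ℝ 2 (χn n) := contDiff_infty.1 (hχn n) 2
    refine (norm_iteratedFDeriv_smul_le h2 (φ.smooth 2) x (n := 2) le_rfl).trans ?_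
    refine Finset.sum_le_sum fun i _ => ?_
    gcongr
    exact (norm_iteratedFDeriv_comp_smul_le hχ (hc1 n) i x).trans (hM i _)
  have hL : Tendsto (fun n => ∫ x, Δ (φn n) x * g x) atTop (𝓝 (∫ x, Δ (φ : E → ℂ) x * g x)) := by
    refine tendsto_integral_of_dominated_convergence
      (fun x => Module.finrank ℝ E * ∑ i ∈ Finset.range 3,
        ((2).choose i : ℝ) * M i * (‖iteratedFDeriv ℝ (2 - i) φ x‖ * ‖g x‖)) ?_ ?_ ?_ ?_
    · intro n
      refine AEStronglyMeasurable.mul ?_ hg.1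
      have h1 : (φn n) = (hφc n).toSchwartzMap (hφn n) := by ext; simp
      rw [h1]
      have h2 : Δ (((hφc n).toSchwartzMap (hφn n) : 𝓢(E, ℂ)) : E → ℂ) =
          (Δ ((hφc n).toSchwartzMap (hφn n)) : 𝓢(E, ℂ)) := by
        ext x; rw [SchwartzMap.laplacian_apply]
      rw [h2]
      exact (SchwartzMap.continuous _).aestronglyMeasurable
    · refine Integrable.const_mul (integrable_finsetSum _ fun i _ => ?_) _
      exact (integrable_norm_iteratedFDeriv_mul φ hg _).const_mul _
    · intro n
      filter_upwards with x
      rw [norm_mul]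
      refine (mul_le_mul_of_nonneg_right ((norm_laplacian_le _ x).trans
        (mul_le_mul_of_nonneg_left (hbound n x) (by positivity))) (norm_nonneg _)).trans_eq ?_
      rw [mul_assoc, Finset.sum_mul]
      simp only [mul_assoc]
    · filter_upwards with x
      refine tendsto_const_nhds.congr' ?_
      filter_upwards [hone x] with n hn
      rw [(InnerProductSpace.laplacian_congr_nhds hn).self_of_nhds]
  have hR : Tendsto (fun n => ∫ x, φn n x * k x) atTop (𝓝 (∫ x, φ x * k x)) := by
    refine tendsto_integral_of_dominated_convergence
      (fun x => M 0 * (‖iteratedFDeriv ℝ 0 φ x‖ * ‖k x‖)) ?_ ?_ ?_ ?_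
    · exact fun n => (hφn n).continuous.aestronglyMeasurable.mul hk.1
    · exact (integrable_norm_iteratedFDeriv_mul φ hk 0).const_mul _
    · intro n
      filter_upwards with x
      have := hM 0 (c n • x)
      rw [norm_iteratedFDeriv_zero] at this
      rw [norm_mul, norm_smul, norm_iteratedFDeriv_zero, mul_assoc]
      gcongr
    · filter_upwards with x
      refine tendsto_const_nhds.congr' ?_
      filter_upwards [hone x] with n hn
      rw [hn.self_of_nhds]
  refine tendsto_nhds_unique hL (hR.congr fun n => ?_)
  exact (h _ (hφn n) (hφc n)).symm

/-- The Fourier transform turns the weak Laplacian in `L²` into multiplication by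
`-(2π)²|ξ|²`. -/
theorem fourier_weakLaplacian_ae {g k : Lp ℂ 2 (volume : Measure E)}
    (h : ∀ φ : E → ℂ, ContDiff ℝ ∞ φ → HasCompactSupport φ →
      ∫ x, Δ φ x * g x = ∫ x, φ x * k x) :
    ∀ᵐ ξ, (𝓕 k) ξ = ((-(2 * Real.pi) ^ 2 * ‖ξ‖ ^ 2 : ℝ) : ℂ) * (𝓕 g) ξ := by
  have hΔ : Δ (Lp.toTemperedDistribution g) = Lp.toTemperedDistribution k := by
    ext u
    rw [TemperedDistribution.laplacian_apply_apply, Lp.toTemperedDistribution_apply,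
      Lp.toTemperedDistribution_apply]
    simp only [smul_eq_mul, SchwartzMap.laplacian_apply]
    exact integral_laplacian_mul_of_hasCompactSupport (Lp.memLp g) (Lp.memLp k) h u
  rw [TemperedDistribution.laplacian_eq_fourierMultiplierCLM,
    TemperedDistribution.fourierMultiplierCLM_apply, Lp.fourier_toTemperedDistribution_eq] at hΔ
  have hw : (fun x : E => ((‖x‖ ^ 2 : ℝ) : ℂ)).HasTemperateGrowth := by fun_prop
  refine ae_eq_of_integral_contDiff_smul_eq ((Lp.memLp (𝓕 k)).locallyIntegrable one_le_two) ?_ ?_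
  · exact ((Lp.memLp (𝓕 g)).locallyIntegrable one_le_two).continuous_mul (by fun_prop)
  · intro u hu huc
    have hu' : HasCompactSupport (Complex.ofRealCLM ∘ u) := huc.comp_left rfl
    have hu'' : ContDiff ℝ ∞ (Complex.ofRealCLM ∘ u) := by fun_prop
    have hF := DFunLike.congr_fun hΔ (𝓕 (hu'.toSchwartzMap hu''))
    rw [← TemperedDistribution.fourier_apply (Lp.toTemperedDistribution k),
      Lp.fourier_toTemperedDistribution_eq,
      Lp.toTemperedDistribution_apply] at hF
    change -(2 * Real.pi) ^ 2 • ((TemperedDistribution.smulLeftCLM ℂ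
      fun x : E => ((‖x‖ ^ 2 : ℝ) : ℂ)) (Lp.toTemperedDistribution (𝓕 g)))
        (𝓕⁻ (𝓕 (hu'.toSchwartzMap hu''))) = _ at hF
    rw [FourierTransform.fourierInv_fourier_eq, TemperedDistribution.smulLeftCLM_apply_apply,
      Lp.toTemperedDistribution_apply] at hF
    refine Eq.trans ?_ (hF.symm.trans ?_)
    · simp
    · rw [← integral_smul]
      congr 1
      ext x
      rw [SchwartzMap.smulLeftCLM_apply_apply hw]
      simp
      ring

/-- Symmetry of the weak Laplacian in `L²`, in the Fourier representation: there it is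
multiplication by a real function. -/
theorem inner_weakLaplacian_symm {g k g' k' : Lp ℂ 2 (volume : Measure E)}
    (h : ∀ φ : E → ℂ, ContDiff ℝ ∞ φ → HasCompactSupport φ → ∫ x, Δ φ x * g x = ∫ x, φ x * k x)
    (h' : ∀ φ : E → ℂ, ContDiff ℝ ∞ φ → HasCompactSupport φ →
      ∫ x, Δ φ x * g' x = ∫ x, φ x * k' x) :
    ⟪k, g'⟫_ℂ = ⟪g, k'⟫_ℂ := by
  rw [← Lp.inner_fourier_eq k g', ← Lp.inner_fourier_eq g k', L2.inner_def, L2.inner_def]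
  refine integral_congr_ae ?_
  filter_upwards [fourier_weakLaplacian_ae h, fourier_weakLaplacian_ae h'] with ξ h1 h2
  simp only [RCLike.inner_apply, h1, h2, map_mul, Complex.conj_ofReal]
  ring

end WeakLaplacian

/-! ### Anti-symmetric functions and their Hamiltonian -/

section AntiHamiltonian

open scoped Laplacian

theorem sign_cast_mul_self (σ : Equiv.Perm (Fin N)) :
    ((Equiv.Perm.sign σ : ℤ) : ℂ) * ((Equiv.Perm.sign σ : ℤ) : ℂ) = 1 := by
  rcases Int.units_eq_one_or (Equiv.Perm.sign σ) with h | h <;> simp [h]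

theorem ae_permute {p : Conf N d → Prop} (h : ∀ᵐ x, p x) (σ : Equiv.Perm (Fin N)) :
    ∀ᵐ x, p (permute σ x) :=
  (measurePreserving_permute σ).quasiMeasurePreserving.ae h

theorem isClosed_antiL2 : IsClosed (AntiL2 N d : Set (Lp ℂ 2 (volume : Measure (Conf N d)))) := by
  have : (AntiL2 N d : Set (Lp ℂ 2 (volume : Measure (Conf N d)))) =
      ⋂ σ : Equiv.Perm (Fin N), {f | Lp.compMeasurePreservingₗᵢ ℂ (permute σ)
        (measurePreserving_permute σ) f = ((Equiv.Perm.sign σ : ℤ) : ℂ) • f} := by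
    ext f
    simp only [Set.mem_iInter, Set.mem_ofPred_eq]
    refine forall_congr' fun σ => ?_
    have h1 := Lp.coeFn_compMeasurePreserving f (measurePreserving_permute σ)
    have h2 := Lp.coeFn_smul (((Equiv.Perm.sign σ : ℤ) : ℂ)) f
    constructor
    · intro h
      apply Lp.ext
      filter_upwards [h, h1, h2] with x hx h1 h2
      rw [h2]
      exact h1.trans hx
    · intro h
      filter_upwards [h1, h2] with x h1 h2
      rw [Pi.smul_apply, smul_eq_mul, ← h] at h2
      rw [← h2]
      exact h1.symm
  rw [this]
  exact isClosed_iInter fun σ => isClosed_eq (LinearIsometry.continuous _) (continuous_const_smul _)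

instance : CompleteSpace (AntiL2 N d) := isClosed_antiL2.completeSpace_coe

theorem permute_permute_conf (σ τ : Equiv.Perm (Fin N)) (x : Conf N d) :
    permute σ (permute τ x) = permute (τ * σ) x := by
  ext1 j
  simp

/-- The sum `∑ σ, sgn(σ) φ(x_{σ(1)}, …, x_{σ(N)})`, i.e. `N!` times the anti-symmetric part
of `φ`. -/
def antisymmetrize (φ : Conf N d → ℂ) (x : Conf N d) : ℂ :=
  ∑ σ : Equiv.Perm (Fin N), ((Equiv.Perm.sign σ : ℤ) : ℂ) * φ (permute σ x)

theorem antisymmetrize_permute (φ : Conf N d → ℂ) (σ : Equiv.Perm (Fin N)) (x : Conf N d) :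
    antisymmetrize φ (permute σ x) = ((Equiv.Perm.sign σ : ℤ) : ℂ) * antisymmetrize φ x := by
  unfold antisymmetrize
  rw [Finset.mul_sum]
  refine Fintype.sum_equiv (Equiv.mulLeft σ) _ _ fun τ => ?_
  rw [permute_permute_conf, Equiv.coe_mulLeft, Equiv.Perm.sign_mul, ← mul_assoc]
  push_cast
  rw [← mul_assoc, sign_cast_mul_self, one_mul]

theorem antisymmetrize_conj (φ : Conf N d → ℂ) (x : Conf N d) :
    (starRingEnd ℂ) (antisymmetrize (fun y => (starRingEnd ℂ) (φ y)) x) = antisymmetrize φ x := by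
  simp [antisymmetrize]

theorem contDiff_antisymmetrize {φ : Conf N d → ℂ} (hφ : ContDiff ℝ ∞ φ) :
    ContDiff ℝ ∞ (antisymmetrize φ) :=
  ContDiff.sum fun σ _ => contDiff_const.mul (hφ.comp (permute σ).contDiff)

theorem hasCompactSupport_antisymmetrize {φ : Conf N d → ℂ} (hφ : HasCompactSupport φ) :
    HasCompactSupport (antisymmetrize φ) := by
  classical
  have h : ∀ s : Finset (Equiv.Perm (Fin N)), HasCompactSupport fun x =>
      ∑ σ ∈ s, ((Equiv.Perm.sign σ : ℤ) : ℂ) * φ (permute σ x) := by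
    intro s
    induction s using Finset.induction_on with
    | empty =>
      simp only [Finset.sum_empty]
      exact HasCompactSupport.zero
    | insert σ s hσ ih =>
      simp only [Finset.sum_insert hσ]
      refine HasCompactSupport.add (HasCompactSupport.mul_left ?_) ih
      exact hφ.comp_homeomorph (permute σ).toHomeomorph
  exact h _

theorem laplacian_comp_linearIsometryEquiv {E : Type*} [NormedAddCommGroup E]
    [InnerProductSpace ℝ E] [FiniteDimensional ℝ E] {f : E → ℂ} (hf : ContDiff ℝ 2 f)
    (e : E ≃ₗᵢ[ℝ] E) (x : E) : Δ (fun y => f (e y)) x = Δ f (e x) := by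
  rw [InnerProductSpace.laplacian_eq_iteratedFDeriv_orthonormalBasis _ (stdOrthonormalBasis ℝ E),
    InnerProductSpace.laplacian_eq_iteratedFDeriv_orthonormalBasis f
      ((stdOrthonormalBasis ℝ E).map e)]
  refine Finset.sum_congr rfl fun i _ => ?_
  have h := ContinuousLinearMap.iteratedFDeriv_comp_right
    (e.toContinuousLinearEquiv : E →L[ℝ] E) hf x (i := 2) le_rfl
  have h' : f ∘ (e.toContinuousLinearEquiv : E →L[ℝ] E) = fun y => f (e y) := rfl
  rw [h'] at h
  rw [h, ContinuousMultilinearMap.compContinuousLinearMap_apply]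
  congr 1
  ext j
  fin_cases j <;> simp

theorem laplacian_conj {E : Type*} [NormedAddCommGroup E]
    [InnerProductSpace ℝ E] [FiniteDimensional ℝ E] (f : E → ℂ) (x : E) :
    Δ (fun y => (starRingEnd ℂ) (f y)) x = (starRingEnd ℂ) (Δ f x) :=
  congrFun (InnerProductSpace.laplacian_CLE_comp_left (f := f) (l := Complex.conjCLE)) x

theorem laplacian_antisymmetrize {φ : Conf N d → ℂ} (hφ : ContDiff ℝ ∞ φ) (x : Conf N d) :
    Δ (antisymmetrize φ) x = antisymmetrize (Δ φ) x := by
  classical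
  have h2 : ContDiff ℝ 2 φ := contDiff_infty.1 hφ 2
  have h : ∀ s : Finset (Equiv.Perm (Fin N)), ∀ x,
      Δ (fun x => ∑ σ ∈ s, ((Equiv.Perm.sign σ : ℤ) : ℂ) * φ (permute σ x)) x =
        ∑ σ ∈ s, ((Equiv.Perm.sign σ : ℤ) : ℂ) * Δ φ (permute σ x) := by
    intro s
    induction s using Finset.induction_on with
    | empty => intro x; simp [InnerProductSpace.laplacian_const]
    | insert σ s hσ ih =>
      intro x
      simp only [Finset.sum_insert hσ]
      have h3 : ContDiff ℝ 2 fun x : Conf N d => φ (permute σ x) := h2.comp (permute σ).contDiff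
      have h4 : ContDiff ℝ 2 fun x : Conf N d =>
          ∑ σ ∈ s, ((Equiv.Perm.sign σ : ℤ) : ℂ) * φ (permute σ x) :=
        ContDiff.sum fun σ _ => contDiff_const.mul (h2.comp (permute σ).contDiff)
      have h5 := ContDiffAt.laplacian_add
        (contDiff_const (c := ((Equiv.Perm.sign σ : ℤ) : ℂ)) |>.mul h3).contDiffAt
        h4.contDiffAt (x := x)
      refine h5.trans ?_
      rw [ih]
      congr 1
      refine (InnerProductSpace.laplacian_smul ((Equiv.Perm.sign σ : ℤ) : ℂ)
        h3.contDiffAt).trans ?_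
      rw [laplacian_comp_linearIsometryEquiv h2, smul_eq_mul]
  exact h _ x

theorem integral_antisymmetrize_mul {G : Conf N d → ℂ} {h : Conf N d → ℂ}
    (hint : Integrable fun x => G x * h x)
    (hh : ∀ σ : Equiv.Perm (Fin N), ∀ᵐ x, h (permute σ x) = ((Equiv.Perm.sign σ : ℤ) : ℂ) * h x) :
    ∫ x, antisymmetrize G x * h x = N.factorial * ∫ x, G x * h x := by
  have key : ∀ σ : Equiv.Perm (Fin N), (fun x => ((Equiv.Perm.sign σ : ℤ) : ℂ) *
      G (permute σ x) * h x) =ᵐ[volume] fun x => G (permute σ x) * h (permute σ x) := by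
    intro σ
    filter_upwards [hh σ] with x hx
    rw [hx]; ring
  have hi : ∀ σ : Equiv.Perm (Fin N), Integrable fun x => ((Equiv.Perm.sign σ : ℤ) : ℂ) *
      G (permute σ x) * h x := by
    intro σ
    refine Integrable.congr ?_ (key σ).symm
    exact (measurePreserving_permute σ).integrable_comp_of_integrable hint
  simp only [antisymmetrize, Finset.sum_mul]
  rw [integral_finsetSum _ fun σ _ => hi σ]
  have : ∀ σ : Equiv.Perm (Fin N), ∫ x, ((Equiv.Perm.sign σ : ℤ) : ℂ) * G (permute σ x) * h x =
      ∫ x, G x * h x := by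
    intro σ
    rw [integral_congr_ae (key σ)]
    exact MeasurePreserving.integral_comp' (f := (permute σ).toMeasurableEquiv)
      (measurePreserving_permute σ) fun x => G x * h x
  rw [Finset.sum_congr rfl fun σ _ => this σ, Finset.sum_const, Finset.card_univ,
    Fintype.card_perm, Fintype.card_fin, nsmul_eq_mul]

theorem continuous_laplacian {f : Conf N d → ℂ} (hf : ContDiff ℝ ∞ f) : Continuous (Δ f) := by
  rw [InnerProductSpace.laplacian_eq_iteratedFDeriv_orthonormalBasis f
    (stdOrthonormalBasis ℝ (Conf N d))]
  have h2 : ContDiff ℝ 2 f := contDiff_infty.1 hf 2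
  exact continuous_finsetSum _ fun i _ =>
    (ContinuousMultilinearMap.apply ℝ (fun _ : Fin 2 => Conf N d) ℂ
      ![stdOrthonormalBasis ℝ (Conf N d) i, stdOrthonormalBasis ℝ (Conf N d) i]).continuous.comp
        (h2.continuous_iteratedFDeriv (m := 2) le_rfl)

theorem memLp_two_of_hasCompactSupport {f : Conf N d → ℂ} (hf : Continuous f)
    (hc : HasCompactSupport f) : MemLp f 2 volume :=
  hf.memLp_of_hasCompactSupport hc

theorem integrable_mul_of_memLp_two {f g : Conf N d → ℂ} (hf : MemLp f 2 volume)
    (hg : MemLp g 2 volume) : Integrable fun x => f x * g x :=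
  hf.integrable_mul hg

theorem hasCompactSupport_laplacian {f : Conf N d → ℂ} (hc : HasCompactSupport f) :
    HasCompactSupport (Δ f) := by
  refine (hc.iteratedFDeriv (𝕜 := ℝ) 2).mono' ?_
  intro x hx
  refine subset_tsupport _ ?_
  contrapose! hx
  have h0 : iteratedFDeriv ℝ 2 f x = 0 := by simpa using hx
  simp [InnerProductSpace.laplacian_eq_iteratedFDeriv_orthonormalBasis f
    (stdOrthonormalBasis ℝ (Conf N d)), h0]

theorem memLp_potential_mul {V : Conf N d → ℝ} (hVmeas : Measurable V)
    (hVbdd : ∃ C : ℝ, ∀ x, |V x| ≤ C) {g : Conf N d → ℂ} (hg : MemLp g 2) :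
    MemLp (fun x => (V x : ℂ) * g x) 2 := by
  obtain ⟨C, hC⟩ := hVbdd
  refine hg.of_le_mul (c := C)
    ((Complex.measurable_ofReal.comp hVmeas).aestronglyMeasurable.mul hg.1) ?_
  filter_upwards with x
  rw [norm_mul, Complex.norm_real]
  exact mul_le_mul_of_nonneg_right (hC x) (norm_nonneg _)

/-- The function `-cΔf + Vf`. -/
def schrodinger (c : ℝ) (V : Conf N d → ℝ) (f : Conf N d → ℂ) (x : Conf N d) : ℂ :=
  -(c : ℂ) * Δ f x + (V x : ℂ) * f x

theorem memLp_schrodinger (c : ℝ) {V : Conf N d → ℝ} (hVmeas : Measurable V)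
    (hVbdd : ∃ C : ℝ, ∀ x, |V x| ≤ C) {f : Conf N d → ℂ} (hf : ContDiff ℝ ∞ f)
    (hc : HasCompactSupport f) : MemLp (schrodinger c V f) 2 :=
  ((memLp_two_of_hasCompactSupport (continuous_laplacian hf)
        (hasCompactSupport_laplacian hc)).const_mul _).add
      (memLp_potential_mul hVmeas hVbdd (memLp_two_of_hasCompactSupport hf.continuous hc))

theorem schrodinger_permute (c : ℝ) {V : Conf N d → ℝ}
    (hVsymm : ∀ (σ : Equiv.Perm (Fin N)) (x : Conf N d), V (permute σ x) = V x)
    {f : Conf N d → ℂ} (hf : ContDiff ℝ ∞ f) (hs : ∀ (σ : Equiv.Perm (Fin N)) (x : Conf N d),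
      f (permute σ x) = ((Equiv.Perm.sign σ : ℤ) : ℂ) * f x)
    (σ : Equiv.Perm (Fin N)) (x : Conf N d) :
    schrodinger c V f (permute σ x) = ((Equiv.Perm.sign σ : ℤ) : ℂ) * schrodinger c V f x := by
  have h2 : ContDiff ℝ 2 f := contDiff_infty.1 hf 2
  have h : Δ f (permute σ x) = ((Equiv.Perm.sign σ : ℤ) : ℂ) * Δ f x := by
    rw [← laplacian_comp_linearIsometryEquiv h2]
    have : (fun y => f (permute σ y)) = ((Equiv.Perm.sign σ : ℤ) : ℂ) • f := by
      ext y; simp [hs]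
    rw [this, InnerProductSpace.laplacian_smul _ h2.contDiffAt, smul_eq_mul]
  unfold schrodinger
  rw [h, hs, hVsymm]
  ring

theorem exists_mem_antiRawHamiltonian {ħ m : ℝ} {V : Conf N d → ℝ} (hVmeas : Measurable V)
    (hVbdd : ∃ C : ℝ, ∀ x, |V x| ≤ C)
    (hVsymm : ∀ (σ : Equiv.Perm (Fin N)) (x : Conf N d), V (permute σ x) = V x)
    {f : Conf N d → ℂ} (hf : ContDiff ℝ ∞ f) (hc : HasCompactSupport f)
    (hs : ∀ (σ : Equiv.Perm (Fin N)) (x : Conf N d),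
      f (permute σ x) = ((Equiv.Perm.sign σ : ℤ) : ℂ) * f x) :
    ∃ p ∈ antiRawHamiltonian ħ m V, p.1.1 =ᵐ[volume] f ∧
      p.2.1 =ᵐ[volume] schrodinger (ħ ^ 2 / (2 * m)) V f := by
  have h1 : MemLp f 2 volume := memLp_two_of_hasCompactSupport hf.continuous hc
  have h2 := memLp_schrodinger (ħ ^ 2 / (2 * m)) hVmeas hVbdd hf hc
  refine ⟨(⟨h1.toLp, fun σ => ?_⟩, ⟨h2.toLp, fun σ => ?_⟩), ⟨f, hf, hc, hs, h1.coeFn_toLp,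
    h2.coeFn_toLp⟩, h1.coeFn_toLp, h2.coeFn_toLp⟩
  · filter_upwards [h1.coeFn_toLp, ae_permute h1.coeFn_toLp σ] with x hx hx'
    rw [hx, hx', hs]
  · filter_upwards [h2.coeFn_toLp, ae_permute h2.coeFn_toLp σ] with x hx hx'
    rw [hx, hx', schrodinger_permute _ hVsymm hf hs]

theorem antisymmetrize_schrodinger (c : ℝ) {V : Conf N d → ℝ}
    (hVsymm : ∀ (σ : Equiv.Perm (Fin N)) (x : Conf N d), V (permute σ x) = V x)
    {φ : Conf N d → ℂ} (hφ : ContDiff ℝ ∞ φ) (x : Conf N d) :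
    schrodinger c V (antisymmetrize φ) x = antisymmetrize (schrodinger c V φ) x := by
  unfold schrodinger
  rw [laplacian_antisymmetrize hφ]
  simp only [antisymmetrize, Finset.mul_sum, ← Finset.sum_add_distrib, hVsymm]
  refine Finset.sum_congr rfl fun σ _ => ?_
  ring

theorem schrodinger_conj (c : ℝ) (V : Conf N d → ℝ) (f : Conf N d → ℂ) (x : Conf N d) :
    (starRingEnd ℂ) (schrodinger c V f x) =
      schrodinger c V (fun y => (starRingEnd ℂ) (f y)) x := by
  simp only [schrodinger, laplacian_conj, map_add, map_mul, map_neg, Complex.conj_ofReal]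

theorem contDiff_conj {φ : Conf N d → ℂ} (hφ : ContDiff ℝ ∞ φ) :
    ContDiff ℝ ∞ fun y => (starRingEnd ℂ) (φ y) := Complex.conjCLE.contDiff.comp hφ

theorem hasCompactSupport_conj {φ : Conf N d → ℂ} (hφ : HasCompactSupport φ) :
    HasCompactSupport fun y => (starRingEnd ℂ) (φ y) := hφ.comp_left (map_zero _)

set_option maxHeartbeats 1000000 in
/-- Testing an element of `AntiL2` against the anti-symmetrization of a test function is the same,
up to the factor `N!`, as testing it against the function itself. Hence anti-symmetric test
functions suffice. -/
theorem exists_mem_antiRawHamiltonian_inner {ħ m : ℝ} {V : Conf N d → ℝ} (hVmeas : Measurable V)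
    (hVbdd : ∃ C : ℝ, ∀ x, |V x| ≤ C)
    (hVsymm : ∀ (σ : Equiv.Perm (Fin N)) (x : Conf N d), V (permute σ x) = V x)
    {φ : Conf N d → ℂ} (hφ : ContDiff ℝ ∞ φ) (hc : HasCompactSupport φ) :
    ∃ p ∈ antiRawHamiltonian ħ m V, ∀ h : AntiL2 N d,
      ⟪p.1, h⟫_ℂ = N.factorial * ∫ x, φ x * h.1 x ∧
      ⟪p.2, h⟫_ℂ = N.factorial * ∫ x, schrodinger (ħ ^ 2 / (2 * m)) V φ x * h.1 x := by
  have hφ' := contDiff_conj hφ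
  obtain ⟨p, hp, hp1, hp2⟩ := exists_mem_antiRawHamiltonian (ħ := ħ) (m := m) hVmeas hVbdd hVsymm
    (contDiff_antisymmetrize hφ') (hasCompactSupport_antisymmetrize (hasCompactSupport_conj hc))
    (fun σ x => antisymmetrize_permute _ σ x)
  refine ⟨p, hp, fun h => ⟨?_, ?_⟩⟩
  · rw [← integral_antisymmetrize_mul ?_ h.2, Submodule.coe_inner, L2.inner_def]
    · refine integral_congr_ae ?_
      filter_upwards [hp1] with x hx
      rw [hx, RCLike.inner_apply, antisymmetrize_conj, mul_comm]
    · exact integrable_mul_of_memLp_two (memLp_two_of_hasCompactSupport hφ.continuous hc)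
        (Lp.memLp h.1)
  · rw [← integral_antisymmetrize_mul ?_ h.2, Submodule.coe_inner, L2.inner_def]
    · refine integral_congr_ae ?_
      filter_upwards [hp2] with x hx
      have h1 : (fun y => (starRingEnd ℂ) (antisymmetrize (fun z => (starRingEnd ℂ) (φ z)) y)) =
          antisymmetrize φ := funext (antisymmetrize_conj φ)
      rw [hx, RCLike.inner_apply, schrodinger_conj, h1, antisymmetrize_schrodinger _ hVsymm hφ,
        mul_comm]
    · exact integrable_mul_of_memLp_two (memLp_schrodinger _ hVmeas hVbdd hφ hc) (Lp.memLp h.1)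

/-- The anti-symmetric test functions are dense in the anti-symmetric functions. -/
theorem antiRawHamiltonian_dense {ħ m : ℝ} {V : Conf N d → ℝ} (hVmeas : Measurable V)
    (hVbdd : ∃ C : ℝ, ∀ x, |V x| ≤ C)
    (hVsymm : ∀ (σ : Equiv.Perm (Fin N)) (x : Conf N d), V (permute σ x) = V x)
    (h : AntiL2 N d) (hh : ∀ q ∈ antiRawHamiltonian ħ m V, ⟪q.1, h⟫_ℂ = 0) : h = 0 := by
  apply Subtype.ext
  apply Lp.ext
  refine Filter.EventuallyEq.trans ?_ (Lp.coeFn_zero ℂ 2 volume).symm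
  refine ae_eq_zero_of_integral_contDiff_smul_eq_zero
    ((Lp.memLp h.1).locallyIntegrable one_le_two) fun g hg hgc => ?_
  obtain ⟨p, hp, hpi⟩ := exists_mem_antiRawHamiltonian_inner (ħ := ħ) (m := m) hVmeas hVbdd hVsymm
    (φ := Complex.ofRealCLM ∘ g) (by fun_prop) (hgc.comp_left rfl)
  have := (hpi h).1
  rw [hh p hp, eq_comm, mul_eq_zero] at this
  simpa using this.resolve_left (by exact_mod_cast N.factorial_ne_zero)

theorem integral_laplacian_mul_symm {f g : Conf N d → ℂ} (hf : ContDiff ℝ ∞ f)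
    (hfc : HasCompactSupport f) (hg : ContDiff ℝ ∞ g) (hgc : HasCompactSupport g) :
    ∫ x, Δ f x * g x = ∫ x, f x * Δ g x := by
  have h := SchwartzMap.integral_mul_laplacian_right_eq_left (μ := volume)
    (hfc.toSchwartzMap hf) (hgc.toSchwartzMap hg)
  simp only [SchwartzMap.laplacian_apply] at h
  exact h.symm

set_option maxHeartbeats 1000000 in
/-- The Hamiltonian on anti-symmetric test functions is symmetric, by Green's formula. -/
theorem antiRawHamiltonian_subset_adjointRel {ħ m : ℝ} {V : Conf N d → ℝ} (hVmeas : Measurable V)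
    (hVbdd : ∃ C : ℝ, ∀ x, |V x| ≤ C) :
    (antiRawHamiltonian ħ m V : Set (AntiL2 N d × AntiL2 N d)) ⊆
      adjointRel (antiRawHamiltonian ħ m V) := by
  rintro p ⟨f, hf, hfc, -, hp1, hp2⟩ q ⟨g, hg, hgc, -, hq1, hq2⟩
  set c := ħ ^ 2 / (2 * m)
  have hg' := contDiff_conj hg
  have hgc' := hasCompactSupport_conj hgc
  have hm : ∀ u v : Conf N d → ℂ, ContDiff ℝ ∞ u → HasCompactSupport u → ContDiff ℝ ∞ v →
      HasCompactSupport v → ∫ x, schrodinger c V u x * v x =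
        -(c : ℂ) * (∫ x, Δ u x * v x) + ∫ x, (V x : ℂ) * u x * v x := by
    intro u v hu huc hv hvc
    have hv2 : MemLp v 2 volume := memLp_two_of_hasCompactSupport hv.continuous hvc
    rw [← integral_const_mul, ← integral_add]
    · congr 1
      ext x
      simp only [schrodinger]
      ring
    · exact Integrable.const_mul (integrable_mul_of_memLp_two (memLp_two_of_hasCompactSupport
        (continuous_laplacian hu) (hasCompactSupport_laplacian huc)) hv2) _
    · exact integrable_mul_of_memLp_two (memLp_potential_mul hVmeas hVbdd
        (memLp_two_of_hasCompactSupport hu.continuous huc)) hv2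
  rw [Submodule.coe_inner, Submodule.coe_inner, L2.inner_def, L2.inner_def]
  have h1 : ∫ x, ⟪q.2.1 x, p.1.1 x⟫_ℂ =
      ∫ x, schrodinger c V (fun y => (starRingEnd ℂ) (g y)) x * f x := by
    refine integral_congr_ae ?_
    filter_upwards [hp1, hq2] with x hx hx'
    rw [hx, hx', RCLike.inner_apply, ← schrodinger_conj, mul_comm]
    rfl
  have h2 : ∫ x, ⟪q.1.1 x, p.2.1 x⟫_ℂ =
      ∫ x, schrodinger c V f x * (starRingEnd ℂ) (g x) := by
    refine integral_congr_ae ?_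
    filter_upwards [hp2, hq1] with x hx hx'
    rw [hx, hx', RCLike.inner_apply]
    rfl
  rw [h1, h2, hm _ _ hg' hgc' hf hfc, hm _ _ hf hfc hg' hgc',
    integral_laplacian_mul_symm hg' hgc' hf hfc]
  congr 1
  · simp only [mul_comm]
  · congr 1
    ext x
    ring

set_option maxHeartbeats 1000000 in
/-- An element `(g, h)` of the adjoint relation satisfies `-cΔg = h - Vg` weakly, also against test
functions without symmetry. -/
theorem exists_weakLaplacian_of_mem_adjointRel {ħ m : ℝ} (hħ : 0 < ħ) (hm : 0 < m)
    {V : Conf N d → ℝ} (hVmeas : Measurable V) (hVbdd : ∃ C : ℝ, ∀ x, |V x| ≤ C)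
    (hVsymm : ∀ (σ : Equiv.Perm (Fin N)) (x : Conf N d), V (permute σ x) = V x)
    {p : AntiL2 N d × AntiL2 N d} (hp : p ∈ adjointRel (antiRawHamiltonian ħ m V)) :
    ∃ k : Lp ℂ 2 (volume : Measure (Conf N d)),
      (∀ᵐ x, p.2.1 x = -((ħ ^ 2 / (2 * m) : ℝ) : ℂ) * k x + (V x : ℂ) * p.1.1 x) ∧
      ∀ φ : Conf N d → ℂ, ContDiff ℝ ∞ φ → HasCompactSupport φ →
        ∫ x, Δ φ x * p.1.1 x = ∫ x, φ x * k x := by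
  set c := ħ ^ 2 / (2 * m)
  have hc0 : (c : ℂ) ≠ 0 := by
    have : 0 < c := by positivity
    exact_mod_cast this.ne'
  have hV := memLp_potential_mul hVmeas hVbdd (Lp.memLp p.1.1)
  have hk : MemLp (fun x => (c : ℂ)⁻¹ * ((V x : ℂ) * p.1.1 x - p.2.1 x)) 2 volume :=
    (hV.sub (Lp.memLp p.2.1)).const_mul _
  refine ⟨hk.toLp, ?_, fun φ hφ hφc => ?_⟩
  · filter_upwards [hk.coeFn_toLp] with x hx
    rw [hx]
    field_simp
    ring
  · obtain ⟨q, hq, hqi⟩ := exists_mem_antiRawHamiltonian_inner (ħ := ħ) (m := m) hVmeas hVbdd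
      hVsymm hφ hφc
    have h1 := hp q hq
    rw [(hqi _).1, (hqi _).2] at h1
    have h2 := mul_left_cancel₀ (by exact_mod_cast N.factorial_ne_zero) h1
    have hφ2 : MemLp φ 2 volume := memLp_two_of_hasCompactSupport hφ.continuous hφc
    have i1 : Integrable fun x => Δ φ x * p.1.1 x :=
      integrable_mul_of_memLp_two (memLp_two_of_hasCompactSupport (continuous_laplacian hφ)
        (hasCompactSupport_laplacian hφc)) (Lp.memLp p.1.1)
    have i2 : Integrable fun x => φ x * ((V x : ℂ) * p.1.1 x) := integrable_mul_of_memLp_two hφ2 hV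
    have i3 : Integrable fun x => φ x * p.2.1 x := integrable_mul_of_memLp_two hφ2 (Lp.memLp p.2.1)
    have h3 : ∫ x, schrodinger c V φ x * p.1.1 x =
        -(c : ℂ) * (∫ x, Δ φ x * p.1.1 x) + ∫ x, φ x * ((V x : ℂ) * p.1.1 x) := by
      rw [← integral_const_mul, ← integral_add (i1.const_mul _) i2]
      congr 1
      ext x
      simp only [schrodinger]
      ring
    have h4 : ∫ x, φ x * hk.toLp _ x =
        (c : ℂ)⁻¹ * ((∫ x, φ x * ((V x : ℂ) * p.1.1 x)) - ∫ x, φ x * p.2.1 x) := by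
      rw [← integral_sub i2 i3, ← integral_const_mul]
      refine integral_congr_ae ?_
      filter_upwards [hk.coeFn_toLp] with x hx
      rw [hx]
      ring
    rw [h3] at h2
    rw [h4, ← h2]
    field_simp
    ring

set_option maxHeartbeats 1000000 in
/-- The adjoint of the Hamiltonian on anti-symmetric test functions is symmetric. -/
theorem adjointRel_antiRawHamiltonian_symm {ħ m : ℝ} (hħ : 0 < ħ) (hm : 0 < m)
    {V : Conf N d → ℝ} (hVmeas : Measurable V) (hVbdd : ∃ C : ℝ, ∀ x, |V x| ≤ C)
    (hVsymm : ∀ (σ : Equiv.Perm (Fin N)) (x : Conf N d), V (permute σ x) = V x)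
    {p q : AntiL2 N d × AntiL2 N d} (hp : p ∈ adjointRel (antiRawHamiltonian ħ m V))
    (hq : q ∈ adjointRel (antiRawHamiltonian ħ m V)) : ⟪q.2, p.1⟫_ℂ = ⟪q.1, p.2⟫_ℂ := by
  obtain ⟨k, hk, hkw⟩ := exists_weakLaplacian_of_mem_adjointRel hħ hm hVmeas hVbdd hVsymm hp
  obtain ⟨l, hl, hlw⟩ := exists_weakLaplacian_of_mem_adjointRel hħ hm hVmeas hVbdd hVsymm hq
  have h := inner_weakLaplacian_symm hlw hkw
  have hVp := memLp_potential_mul hVmeas hVbdd (Lp.memLp p.1.1)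
  have hVq := memLp_potential_mul hVmeas hVbdd (Lp.memLp q.1.1)
  set c := ħ ^ 2 / (2 * m)
  have e1 : p.2.1 = -(c : ℂ) • k + hVp.toLp := by
    apply Lp.ext
    filter_upwards [hk, hVp.coeFn_toLp, Lp.coeFn_add (-(c : ℂ) • k) hVp.toLp,
      Lp.coeFn_smul (-(c : ℂ)) k] with x h1 h2 h3 h4
    rw [h3, Pi.add_apply, h4, h2, h1, Pi.smul_apply, smul_eq_mul]
  have e2 : q.2.1 = -(c : ℂ) • l + hVq.toLp := by
    apply Lp.ext
    filter_upwards [hl, hVq.coeFn_toLp, Lp.coeFn_add (-(c : ℂ) • l) hVq.toLp,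
      Lp.coeFn_smul (-(c : ℂ)) l] with x h1 h2 h3 h4
    rw [h3, Pi.add_apply, h4, h2, h1, Pi.smul_apply, smul_eq_mul]
  have e3 : ⟪hVq.toLp, p.1.1⟫_ℂ = ⟪q.1.1, hVp.toLp⟫_ℂ := by
    rw [L2.inner_def, L2.inner_def]
    refine integral_congr_ae ?_
    filter_upwards [hVp.coeFn_toLp, hVq.coeFn_toLp] with x h1 h2
    rw [h1, h2, RCLike.inner_apply, RCLike.inner_apply, map_mul, Complex.conj_ofReal]
    ring
  rw [Submodule.coe_inner, Submodule.coe_inner, e1, e2, inner_add_left, inner_add_right,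
    inner_smul_left, inner_smul_right, e3, h]
  simp

end AntiHamiltonian

/-! ### The unordered position observable on anti-symmetric functions -/

section AntiPosObs

open Filter Topology

theorem antiPosObs_ae {A : Set (UConf N d)} (hA : MeasurableSet A) (f : AntiL2 N d) :
    (antiPosObs A hA f).1 =ᵐ[volume] (preim A).indicator f.1 := antiCutoff_ae A hA f

theorem preim_union (A B : Set (UConf N d)) : preim (A ∪ B) = preim A ∪ preim B := by
  ext x
  simp only [preim, Set.mem_union]
  constructor
  · rintro ⟨h, hx | hx⟩
    exacts [Or.inl ⟨h, hx⟩, Or.inr ⟨h, hx⟩]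
  · rintro (⟨h, hx⟩ | ⟨h, hx⟩)
    exacts [⟨h, Or.inl hx⟩, ⟨h, Or.inr hx⟩]

theorem preim_disjoint {A B : Set (UConf N d)} (h : Disjoint A B) : Disjoint (preim A) (preim B) :=
  Set.disjoint_left.2 fun _ ⟨_, hA⟩ ⟨_, hB⟩ => Set.disjoint_left.1 h hA hB

theorem antiPosObs_union {A B : Set (UConf N d)} (hA : MeasurableSet A) (hB : MeasurableSet B)
    (h : Disjoint A B) (f : AntiL2 N d) :
    antiPosObs (A ∪ B) (hA.union hB) f = antiPosObs A hA f + antiPosObs B hB f := by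
  apply Subtype.ext
  apply Lp.ext
  filter_upwards [antiPosObs_ae hA f, antiPosObs_ae hB f, antiPosObs_ae (hA.union hB) f,
    Lp.coeFn_add (antiPosObs A hA f).1 (antiPosObs B hB f).1] with x h1 h2 h3 h4
  rw [Submodule.coe_add, h3, h4, Pi.add_apply, h1, h2, preim_union,
    Set.indicator_union_of_disjoint (preim_disjoint h)]

theorem antiPosObs_empty (f : AntiL2 N d) : antiPosObs ∅ .empty f = 0 := by
  apply Subtype.ext
  apply Lp.ext
  filter_upwards [antiPosObs_ae .empty f, Lp.coeFn_zero ℂ 2 (volume : Measure (Conf N d))]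
    with x h1 h2
  have : x ∉ preim (∅ : Set (UConf N d)) := fun ⟨_, h⟩ => h
  rw [h1, Set.indicator_of_notMem this]
  exact h2.symm

theorem antiPosObs_biUnion (A : ℕ → Set (UConf N d)) (hA : ∀ n, MeasurableSet (A n))
    (hd : Pairwise (Disjoint on A)) (f : AntiL2 N d) (s : Finset ℕ) :
    ∑ n ∈ s, antiPosObs (A n) (hA n) f =
      antiPosObs (⋃ n ∈ s, A n) (s.measurableSet_biUnion fun n _ => hA n) f := by
  induction s using Finset.induction_on with
  | empty => simpa using (antiPosObs_empty f).symm
  | insert a s ha ih =>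
    rw [Finset.sum_insert ha, ih, ← antiPosObs_union]
    · simp only [Finset.set_biUnion_insert]
    · exact Set.disjoint_iUnion₂_right.2 fun n hn => hd fun h => ha (h ▸ hn)

theorem norm_sq_antiPosObs {A : Set (UConf N d)} (hA : MeasurableSet A) (f : AntiL2 N d) :
    ‖antiPosObs A hA f‖ ^ 2 = ∫ x, (preim A).indicator (fun x => ‖f.1 x‖ ^ 2) x := by
  have h : ((‖antiPosObs A hA f‖ ^ 2 : ℝ) : ℂ) =
      ((∫ x, (preim A).indicator (fun x => ‖f.1 x‖ ^ 2) x : ℝ) : ℂ) := by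
    rw [← integral_complex_ofReal]
    have := inner_self_eq_norm_sq_to_K (𝕜 := ℂ) (antiPosObs A hA f)
    rw [Submodule.coe_inner, L2.inner_def] at this
    push_cast
    refine this.symm.trans (integral_congr_ae ?_)
    filter_upwards [antiPosObs_ae hA f] with x hx
    rw [hx, inner_self_eq_norm_sq_to_K]
    by_cases h : x ∈ preim A <;> simp [h]
  exact_mod_cast h

/-- The configurations in which the particles `i` and `j` are in the same place. -/
def collisionSubspace (i j : Fin N) : Submodule ℝ (Conf N d) where
  carrier := {x | x i = x j}
  zero_mem' := rfl
  add_mem' := fun {x y} hx hy => by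
    change x i + y i = x j + y j
    rw [show x i = x j from hx, show y i = y j from hy]
  smul_mem' := fun c x hx => by
    change c • x i = c • x j
    rw [show x i = x j from hx]

theorem collisionSubspace_ne_top (hd : 1 ≤ d) {i j : Fin N} (hij : i ≠ j) :
    (collisionSubspace i j : Submodule ℝ (Conf N d)) ≠ ⊤ := by
  intro h
  have : unitVec i ⟨0, hd⟩ ∈ (collisionSubspace i j : Submodule ℝ (Conf N d)) := by simp [h]
  have h1 : (unitVec i ⟨0, hd⟩ : Conf N d) i = (unitVec i ⟨0, hd⟩ : Conf N d) j := this
  simp only [unitVec, Pi.single_eq_same, Pi.single_eq_of_ne hij.symm] at h1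
  have h2 := congrFun (congrArg WithLp.ofLp h1) ⟨0, hd⟩
  simp at h2

/-- The collisions lie in finitely many proper subspaces, hence in a null set. -/
theorem ae_injective (hd : 1 ≤ d) : ∀ᵐ x : Conf N d, Injective x := by
  have h : ∀ i j : Fin N, i ≠ j → ∀ᵐ x : Conf N d, x i ≠ x j := fun i j hij => by
    have := Measure.addHaar_submodule volume _ (collisionSubspace_ne_top (d := d) hd hij)
    exact measure_eq_zero_iff_ae_notMem.1 this
  have h' : ∀ᵐ x : Conf N d, ∀ i j : Fin N, i ≠ j → x i ≠ x j := by
    simp only [ae_all_iff]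
    exact h
  filter_upwards [h'] with x hx i j hij
  by_contra hne
  exact hx i j hne hij

theorem antiPosObs_idem {A : Set (UConf N d)} (hA : MeasurableSet A) (f : AntiL2 N d) :
    antiPosObs A hA (antiPosObs A hA f) = antiPosObs A hA f := by
  apply Subtype.ext
  apply Lp.ext
  filter_upwards [antiPosObs_ae hA f, antiPosObs_ae hA (antiPosObs A hA f)] with x h1 h2
  rw [h2]
  by_cases h : x ∈ preim A
  · rw [Set.indicator_of_mem h]
  · rw [h1, Set.indicator_of_notMem h, Set.indicator_of_notMem h]

theorem antiL2_inner (f g : AntiL2 N d) :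
    ⟪f, g⟫_ℂ = ∫ x, (starRingEnd ℂ) (f.1 x) * g.1 x := by
  rw [Submodule.coe_inner, L2.inner_def]
  simp only [RCLike.inner_apply, mul_comm]

theorem antiPosObs_symm {A : Set (UConf N d)} (hA : MeasurableSet A) (f g : AntiL2 N d) :
    ⟪antiPosObs A hA f, g⟫_ℂ = ⟪f, antiPosObs A hA g⟫_ℂ := by
  rw [antiL2_inner, antiL2_inner]
  refine integral_congr_ae ?_
  filter_upwards [antiPosObs_ae hA f, antiPosObs_ae hA g] with x h1 h2
  by_cases h : x ∈ preim A
  · rw [h1, h2, Set.indicator_of_mem h, Set.indicator_of_mem h]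
  · rw [h1, h2, Set.indicator_of_notMem h, Set.indicator_of_notMem h, map_zero, zero_mul, mul_zero]

theorem antiPosObs_univ (hd : 1 ≤ d) (f : AntiL2 N d) : antiPosObs Set.univ .univ f = f := by
  apply Subtype.ext
  apply Lp.ext
  filter_upwards [antiPosObs_ae .univ f, ae_injective hd] with x h1 h2
  rw [h1, Set.indicator_of_mem]
  exact ⟨h2, Set.mem_univ _⟩

theorem hasSum_antiPosObs (A : ℕ → Set (UConf N d)) (hA : ∀ n, MeasurableSet (A n))
    (hd : Pairwise (Disjoint on A)) (f : AntiL2 N d) :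
    HasSum (fun n => antiPosObs (A n) (hA n) f) (antiPosObs (⋃ n, A n) (.iUnion hA) f) := by
  have hB : ∀ s : Finset ℕ, MeasurableSet ((⋃ n, A n) \ ⋃ n ∈ s, A n) := fun s =>
    (MeasurableSet.iUnion hA).diff (s.measurableSet_biUnion fun n _ => hA n)
  have h1 : ∀ s : Finset ℕ, ‖∑ n ∈ s, antiPosObs (A n) (hA n) f -
      antiPosObs (⋃ n, A n) (.iUnion hA) f‖ ^ 2 =
        ∫ x, (preim ((⋃ n, A n) \ ⋃ n ∈ s, A n)).indicator (fun x => ‖f.1 x‖ ^ 2) x := by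
    intro s
    have hs : MeasurableSet (⋃ n ∈ s, A n) := s.measurableSet_biUnion fun n _ => hA n
    have h2 := antiPosObs_union hs (hB s) Set.disjoint_sdiff_right f
    have h3 : (⋃ n ∈ s, A n) ∪ ((⋃ n, A n) \ ⋃ n ∈ s, A n) = ⋃ n, A n :=
      Set.union_sdiff_cancel (Set.iUnion₂_subset fun n _ => Set.subset_iUnion A n)
    simp only [h3] at h2
    rw [antiPosObs_biUnion A hA hd, h2, sub_add_cancel_left, norm_neg, norm_sq_antiPosObs]
  have hint : Integrable fun x => ‖f.1 x‖ ^ 2 := (Lp.memLp f.1).norm.integrable_sq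
  have h2 : Tendsto (fun s : Finset ℕ => ‖∑ n ∈ s, antiPosObs (A n) (hA n) f -
      antiPosObs (⋃ n, A n) (.iUnion hA) f‖ ^ 2) atTop (𝓝 0) := by
    simp only [h1]
    rw [← integral_zero (Conf N d) ℝ]
    refine tendsto_integral_filter_of_dominated_convergence (fun x => ‖f.1 x‖ ^ 2) ?_ ?_ hint ?_
    · exact Eventually.of_forall fun s =>
        hint.1.indicator (measurableSet_preim (hB s))
    · refine Eventually.of_forall fun s => Eventually.of_forall fun x => ?_
      exact (norm_indicator_le_norm_self _ _).trans_eq (by simp)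
    · refine Eventually.of_forall fun x => tendsto_const_nhds.congr' ?_
      by_cases hx : x ∈ preim (⋃ n, A n)
      · obtain ⟨hi, hx⟩ := hx
        obtain ⟨n, hn⟩ := Set.mem_iUnion.1 hx
        filter_upwards [eventually_ge_atTop {n}] with s hs
        rw [Set.indicator_of_notMem]
        rintro ⟨_, -, h⟩
        exact h (Set.mem_iUnion₂.2 ⟨n, hs (Finset.mem_singleton_self n), hn⟩)
      · refine Eventually.of_forall fun s => ?_
        refine (Set.indicator_of_notMem ?_ _).symm
        rintro ⟨hi, h, -⟩
        exact hx ⟨hi, h⟩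
  have h3 : Tendsto (fun s : Finset ℕ => ‖∑ n ∈ s, antiPosObs (A n) (hA n) f -
      antiPosObs (⋃ n, A n) (.iUnion hA) f‖) atTop (𝓝 0) := by
    have := h2.sqrt
    simpa [Real.sqrt_sq (norm_nonneg _)] using this
  exact tendsto_iff_norm_sub_tendsto_zero.2 h3

theorem isPVM_antiPosObs (hd : 1 ≤ d) : IsPVM (antiPosObs (N := N) (d := d)) where
  isProjection _ hA :=
    ⟨LinearMap.ext (antiPosObs_idem hA), antiPosObs_symm hA⟩
  univ := ContinuousLinearMap.ext (antiPosObs_univ hd)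
  iUnion := hasSum_antiPosObs

end AntiPosObs

/-! ### Connectedness of the ordered configuration space -/

section Connected

/-- The linear map `x ↦ x_i - x_j`. -/
def relPos (i j : Fin N) : Conf N d →ₗ[ℝ] EuclideanSpace ℝ (Fin d) where
  toFun x := x i - x j
  map_add' x y := by
    change x i + y i - (x j + y j) = _
    abel
  map_smul' c x := by
    change c • x i - c • x j = c • (x i - x j)
    rw [smul_sub]

theorem relPos_surjective {i j : Fin N} (hij : i ≠ j) :
    Surjective (relPos i j : Conf N d →ₗ[ℝ] _) := by
  intro w
  refine ⟨WithLp.toLp 2 (Pi.single i w), ?_⟩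
  change (Pi.single i w : Fin N → EuclideanSpace ℝ (Fin d)) i -
    (Pi.single i w : Fin N → EuclideanSpace ℝ (Fin d)) j = w
  rw [Pi.single_eq_same, Pi.single_eq_of_ne hij.symm, sub_zero]

theorem comap_relPos_span_ne_top (hd : 2 ≤ d) {i j : Fin N} (hij : i ≠ j)
    (w : EuclideanSpace ℝ (Fin d)) :
    ((ℝ ∙ w).comap (relPos i j) : Submodule ℝ (Conf N d)) ≠ ⊤ := by
  intro h
  have h1 : (ℝ ∙ w) = ⊤ := by
    rw [← Submodule.map_comap_eq_of_surjective (relPos_surjective hij) (ℝ ∙ w), h,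
      Submodule.map_top, LinearMap.range_eq_top.2 (relPos_surjective hij)]
  have h2 := finrank_span_le_card (R := ℝ) ({w} : Set (EuclideanSpace ℝ (Fin d)))
  rw [h1, finrank_top, finrank_euclideanSpace_fin] at h2
  simp at h2
  omega

/-- A segment of configurations has no collisions if it starts without collisions and the relative
positions at its end are not multiples of those at its start. -/
theorem segment_subset_injective {x z : Conf N d} (hx : Injective x)
    (hz : ∀ i j : Fin N, i ≠ j → z ∉ (ℝ ∙ relPos i j x).comap (relPos i j)) :
    segment ℝ x z ⊆ {x | Injective x} := by
  rintro _ ⟨a, b, ha, hb, hab, rfl⟩ i j hij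
  by_contra hne
  have h0 : relPos i j (a • x + b • z) = 0 := sub_eq_zero.2 hij
  rw [map_add, map_smul, map_smul] at h0
  by_cases hb0 : b = 0
  · have ha1 : a = 1 := by linarith
    rw [hb0, ha1, zero_smul, one_smul, add_zero] at h0
    exact hne (hx (sub_eq_zero.1 h0))
  · refine hz i j hne ?_
    rw [Submodule.mem_comap, Submodule.mem_span_singleton]
    refine ⟨-(b⁻¹ * a), ?_⟩
    have h1 : b • relPos i j z = -(a • relPos i j x) := by
      rw [eq_neg_iff_add_eq_zero, add_comm]; exact h0
    rw [neg_smul, mul_smul, ← smul_neg, ← h1, smul_smul, inv_mul_cancel₀ hb0, one_smul]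

theorem isPreconnected_segment {E : Type*} [NormedAddCommGroup E] [NormedSpace ℝ E] (x y : E) :
    IsPreconnected (segment ℝ x y) := (convex_segment x y).isPreconnected

/-- In dimension at least two any two configurations can be joined by two segments, since the
directions to be avoided form finitely many proper subspaces. -/
theorem isPreconnected_setOf_injective (hd : 2 ≤ d) :
    IsPreconnected {x : Conf N d | Injective x} := by
  classical
  refine isPreconnected_of_forall_pair fun x hx y hy => ?_
  let s : Finset (Subspace ℝ (Conf N d)) :=
    (Finset.univ.filter fun p : Fin N × Fin N => p.1 ≠ p.2).image
      (fun p => (ℝ ∙ relPos p.1 p.2 x).comap (relPos p.1 p.2)) ∪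
    (Finset.univ.filter fun p : Fin N × Fin N => p.1 ≠ p.2).image
      (fun p => (ℝ ∙ relPos p.1 p.2 y).comap (relPos p.1 p.2))
  have hs : ⊤ ∉ s := by
    simp only [s, Finset.mem_union, Finset.mem_image, Finset.mem_filter, Finset.mem_univ, true_and,
      not_or, not_exists, not_and]
    exact ⟨fun p hp => comap_relPos_span_ne_top hd hp _, fun p hp =>
      comap_relPos_span_ne_top hd hp _⟩
  obtain ⟨z, hz⟩ := (Set.ne_univ_iff_exists_notMem _).1
    (Subspace.biUnion_ne_univ_of_top_notMem hs)
  have hz' : ∀ p ∈ s, z ∉ p := fun p hp hzp => hz (Set.mem_iUnion₂.2 ⟨p, hp, hzp⟩)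
  have hzx : ∀ i j : Fin N, i ≠ j → z ∉ (ℝ ∙ relPos i j x).comap (relPos i j) :=
    fun i j hij => hz' _ (Finset.mem_union_left _ (Finset.mem_image.2 ⟨(i, j), by simpa using hij,
      rfl⟩))
  have hzy : ∀ i j : Fin N, i ≠ j → z ∉ (ℝ ∙ relPos i j y).comap (relPos i j) :=
    fun i j hij => hz' _ (Finset.mem_union_right _ (Finset.mem_image.2 ⟨(i, j), by simpa using hij,
      rfl⟩))
  exact ⟨segment ℝ x z ∪ segment ℝ y z, Set.union_subset (segment_subset_injective hx hzx)
    (segment_subset_injective hy hzy), Or.inl (left_mem_segment ℝ x z),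
    Or.inr (left_mem_segment ℝ y z), (isPreconnected_segment x z).union z
      (right_mem_segment ℝ x z) (right_mem_segment ℝ y z) (isPreconnected_segment y z)⟩

theorem preconnectedSpace_oConf (hd : 2 ≤ d) : PreconnectedSpace (OConf N d) :=
  Subtype.preconnectedSpace (isPreconnected_setOf_injective hd)

end Connected

/-! ### Parallel transport -/

theorem inner_smul_self_of_finrank_eq_one {G : Type*} [NormedAddCommGroup G]
    [InnerProductSpace ℂ G] (h : Module.finrank ℂ G = 1) {e : G} (he : ‖e‖ = 1) (w : G) :
    ⟪e, w⟫_ℂ • e = w := by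
  have h0 : e ≠ 0 := by
    rintro rfl
    simp at he
  obtain ⟨c, rfl⟩ := (finrank_eq_one_iff_of_nonzero' _ h0).1 h w
  rw [inner_smul_right, inner_self_eq_norm_sq_to_K, he]
  simp

theorem pullback_apply (f : UConf N d → ℂ) (x : OConf N d) : pullback f x.1 = f (proj x) :=
  dif_pos x.2

theorem mem_preim_iff (A : Set (UConf N d)) (x : OConf N d) : x.1 ∈ preim A ↔ proj x ∈ A :=
  ⟨fun ⟨_, h⟩ => h, fun h => ⟨x.2, h⟩⟩

theorem isOpen_preim {A : Set (UConf N d)} (hA : IsOpen A) : IsOpen (preim A) := by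
  have : preim A = Subtype.val '' ((proj : OConf N d → UConf N d) ⁻¹' A) := by
    ext x
    simp [preim]
  rw [this]
  exact isOpen_setOf_injective.isOpenMap_subtype_val _ (hA.preimage isQuotientMap_proj.continuous)

theorem HasDerivWithinAt.comp_affine {G : Type*} [NormedAddCommGroup G] [NormedSpace ℝ G]
    {f : ℝ → G} {f' : G} {s t : Set ℝ} {a b τ : ℝ} (h : HasDerivWithinAt f f' s (a * τ + b))
    (hL : Set.MapsTo (fun τ => a * τ + b) t s) :
    HasDerivWithinAt (fun τ => f (a * τ + b)) (a • f') t τ := by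
  have hLd : HasDerivWithinAt (fun τ : ℝ => a * τ + b) a t τ := by
    simpa using (((hasDerivAt_id τ).const_mul a).add_const b).hasDerivWithinAt
  exact HasDerivWithinAt.scomp τ h hLd hL

theorem derivWithin_comp_affine {G : Type*} [NormedAddCommGroup G] [NormedSpace ℝ G]
    {f : ℝ → G} {p q p' q' a b τ : ℝ} (hf : ContDiffOn ℝ ∞ f (Set.Icc p q)) (hlt : p' < q')
    (hL : Set.MapsTo (fun τ => a * τ + b) (Set.Icc p' q') (Set.Icc p q))
    (hτ : τ ∈ Set.Icc p' q') :
    derivWithin (fun τ => f (a * τ + b)) (Set.Icc p' q') τ =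
      a • derivWithin f (Set.Icc p q) (a * τ + b) := by
  have h1 := (hf.differentiableOn (by simp) _ (hL hτ)).hasDerivWithinAt
  exact (h1.comp_affine hL).derivWithin (uniqueDiffOn_Icc hlt τ hτ)

namespace HermitianLineBundle

variable (F : HermitianLineBundle.{u, v} N d)

/-- A unit vector in each fiber, without any regularity in `q`. Relative to it, sections along
curves become complex-valued functions, which avoids transports between equal fibers. -/
def refVec (q : UConf N d) : F.Fiber q := F.frame (F.indexAt q) q

theorem norm_refVec (q : UConf N d) : ‖F.refVec q‖ = 1 :=
  F.norm_frame _ _ (F.mem_baseSet_at q)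

theorem inner_refVec_smul (q : UConf N d) (w : F.Fiber q) : ⟪F.refVec q, w⟫_ℂ • F.refVec q = w :=
  inner_smul_self_of_finrank_eq_one (F.finrank_eq_one q) (F.norm_refVec q) w

/-- The curve `γ` is smooth on `[p, q]`, and the section `τ ↦ c(τ) e(π(γ(τ)))`, with the reference
vectors `e`, is parallel along it. -/
def ParallelOn (p q : ℝ) (γ : ℝ → OConf N d) (c : ℝ → ℂ) : Prop :=
  ContDiffOn ℝ ∞ (fun τ => (γ τ).1) (Set.Icc p q) ∧
    ∀ i, ∀ τ ∈ Set.Icc p q, proj (γ τ) ∈ F.baseSet i →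
      HasDerivWithinAt (fun τ' => ⟪F.frame i (proj (γ τ')), c τ' • F.refVec (proj (γ τ'))⟫_ℂ)
        (-(Complex.I * F.form i (γ τ).1 (derivWithin (fun τ' => (γ τ').1) (Set.Icc p q) τ) *
          ⟪F.frame i (proj (γ τ)), c τ • F.refVec (proj (γ τ))⟫_ℂ)) (Set.Icc p q) τ

variable {F}

theorem ParallelOn.congr {p q : ℝ} {γ γ' : ℝ → OConf N d} {c c' : ℝ → ℂ} (h : F.ParallelOn p q γ c)
    (hγ : ∀ τ ∈ Set.Icc p q, γ' τ = γ τ) (hc : ∀ τ ∈ Set.Icc p q, c' τ = c τ) :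
    F.ParallelOn p q γ' c' := by
  have hγ' : Set.EqOn (fun τ => (γ' τ).1) (fun τ => (γ τ).1) (Set.Icc p q) := fun τ hτ => by
    simp only [hγ τ hτ]
  refine ⟨h.1.congr hγ', fun i τ hτ hi => ?_⟩
  rw [derivWithin_congr hγ' (hγ' hτ), hγ τ hτ, hc τ hτ]
  rw [hγ τ hτ] at hi
  refine (h.2 i τ hτ hi).congr_of_mem (fun τ' hτ' => ?_) hτ
  rw [hγ τ' hτ', hc τ' hτ']

theorem ParallelOn.const_mul {p q : ℝ} {γ : ℝ → OConf N d} {c : ℝ → ℂ} (h : F.ParallelOn p q γ c)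
    (a : ℂ) : F.ParallelOn p q γ fun τ => a * c τ := by
  refine ⟨h.1, fun i τ hτ hi => ?_⟩
  have h1 := (h.2 i τ hτ hi).const_mul a
  simp only [mul_smul, inner_smul_right] at h1 ⊢
  refine h1.congr_deriv ?_
  ring

theorem ParallelOn.comp_affine {p q p' q' a b : ℝ} {γ : ℝ → OConf N d} {c : ℝ → ℂ}
    (h : F.ParallelOn p q γ c) (hlt : p' < q')
    (hL : Set.MapsTo (fun τ => a * τ + b) (Set.Icc p' q') (Set.Icc p q)) :
    F.ParallelOn p' q' (fun τ => γ (a * τ + b)) (fun τ => c (a * τ + b)) := by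
  refine ⟨?_, fun i τ hτ hi => ?_⟩
  · exact h.1.comp ((contDiff_const.mul contDiff_id).add contDiff_const).contDiffOn hL
  · have h2 := derivWithin_comp_affine (G := Conf N d) h.1 hlt hL hτ
    refine ((h.2 i (a * τ + b) (hL hτ) hi).comp_affine hL).congr_deriv ?_
    rw [h2, map_smul]
    simp only [smul_eq_mul, Complex.real_smul, Complex.ofReal_mul]
    ring

variable (F)

theorem parallelOn_const (p q : ℝ) (x : OConf N d) (a : ℂ) :
    F.ParallelOn p q (fun _ => x) fun _ => a := by
  refine ⟨contDiffOn_const, fun i τ _ _ => ?_⟩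
  refine (hasDerivWithinAt_const τ _ _).congr_deriv ?_
  have : derivWithin (fun _ : ℝ => x.1) (Set.Icc p q) τ = 0 := by simp
  rw [this]
  simp

/-- Parallel transport along a single smooth piece takes the vector `a e(π(x))` at `x` to
`b e(π(y))` at `y`, where `P = (x, a)` and `Q = (y, b)`. -/
def Piece (P Q : OConf N d × ℂ) : Prop :=
  ∃ γ c, F.ParallelOn 0 1 γ c ∧ γ 0 = P.1 ∧ γ 1 = Q.1 ∧ c 0 = P.2 ∧ c 1 = Q.2

/-- Parallel transport along finitely many smooth pieces. -/
def Transport : OConf N d × ℂ → OConf N d × ℂ → Prop := Relation.ReflTransGen F.Piece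

variable {F}

theorem Piece.symm {P Q : OConf N d × ℂ} (h : F.Piece P Q) : F.Piece Q P := by
  obtain ⟨γ, c, h, h0, h1, hc0, hc1⟩ := h
  refine ⟨_, _, h.comp_affine (a := -1) (b := 1) zero_lt_one ?_, ?_⟩
  · intro τ hτ
    constructor <;> linarith [hτ.1, hτ.2]
  · simp [h0, h1, hc0, hc1]

theorem Piece.smul {x y : OConf N d} {a b : ℂ} (h : F.Piece (x, a) (y, b)) (k : ℂ) :
    F.Piece (x, k * a) (y, k * b) := by
  obtain ⟨γ, c, h, h0, h1, hc0, hc1⟩ := h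
  exact ⟨_, _, h.const_mul k, h0, h1, by simp [hc0], by simp [hc1]⟩

theorem Transport.symm {P Q : OConf N d × ℂ} (h : F.Transport P Q) : F.Transport Q P := by
  induction h with
  | refl => exact Relation.ReflTransGen.refl
  | tail _ hQR ih => exact Relation.ReflTransGen.head hQR.symm ih

theorem Transport.smul {P Q : OConf N d × ℂ} (h : F.Transport P Q) (k : ℂ) :
    F.Transport (P.1, k * P.2) (Q.1, k * Q.2) := by
  induction h with
  | refl => exact Relation.ReflTransGen.refl
  | tail _ hQR ih => exact Relation.ReflTransGen.tail ih (hQR.smul k)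

theorem Piece.of_parallelOn {p q : ℝ} (hpq : p < q) {γ : ℝ → OConf N d} {c : ℝ → ℂ}
    (h : F.ParallelOn p q γ c) : F.Piece (γ p, c p) (γ q, c q) := by
  refine ⟨_, _, h.comp_affine (a := q - p) (b := p) zero_lt_one ?_, ?_⟩
  · intro τ hτ
    constructor <;> nlinarith [hτ.1, hτ.2]
  · simp

theorem smul_refVec_eq {γ : ℝ → OConf N d} (s : ∀ τ, F.Fiber (proj (γ τ))) (τ : ℝ) :
    ⟪F.refVec (proj (γ τ)), s τ⟫_ℂ • F.refVec (proj (γ τ)) = s τ := F.inner_refVec_smul _ _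

/-- The end values of a parallel section along a piecewise smooth curve are related by
`Transport`; `Transport.exists_isParallelAlong` is the converse. -/
theorem IsParallelAlong.transport {γ : ℝ → OConf N d} {s : ∀ τ, F.Fiber (proj (γ τ))}
    (h : F.IsParallelAlong γ s) :
    F.Transport (γ 0, ⟪F.refVec (proj (γ 0)), s 0⟫_ℂ) (γ 1, ⟪F.refVec (proj (γ 1)), s 1⟫_ℂ) := by
  obtain ⟨n, t, ht, ht0, ht1, h⟩ := h
  have key : ∀ k : Fin (n + 1),
      F.Transport (γ (t 0), ⟪F.refVec (proj (γ (t 0))), s (t 0)⟫_ℂ)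
        (γ (t k), ⟪F.refVec (proj (γ (t k))), s (t k)⟫_ℂ) := by
    intro k
    induction k using Fin.induction with
    | zero => exact Relation.ReflTransGen.refl
    | succ k ih =>
      refine Relation.ReflTransGen.tail ih ?_
      refine Piece.of_parallelOn (c := fun τ => ⟪F.refVec (proj (γ τ)), s τ⟫_ℂ)
        (ht Fin.castSucc_lt_succ) ⟨(h k).1, fun i τ hτ hi => ?_⟩
      have := (h k).2 i τ hτ hi
      simpa only [smul_refVec_eq s] using this
  have := key (Fin.last n)
  rwa [ht0, ht1] at this

/-- The pieces of a transport can be joined to a curve on `[0, n]` with breaks at the integers. -/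
theorem Transport.exists_parallelOn {P Q : OConf N d × ℂ} (h : F.Transport P Q) :
    ∃ (n : ℕ) (γ : ℝ → OConf N d) (c : ℝ → ℂ), (∀ k < n, F.ParallelOn k (k + 1) γ c) ∧
      γ 0 = P.1 ∧ γ n = Q.1 ∧ c 0 = P.2 ∧ c n = Q.2 := by
  induction h with
  | refl => exact ⟨0, fun _ => P.1, fun _ => P.2, by simp, by simp⟩
  | @tail Q R _ hQR ih =>
    obtain ⟨n, γ, c, h, h0, h1, hc0, hc1⟩ := ih
    obtain ⟨γ', c', h', h0', h1', hc0', hc1'⟩ := hQR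
    have hn : (0 : ℝ) ≤ n := n.cast_nonneg
    refine ⟨n + 1, fun τ => if τ ≤ n then γ τ else γ' (1 * τ + -n),
      fun τ => if τ ≤ n then c τ else c' (1 * τ + -n), fun k hk => ?_, ?_⟩
    · rcases Nat.lt_succ_iff_lt_or_eq.1 hk with hk | rfl
      · have hk' : (k : ℝ) + 1 ≤ n := by exact_mod_cast hk
        refine (h k hk).congr (fun τ hτ => if_pos (hτ.2.trans hk')) fun τ hτ =>
          if_pos (hτ.2.trans hk')
      · have h2 : F.ParallelOn k (k + 1) (fun τ => γ' (1 * τ + -k)) (fun τ => c' (1 * τ + -k)) :=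
          h'.comp_affine (lt_add_one _) fun τ hτ => by
            constructor <;> linarith [hτ.1, hτ.2]
        refine h2.congr (fun τ hτ => ?_) fun τ hτ => ?_
        · rcases hτ.1.eq_or_lt with rfl | hlt
          · simp [h1, h0']
          · exact if_neg hlt.not_ge
        · rcases hτ.1.eq_or_lt with rfl | hlt
          · simp [hc1, hc0']
          · exact if_neg hlt.not_ge
    · simp [hn, h0, hc0, h1', hc1']

theorem Transport.exists_isParallelAlong {P Q : OConf N d × ℂ} (h : F.Transport P Q) :
    ∃ (γ : ℝ → OConf N d) (c : ℝ → ℂ),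
      F.IsParallelAlong γ (fun τ => c τ • F.refVec (proj (γ τ))) ∧
      γ 0 = P.1 ∧ γ 1 = Q.1 ∧ c 0 = P.2 ∧ c 1 = Q.2 := by
  -- A constant piece is appended so that there is at least one piece.
  have h' : F.Transport P Q ∧ F.Piece Q Q :=
    ⟨h, _, _, F.parallelOn_const 0 1 Q.1 Q.2, rfl, rfl, rfl, rfl⟩
  obtain ⟨n, γ, c, hp, h0, h1, hc0, hc1⟩ : ∃ (n : ℕ) (γ : ℝ → OConf N d) (c : ℝ → ℂ),
      (∀ k < n + 1, F.ParallelOn k (k + 1) γ c) ∧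
      γ 0 = P.1 ∧ γ ((n + 1 : ℕ) : ℝ) = Q.1 ∧ c 0 = P.2 ∧ c ((n + 1 : ℕ) : ℝ) = Q.2 := by
    obtain ⟨n, γ, c, hp, h0, h1, hc0, hc1⟩ := h.exists_parallelOn
    rcases n with _ | n
    · refine ⟨0, fun _ => Q.1, fun _ => Q.2, fun k _ => F.parallelOn_const _ _ _ _, ?_⟩
      simp only [Nat.cast_zero] at h1 hc1
      simp [← h0, ← hc0, h1, hc1]
    · exact ⟨n, γ, c, hp, h0, h1, hc0, hc1⟩
  have hn : (0 : ℝ) < ((n + 1 : ℕ) : ℝ) := by positivity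
  refine ⟨fun τ => γ (((n + 1 : ℕ) : ℝ) * τ + 0), fun τ => c (((n + 1 : ℕ) : ℝ) * τ + 0),
    ⟨n + 1, fun k => (k : ℕ) / ((n + 1 : ℕ) : ℝ), ?_, ?_, ?_, fun k => ?_⟩, ?_⟩
  · intro k l hkl
    have : ((k : ℕ) : ℝ) < ((l : ℕ) : ℝ) := by exact_mod_cast hkl
    exact div_lt_div_of_pos_right this hn
  · simp
  · simp only [Fin.val_last]
    exact div_self hn.ne'
  · have h2 := (hp k k.2).comp_affine (a := ((n + 1 : ℕ) : ℝ)) (b := 0)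
      (p' := ((k.castSucc : Fin (n + 1 + 1)) : ℕ) / ((n + 1 : ℕ) : ℝ))
      (q' := ((k.succ : Fin (n + 1 + 1)) : ℕ) / ((n + 1 : ℕ) : ℝ)) ?_ ?_
    · exact h2
    · refine div_lt_div_of_pos_right ?_ hn
      simp
    · intro τ hτ
      have h3 := (div_le_iff₀ hn).1 hτ.1
      have h4 := (le_div_iff₀ hn).1 hτ.2
      simp only [Fin.val_castSucc, Fin.val_succ, Nat.cast_add, Nat.cast_one] at h3 h4 ⊢
      constructor <;> linarith
  · simp only [mul_zero, mul_one, add_zero]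
    exact ⟨h0, h1, hc0, hc1⟩

theorem cast_smul_refVec {q q' : UConf N d} (h : q = q') (a : ℂ) :
    cast (congrArg F.Fiber h) (a • F.refVec q) = a • F.refVec q' := by
  subst h
  rfl

theorem smul_refVec_injective {q : UConf N d} {a b : ℂ} (h : a • F.refVec q = b • F.refVec q) :
    a = b := by
  refine smul_left_injective ℂ (?_ : F.refVec q ≠ 0) h
  intro h0
  have := F.norm_refVec q
  simp [h0] at this

/-- The holonomy of a curve from `x` to its relabelling by `σ` is the sign of `σ`. -/
theorem IsFermionic.eq_of_transport (hF : F.IsFermionic) {x : OConf N d}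
    {σ : Equiv.Perm (Fin N)} {a b : ℂ} (h : F.Transport (x, a) (OConf.permute σ x, b)) :
    b = ((Equiv.Perm.sign σ : ℤ) : ℂ) * a := by
  obtain ⟨γ, c, hp, h0, h1, rfl, rfl⟩ := h.exists_isParallelAlong
  subst h0
  have h2 := hF γ _ hp σ h1
  rw [cast_smul_refVec ((congrArg proj h1).trans (proj_permute σ (γ 0))), smul_smul] at h2
  exact smul_refVec_injective h2

end HermitianLineBundle

/-! ### Parallel transport along segments and existence of trivializations -/

theorem hasDerivAt_cexp_neg_integral {a : ℝ → ℝ} (ha : Continuous a) (τ : ℝ) :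
    HasDerivAt (fun τ' => Complex.exp (-(Complex.I * ((∫ s in (0 : ℝ)..τ', a s : ℝ) : ℂ))))
      (-(Complex.I * (a τ : ℂ)) *
        Complex.exp (-(Complex.I * ((∫ s in (0 : ℝ)..τ, a s : ℝ) : ℂ)))) τ := by
  have h1 : HasDerivAt (fun τ' => ∫ s in (0 : ℝ)..τ', a s) (a τ) τ :=
    (ha.integral_hasStrictDerivAt 0 τ).hasDerivAt
  refine ((h1.ofReal_comp.const_mul Complex.I).neg.cexp).congr_deriv ?_
  simp only [Pi.neg_apply]
  ring

section ClampedSegment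

variable {G : Type*} [NormedAddCommGroup G] [NormedSpace ℝ G]

/-- The segment from `x` to `y`, parametrized by `[0, 1]` and constant before and after, so
that it is continuous and stays on the segment at all times. -/
def clampedSegment (x y : G) (τ : ℝ) : G := x + (Set.projIcc (0 : ℝ) 1 zero_le_one τ : ℝ) • (y - x)

theorem clampedSegment_eq (x y : G) {τ : ℝ} (hτ : τ ∈ Set.Icc (0 : ℝ) 1) :
    clampedSegment x y τ = x + τ • (y - x) := by
  rw [clampedSegment, Set.projIcc_of_mem zero_le_one hτ]

theorem continuous_clampedSegment (x y : G) : Continuous (clampedSegment x y) :=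
  continuous_const.add ((continuous_subtype_val.comp continuous_projIcc).smul continuous_const)

theorem hasDerivWithinAt_clampedSegment (x y : G) {τ : ℝ} (hτ : τ ∈ Set.Icc (0 : ℝ) 1) :
    HasDerivWithinAt (clampedSegment x y) (y - x) (Set.Icc 0 1) τ := by
  have h : HasDerivAt (fun τ : ℝ => x + τ • (y - x)) (y - x) τ := by
    simpa using ((hasDerivAt_id τ).smul_const (y - x)).const_add x
  exact h.hasDerivWithinAt.congr_of_mem (fun τ' hτ' => clampedSegment_eq x y hτ') hτ

theorem contDiffOn_clampedSegment (x y : G) :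
    ContDiffOn ℝ ∞ (clampedSegment x y) (Set.Icc 0 1) := by
  have h : ContDiff ℝ ∞ (fun τ : ℝ => x + τ • (y - x)) := by fun_prop
  exact h.contDiffOn.congr fun τ hτ => clampedSegment_eq x y hτ

theorem derivWithin_clampedSegment (x y : G) {τ : ℝ} (hτ : τ ∈ Set.Icc (0 : ℝ) 1) :
    derivWithin (clampedSegment x y) (Set.Icc 0 1) τ = y - x :=
  (hasDerivWithinAt_clampedSegment x y hτ).derivWithin (uniqueDiffOn_Icc zero_lt_one τ hτ)

theorem hasDerivWithinAt_comp_clampedSegment (x y : G) {τ : ℝ} (hτ : τ ∈ Set.Icc (0 : ℝ) 1)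
    {f : G → ℂ} (hf : DifferentiableAt ℝ f (clampedSegment x y τ)) :
    HasDerivWithinAt (fun τ' => f (clampedSegment x y τ'))
      (fderiv ℝ f (clampedSegment x y τ) (y - x)) (Set.Icc 0 1) τ :=
  hf.hasFDerivAt.comp_hasDerivWithinAt τ (hasDerivWithinAt_clampedSegment x y hτ)

/-- The line integral over a short segment is, to first order, the 1-form at the starting point. -/
theorem hasFDerivAt_integral_segment {A : G → G →L[ℝ] ℝ} {x : G} {s : Set G} (hs : s ∈ nhds x)
    (hA : ContinuousOn A s) :
    HasFDerivAt (fun y => ∫ t in (0 : ℝ)..1, A (clampedSegment x y t) (y - x)) (A x) x := by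
  have hAx : ContinuousAt A x := hA.continuousAt hs
  rw [hasFDerivAt_iff_isLittleO, Asymptotics.isLittleO_iff]
  intro ε hε
  obtain ⟨s', hs', hs'o, hxs'⟩ := mem_nhds_iff.1 hs
  obtain ⟨δ, hδ, hball⟩ := Metric.mem_nhds_iff.1 (Filter.inter_mem (hs'o.mem_nhds hxs')
    (hAx (Metric.closedBall_mem_nhds (A x) hε)))
  filter_upwards [Metric.ball_mem_nhds x hδ] with y hy
  have hmem : ∀ t, clampedSegment x y t ∈ Metric.ball x δ := fun t =>
    (convex_ball x δ).add_smul_sub_mem (Metric.mem_ball_self hδ) hy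
      (Set.projIcc (0 : ℝ) 1 zero_le_one t).2
  have hcont : Continuous fun t => A (clampedSegment x y t) (y - x) := by
    have : Continuous fun t => A (clampedSegment x y t) :=
      hA.comp_continuous (continuous_clampedSegment x y) fun t => hs' (hball (hmem t)).1
    exact this.clm_apply continuous_const
  have h0 : (∫ t in (0 : ℝ)..1, A (clampedSegment x x t) (x - x)) = 0 := by simp
  have h1 : (∫ t in (0 : ℝ)..1, A (clampedSegment x y t) (y - x)) - A x (y - x) =
      ∫ t in (0 : ℝ)..1, (A (clampedSegment x y t) (y - x) - A x (y - x)) := by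
    rw [intervalIntegral.integral_sub (hcont.intervalIntegrable _ _) (by simp)]
    simp
  rw [h0, sub_zero, h1]
  have h2 := intervalIntegral.norm_integral_le_of_norm_le_const (a := (0 : ℝ)) (b := 1)
    (C := ε * ‖y - x‖) (f := fun t => A (clampedSegment x y t) (y - x) - A x (y - x))
    fun t _ => by
      rw [← sub_apply]
      refine ((A (clampedSegment x y t) - A x).le_opNorm _).trans ?_
      refine mul_le_mul_of_nonneg_right ?_ (norm_nonneg _)
      have := (hball (hmem t)).2
      rwa [Set.mem_preimage, mem_closedBall_iff_norm] at this
  simpa using h2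

end ClampedSegment

namespace HermitianLineBundle

variable (F : HermitianLineBundle.{u, v} N d)

/-- The integral of the connection form of the frame `i` along the segment from `x` to `y`. -/
def formIntegral (i : F.Index) (x y : Conf N d) : ℝ :=
  ∫ t in (0 : ℝ)..1, F.form i (clampedSegment x y t) (y - x)

theorem clampedSegment_mem {A : Set (UConf N d)} {x y : Conf N d}
    (h : ∀ t ∈ Set.Icc (0 : ℝ) 1, x + t • (y - x) ∈ preim A) (τ : ℝ) :
    clampedSegment x y τ ∈ preim A :=
  h _ (Set.projIcc (0 : ℝ) 1 zero_le_one τ).2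

theorem continuous_form_clampedSegment (i : F.Index) {x y : Conf N d}
    (h : ∀ t ∈ Set.Icc (0 : ℝ) 1, x + t • (y - x) ∈ preim (F.baseSet i)) :
    Continuous fun τ => F.form i (clampedSegment x y τ) (y - x) := by
  have h1 : Continuous fun τ => F.form i (clampedSegment x y τ) :=
    (F.smooth_form i).continuousOn.comp_continuous (continuous_clampedSegment x y)
      (clampedSegment_mem h)
  exact h1.clm_apply continuous_const

theorem pullback_transition (i j : F.Index) (x : OConf N d) :
    pullback (fun q => ⟪F.frame i q, F.frame j q⟫_ℂ) x.1 =
      ⟪F.frame i (proj x), F.frame j (proj x)⟫_ℂ := pullback_apply _ x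

theorem differentiableAt_transition (i j : F.Index) {x : Conf N d}
    (hx : x ∈ preim (F.baseSet i ∩ F.baseSet j)) :
    DifferentiableAt ℝ (pullback fun q => ⟪F.frame i q, F.frame j q⟫_ℂ) x :=
  ((F.smooth_transition i j).contDiffAt ((isOpen_preim ((F.isOpen_baseSet i).inter
    (F.isOpen_baseSet j))).mem_nhds hx)).differentiableAt (by simp)

/-- In the frame `i`, parallel transport along a segment multiplies by `exp (-i ∫ form i)`. -/
theorem piece_segment (i : F.Index) (x y : OConf N d)
    (h : ∀ t ∈ Set.Icc (0 : ℝ) 1, x.1 + t • (y.1 - x.1) ∈ preim (F.baseSet i)) :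
    F.Piece (x, ⟪F.refVec (proj x), F.frame i (proj x)⟫_ℂ)
      (y, Complex.exp (-(Complex.I * (F.formIntegral i x.1 y.1 : ℂ))) *
        ⟪F.refVec (proj y), F.frame i (proj y)⟫_ℂ) := by
  let γ : ℝ → OConf N d := fun τ =>
    ⟨clampedSegment x.1 y.1 τ, (clampedSegment_mem h τ).1⟩
  let a : ℝ → ℝ := fun τ => F.form i (γ τ).1 (y.1 - x.1)
  have ha : Continuous a := F.continuous_form_clampedSegment i h
  let E : ℝ → ℂ := fun τ => Complex.exp (-(Complex.I * ((∫ s in (0 : ℝ)..τ, a s : ℝ) : ℂ)))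
  have h0 : γ 0 = x := Subtype.ext (by
    simpa using clampedSegment_eq x.1 y.1 (τ := 0) (by simp))
  have h1 : γ 1 = y := Subtype.ext (by
    simpa using clampedSegment_eq x.1 y.1 (τ := 1) (by simp))
  have hcongr : ∀ z z' : OConf N d, z = z' → ⟪F.refVec (proj z), F.frame i (proj z)⟫_ℂ =
      ⟪F.refVec (proj z'), F.frame i (proj z')⟫_ℂ := by
    rintro z _ rfl
    rfl
  refine ⟨γ, fun τ => E τ * ⟪F.refVec (proj (γ τ)), F.frame i (proj (γ τ))⟫_ℂ,
    ⟨contDiffOn_clampedSegment x.1 y.1, fun j τ hτ hj => ?_⟩, h0, h1, ?_, ?_⟩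
  · have hi : proj (γ τ) ∈ F.baseSet i := (clampedSegment_mem h τ).2
    have hsec : ∀ τ', (E τ' * ⟪F.refVec (proj (γ τ')), F.frame i (proj (γ τ'))⟫_ℂ) •
        F.refVec (proj (γ τ')) = E τ' • F.frame i (proj (γ τ')) := fun τ' => by
      rw [mul_smul, F.inner_refVec_smul]
    have hcoef : ∀ τ', ⟪F.frame j (proj (γ τ')), E τ' • F.frame i (proj (γ τ'))⟫_ℂ =
        E τ' * pullback (fun q => ⟪F.frame j q, F.frame i q⟫_ℂ) (γ τ').1 := fun τ' => by
      rw [inner_smul_right, F.pullback_transition]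
    simp only [hsec, hcoef]
    have hmem : (γ τ).1 ∈ preim (F.baseSet j ∩ F.baseSet i) := ⟨_, hj, hi⟩
    have hd1 := (hasDerivAt_cexp_neg_integral ha τ).hasDerivWithinAt (s := Set.Icc (0 : ℝ) 1)
    have hd2 := hasDerivWithinAt_comp_clampedSegment x.1 y.1 hτ
      (F.differentiableAt_transition j i hmem)
    refine (hd1.mul hd2).congr_deriv ?_
    rw [show derivWithin (fun τ' => (γ τ').1) (Set.Icc 0 1) τ = y.1 - x.1 from
      derivWithin_clampedSegment x.1 y.1 hτ]
    rw [show clampedSegment x.1 y.1 τ = (γ τ).1 from rfl, F.form_transition j i _ hmem]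
    simp only [a, E]
    ring
  · simp [E, hcongr _ _ h0]
  · simp only [E, hcongr _ _ h1]
    rfl

theorem norm_inner_refVec (q : UConf N d) (w : F.Fiber q) : ‖⟪F.refVec q, w⟫_ℂ‖ = ‖w‖ := by
  conv_rhs => rw [← F.inner_refVec_smul q w, norm_smul, F.norm_refVec, mul_one]

theorem eventually_segment_mem (i : F.Index) {x : OConf N d} (hx : proj x ∈ F.baseSet i) :
    ∀ᶠ y in nhds x.1, ∀ t ∈ Set.Icc (0 : ℝ) 1, x.1 + t • (y - x.1) ∈ preim (F.baseSet i) := by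
  obtain ⟨δ, hδ, hball⟩ := Metric.mem_nhds_iff.1 ((isOpen_preim (F.isOpen_baseSet i)).mem_nhds
    ((mem_preim_iff _ x).2 hx))
  filter_upwards [Metric.ball_mem_nhds x.1 hδ] with y hy t ht
  exact hball ((convex_ball x.1 δ).add_smul_sub_mem (Metric.mem_ball_self hδ) hy ht)

theorem norm_cexp_neg_I_mul (r : ℝ) : ‖Complex.exp (-(Complex.I * (r : ℂ)))‖ = 1 := by
  rw [Complex.norm_exp]
  simp

/-- Some curve transports unit vectors over `x` to unit vectors over `y`. -/
def Reachable (x y : OConf N d) : Prop := ∃ b : ℂ, ‖b‖ = 1 ∧ F.Transport (x, 1) (y, b)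

variable {F}

theorem Reachable.symm {x y : OConf N d} (h : F.Reachable x y) : F.Reachable y x := by
  obtain ⟨b, hb, h⟩ := h
  have hb0 : b ≠ 0 := by
    rintro rfl
    simp at hb
  refine ⟨b⁻¹, by simp [hb], ?_⟩
  simpa [hb0] using h.symm.smul b⁻¹

theorem Reachable.trans {x y z : OConf N d} (h : F.Reachable x y) (h' : F.Reachable y z) :
    F.Reachable x z := by
  obtain ⟨b, hb, h⟩ := h
  obtain ⟨b', hb', h'⟩ := h'
  have h2 : F.Transport (y, b) (z, b * b') := by simpa using h'.smul b
  exact ⟨b * b', by simp [hb, hb'], h.trans h2⟩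

variable (F)

theorem eventually_reachable (x : OConf N d) : ∀ᶠ y in nhds x, F.Reachable x y := by
  have h := F.eventually_segment_mem _ (F.mem_baseSet_at (proj x))
  filter_upwards [continuous_subtype_val.continuousAt.eventually h] with y hy
  set i := F.indexAt (proj x)
  have hyi : proj y ∈ F.baseSet i := by
    have := hy 1 (by simp)
    rw [one_smul, add_sub_cancel] at this
    exact (mem_preim_iff _ y).1 this
  have hp := F.piece_segment i x y hy
  set a := ⟪F.refVec (proj x), F.frame i (proj x)⟫_ℂ
  have ha : ‖a‖ = 1 := (F.norm_inner_refVec _ _).trans (F.norm_frame i _ (F.mem_baseSet_at _))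
  have ha0 : a ≠ 0 := by
    intro h
    simp [h] at ha
  have := hp.smul a⁻¹
  rw [inv_mul_cancel₀ ha0] at this
  refine ⟨_, ?_, Relation.ReflTransGen.single this⟩
  rw [norm_mul, norm_mul, norm_inv, ha, norm_cexp_neg_I_mul, F.norm_inner_refVec,
    F.norm_frame i _ hyi]
  simp

theorem reachable (hd : 2 ≤ d) (x y : OConf N d) : F.Reachable x y := by
  have := preconnectedSpace_oConf (N := N) hd
  have hclopen : IsClopen {z | F.Reachable x z} := by
    constructor
    · rw [← isOpen_compl_iff, isOpen_iff_mem_nhds]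
      intro z hz
      filter_upwards [F.eventually_reachable z] with w hw hxw
      exact hz (Reachable.trans hxw hw.symm)
    · rw [isOpen_iff_mem_nhds]
      intro z hz
      filter_upwards [F.eventually_reachable z] with w hw
      exact Reachable.trans hz hw
  have h := hclopen.eq_univ ⟨x, 1, by simp, Relation.ReflTransGen.refl⟩
  exact (Set.eq_univ_iff_forall.1 h) y

variable {F}

theorem IsFermionic.eq_of_transport_self (hF : F.IsFermionic) {x : OConf N d} {a b : ℂ}
    (h : F.Transport (x, a) (x, b)) : b = a := by
  have h1 : OConf.permute 1 x = x := (permute_eq_self_iff 1 x).2 rfl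
  have := hF.eq_of_transport (σ := 1) (a := a) (b := b) (by rwa [h1])
  simpa using this

/-- The linear form `w ↦ ⟪e, w⟫` of a unit vector `e` in a one-dimensional space. -/
def unitaryOfUnitVector {G : Type*} [NormedAddCommGroup G] [InnerProductSpace ℂ G]
    (h : Module.finrank ℂ G = 1) (e : G) (he : ‖e‖ = 1) : G ≃ₗᵢ[ℂ] ℂ where
  toFun w := ⟪e, w⟫_ℂ
  map_add' := inner_add_right _
  map_smul' c w := inner_smul_right _ _ _
  invFun c := c • e
  left_inv w := inner_smul_self_of_finrank_eq_one h he w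
  right_inv c := by
    change ⟪e, c • e⟫_ℂ = c
    rw [inner_smul_right, inner_self_eq_norm_sq_to_K, he]
    simp
  norm_map' w := by
    change ‖⟪e, w⟫_ℂ‖ = ‖w‖
    conv_rhs => rw [← inner_smul_self_of_finrank_eq_one h he w, norm_smul, he, mul_one]

/-- Parallel transport from a base point is path-independent up to the sign of a permutation, and
the sign is trivial for curves that close already among the ordered configurations. Hence it
trivializes the pull-back of the bundle. -/
theorem nonempty_trivialization (hd : 2 ≤ d) (hF : F.IsFermionic) :
    Nonempty F.Trivialization := by
  rcases isEmpty_or_nonempty (OConf N d) with h0 | ⟨⟨x₀⟩⟩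
  · exact ⟨⟨fun x => (h0.false x).elim, fun γ => (h0.false (γ 0)).elim⟩⟩
  choose b hb hT using fun x => F.reachable hd x₀ x
  refine ⟨⟨fun x => unitaryOfUnitVector (F.finrank_eq_one _) (b x • F.refVec (proj x)) (by
    rw [norm_smul, hb, F.norm_refVec, mul_one]), fun γ s h => ?_⟩⟩
  have hbb : ∀ x, (starRingEnd ℂ) (b x) * b x = 1 := fun x => by
    rw [mul_comm, Complex.mul_conj, Complex.normSq_eq_norm_sq, hb]
    simp
  have key : ∀ x, ∀ w : F.Fiber (proj x),
      F.Transport (x₀, ⟪b x • F.refVec (proj x), w⟫_ℂ) (x, ⟪F.refVec (proj x), w⟫_ℂ) := by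
    intro x w
    have := (hT x).smul ⟪b x • F.refVec (proj x), w⟫_ℂ
    simp only [mul_one, inner_smul_left] at this ⊢
    convert this using 2
    linear_combination -⟪F.refVec (proj x), w⟫_ℂ * hbb x
  exact hF.eq_of_transport_self (((key _ _).trans h.transport).trans (key _ _).symm)

end HermitianLineBundle

/-! ### Regularity and symmetry of trivializations -/

section PhaseEquation

variable {G : Type*} [NormedAddCommGroup G] [NormedSpace ℝ G]

theorem hasFDerivAt_of_eventuallyEq_cexp_mul {φ : G → ℝ} {u : G → ℂ} {A : G →L[ℝ] ℝ} {x : G}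
    (hφ : HasFDerivAt φ A x) (h0 : φ x = 0)
    (h : u =ᶠ[nhds x] fun y => Complex.exp (Complex.I * (φ y : ℂ)) * u x) :
    HasFDerivAt u ((Complex.I * u x) • Complex.ofRealCLM.comp A) x := by
  have h2 := (((Complex.ofRealCLM.hasFDerivAt.comp x hφ).const_mul Complex.I).cexp).mul_const (u x)
  refine (h2.congr_of_eventuallyEq h).congr_fderiv ?_
  ext v
  simp [h0]
  ring

/-- Solutions of `du = i A u` with a smooth 1-form `A` are smooth. -/
theorem contDiffOn_of_hasFDerivAt_I_mul {A : G → G →L[ℝ] ℝ} {u : G → ℂ} {s : Set G}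
    (hs : IsOpen s) (hA : ContDiffOn ℝ ∞ A s)
    (h : ∀ x ∈ s, HasFDerivAt u ((Complex.I * u x) • Complex.ofRealCLM.comp (A x)) x) :
    ContDiffOn ℝ ∞ u s := by
  refine contDiffOn_infty.2 fun n => ?_
  induction n with
  | zero => exact contDiffOn_zero.2 fun x hx => (h x hx).continuousAt.continuousWithinAt
  | succ n ih =>
    have h1 : ContDiffOn ℝ ((n : ℕ∞) + 1) u s := by
      refine (contDiffOn_succ_iff_fderiv_of_isOpen hs).2
        ⟨fun x hx => (h x hx).differentiableAt.differentiableWithinAt, by simp, ?_⟩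
      have h2 : ContDiffOn ℝ n (fun x => (Complex.I * u x) • Complex.ofRealCLM.comp (A x)) s :=
        (contDiffOn_const.mul ih).smul
          (contDiffOn_const.clm_comp ((contDiffOn_infty.1 hA) n))
      exact h2.congr fun x hx => (h x hx).fderiv
    exact_mod_cast h1

end PhaseEquation

namespace HermitianLineBundle

variable {F : HermitianLineBundle.{u, v} N d}

namespace Trivialization

theorem eq_of_transport (I : F.Trivialization) {x y : OConf N d} {a b : ℂ}
    (h : F.Transport (x, a) (y, b)) :
    I.toFun y (b • F.refVec (proj y)) = I.toFun x (a • F.refVec (proj x)) := by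
  obtain ⟨γ, c, hp, h0, h1, rfl, rfl⟩ := h.exists_isParallelAlong
  subst h0 h1
  exact I.parallel γ _ hp

theorem apply_eq_inner_mul (I : F.Trivialization) (x : OConf N d) (w : F.Fiber (proj x)) :
    I.toFun x w = ⟪F.refVec (proj x), w⟫_ℂ * I.toFun x (F.refVec (proj x)) := by
  conv_lhs => rw [← F.inner_refVec_smul _ w, map_smul, smul_eq_mul]

theorem norm_apply_refVec (I : F.Trivialization) (x : OConf N d) :
    ‖I.toFun x (F.refVec (proj x))‖ = 1 := by
  rw [LinearIsometryEquiv.norm_map, F.norm_refVec]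

/-- Trivializations are equivariant up to the sign of the permutation: this is where the fermionic
holonomy turns cross-sections into anti-symmetric functions. -/
theorem apply_permute (I : F.Trivialization) (hd : 2 ≤ d) (hF : F.IsFermionic)
    (ψ : ∀ q, F.Fiber q) (σ : Equiv.Perm (Fin N)) (x : OConf N d) :
    I.toFun (OConf.permute σ x) (ψ (proj (OConf.permute σ x))) =
      ((Equiv.Perm.sign σ : ℤ) : ℂ) * I.toFun x (ψ (proj x)) := by
  obtain ⟨b, -, hb⟩ := F.reachable hd x (OConf.permute σ x)
  have h1 := hF.eq_of_transport hb
  have h2 := I.eq_of_transport hb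
  rw [h1, mul_one, map_smul, one_smul, smul_eq_mul] at h2
  have h3 : ⟪F.refVec (proj (OConf.permute σ x)), ψ (proj (OConf.permute σ x))⟫_ℂ =
      ⟪F.refVec (proj x), ψ (proj x)⟫_ℂ :=
    congrArg (fun q => ⟪F.refVec q, ψ q⟫_ℂ) (proj_permute σ x)
  rw [I.apply_eq_inner_mul x, I.apply_eq_inner_mul (OConf.permute σ x), h3, ← h2]
  linear_combination -⟪F.refVec (proj x), ψ (proj x)⟫_ℂ *
    I.toFun (OConf.permute σ x) (F.refVec (proj (OConf.permute σ x))) * sign_cast_mul_self σ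

/-- The trivialization is unique up to a global phase, as any two points are joined by a curve. -/
theorem exists_phase (I I' : F.Trivialization) (hd : 2 ≤ d) :
    ∃ c : ℂ, ‖c‖ = 1 ∧ ∀ x w, I'.toFun x w = c * I.toFun x w := by
  rcases isEmpty_or_nonempty (OConf N d) with h0 | ⟨⟨x₀⟩⟩
  · exact ⟨1, by simp, fun x => (h0.false x).elim⟩
  have hn := I.norm_apply_refVec x₀
  have hn' := I'.norm_apply_refVec x₀
  set e := I.toFun x₀ (F.refVec (proj x₀))
  set e' := I'.toFun x₀ (F.refVec (proj x₀))
  have he : e ≠ 0 := by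
    intro h
    simp [h] at hn
  refine ⟨e' / e, by simp [hn, hn'], fun x w => ?_⟩
  obtain ⟨b, hb, hT⟩ := F.reachable hd x₀ x
  have hb0 : b ≠ 0 := by
    rintro rfl
    simp at hb
  have h1 := I.eq_of_transport hT
  have h1' := I'.eq_of_transport hT
  rw [map_smul, one_smul, smul_eq_mul] at h1 h1'
  change _ = e at h1
  change _ = e' at h1'
  rw [I.apply_eq_inner_mul x, I'.apply_eq_inner_mul x, div_mul_eq_mul_div, eq_div_iff he, ← h1,
    ← h1']
  ring

open Classical in
/-- The cross-section `ψ` as a function on `ℝᴺᵈ`, extended by zero to the collisions. -/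
def lift (I : F.Trivialization) (ψ : ∀ q, F.Fiber q) (x : Conf N d) : ℂ :=
  if h : Injective x then I.toFun ⟨x, h⟩ (ψ (proj ⟨x, h⟩)) else 0

theorem lift_apply (I : F.Trivialization) (ψ : ∀ q, F.Fiber q) (x : OConf N d) :
    I.lift ψ x.1 = I.toFun x (ψ (proj x)) := dif_pos x.2

theorem lift_of_not_injective (I : F.Trivialization) (ψ : ∀ q, F.Fiber q) {x : Conf N d}
    (hx : ¬ Injective x) : I.lift ψ x = 0 := dif_neg hx

/-- The value of the trivialization on the frame `i`, as a function on `ℝᴺᵈ`. -/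
def phase (I : F.Trivialization) (i : F.Index) : Conf N d → ℂ := I.lift (F.frame i)

theorem phase_apply (I : F.Trivialization) (i : F.Index) (x : OConf N d) :
    I.phase i x.1 = I.toFun x (F.frame i (proj x)) := I.lift_apply _ x

theorem norm_phase (I : F.Trivialization) (i : F.Index) {x : Conf N d}
    (hx : x ∈ preim (F.baseSet i)) : ‖I.phase i x‖ = 1 := by
  obtain ⟨hx, hi⟩ := hx
  rw [I.phase_apply i ⟨x, hx⟩, LinearIsometryEquiv.norm_map, F.norm_frame i _ hi]

theorem phase_segment (I : F.Trivialization) (i : F.Index) (x y : OConf N d)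
    (h : ∀ t ∈ Set.Icc (0 : ℝ) 1, x.1 + t • (y.1 - x.1) ∈ preim (F.baseSet i)) :
    I.phase i y.1 = Complex.exp (Complex.I * (F.formIntegral i x.1 y.1 : ℂ)) * I.phase i x.1 := by
  have h1 := I.eq_of_transport (Relation.ReflTransGen.single (F.piece_segment i x y h))
  rw [mul_smul, F.inner_refVec_smul, F.inner_refVec_smul, map_smul, smul_eq_mul] at h1
  rw [phase_apply, phase_apply, ← h1, ← mul_assoc, ← Complex.exp_add]
  simp

/-- The frame is related to the flat one by a phase that solves `du = i (form i) u`. -/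
theorem hasFDerivAt_phase (I : F.Trivialization) (i : F.Index) {x : Conf N d}
    (hx : x ∈ preim (F.baseSet i)) :
    HasFDerivAt (I.phase i)
      ((Complex.I * I.phase i x) • Complex.ofRealCLM.comp (F.form i x)) x := by
  obtain ⟨hx, hi⟩ := hx
  have hopen := (isOpen_preim (F.isOpen_baseSet i)).mem_nhds (show x ∈ _ from ⟨hx, hi⟩)
  have h1 : HasFDerivAt (F.formIntegral i x) (F.form i x) x :=
    hasFDerivAt_integral_segment hopen (F.smooth_form i).continuousOn
  have h3 : I.phase i =ᶠ[nhds x] fun y =>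
      Complex.exp (Complex.I * (F.formIntegral i x y : ℂ)) * I.phase i x := by
    filter_upwards [F.eventually_segment_mem i (x := ⟨x, hx⟩) hi] with y hy
    have hy1 := hy 1 (by simp)
    rw [one_smul, add_sub_cancel] at hy1
    exact I.phase_segment i ⟨x, hx⟩ ⟨y, hy1.1⟩ hy
  exact hasFDerivAt_of_eventuallyEq_cexp_mul h1 (by simp [formIntegral]) h3

theorem contDiffOn_phase (I : F.Trivialization) (i : F.Index) :
    ContDiffOn ℝ ∞ (I.phase i) (preim (F.baseSet i)) :=
  contDiffOn_of_hasFDerivAt_I_mul (isOpen_preim (F.isOpen_baseSet i)) (F.smooth_form i)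
    fun _ hx => I.hasFDerivAt_phase i hx

theorem lift_eq_phase_mul (I : F.Trivialization) (i : F.Index) (ψ : ∀ q, F.Fiber q)
    {x : Conf N d} (hx : x ∈ preim (F.baseSet i)) :
    I.lift ψ x = I.phase i x * pullback (F.coeff i ψ) x := by
  obtain ⟨hx, hi⟩ := hx
  rw [I.lift_apply ψ ⟨x, hx⟩, I.phase_apply i ⟨x, hx⟩, pullback_apply _ ⟨x, hx⟩, mul_comm,
    ← smul_eq_mul, ← map_smul, coeff,
    inner_smul_self_of_finrank_eq_one (F.finrank_eq_one _) (F.norm_frame i _ hi)]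

theorem norm_lift (I : F.Trivialization) (ψ : ∀ q, F.Fiber q) (x : OConf N d) :
    ‖I.lift ψ x.1‖ = ‖ψ (proj x)‖ := by
  rw [lift_apply, LinearIsometryEquiv.norm_map]

theorem lift_permute (I : F.Trivialization) (hd : 2 ≤ d) (hF : F.IsFermionic)
    (ψ : ∀ q, F.Fiber q) (σ : Equiv.Perm (Fin N)) (x : Conf N d) :
    I.lift ψ (permute σ x) = ((Equiv.Perm.sign σ : ℤ) : ℂ) * I.lift ψ x := by
  by_cases hx : Injective x
  · exact (I.lift_apply ψ (OConf.permute σ ⟨x, hx⟩)).trans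
      ((I.apply_permute hd hF ψ σ ⟨x, hx⟩).trans (by rw [I.lift_apply ψ ⟨x, hx⟩]))
  · have hx' : ¬ Injective (permute σ x) := fun h => hx fun i j hij => by
      have := @h (σ.symm i) (σ.symm j) (by simpa using hij)
      simpa using this
    rw [I.lift_of_not_injective ψ hx, I.lift_of_not_injective ψ hx', mul_zero]

end Trivialization

end HermitianLineBundle

/-! ### Integration over unordered configurations -/

theorem measurable_of_countable_cover {X Y ι : Type*} [MeasurableSpace X] [MeasurableSpace Y]
    {T : Set ι} (hT : T.Countable) {B : ι → Set X} (hB : ∀ i, MeasurableSet (B i))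
    (hcov : ∀ x, ∃ i ∈ T, x ∈ B i) {f : X → Y} (hf : ∀ i ∈ T, Measurable fun x : B i => f x) :
    Measurable f := by
  intro S hS
  have : f ⁻¹' S = ⋃ i ∈ T, Subtype.val '' ((fun x : B i => f x) ⁻¹' S) := by
    ext x
    simp only [Set.mem_iUnion, exists_prop]
    constructor
    · intro h
      obtain ⟨i, hi, hx⟩ := hcov x
      exact ⟨i, hi, ⟨x, hx⟩, h, rfl⟩
    · rintro ⟨i, -, x, h, rfl⟩
      exact h
  rw [this]
  exact MeasurableSet.biUnion hT fun i hi => MeasurableSet.subtype_image (hB i) (hf i hi hS)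

/-- Measurability descends along the covering, as the latter has countably many sheets. -/
theorem measurableSet_of_preimage_proj {A : Set (UConf N d)}
    (hA : MeasurableSet ((proj : OConf N d → UConf N d) ⁻¹' A)) : MeasurableSet A := by
  choose W hWo hxW hWinj using fun x : OConf N d => exists_nhd_injOn x
  obtain ⟨T, hT, hTU⟩ := TopologicalSpace.isOpen_iUnion_countable W hWo
  have hcov : ∀ x, ∃ y ∈ T, x ∈ W y := by
    intro x
    have : x ∈ ⋃ y, W y := Set.mem_iUnion.2 ⟨x, hxW x⟩
    rw [← hTU] at this
    simpa using this
  have hU : A = ⋃ y ∈ T, (W y).domRestrict proj '' (Subtype.val ⁻¹' (proj ⁻¹' A)) := by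
    ext q
    simp only [Set.mem_iUnion, exists_prop]
    constructor
    · intro hq
      obtain ⟨y, hy, h⟩ := hcov (ordering q)
      refine ⟨y, hy, ⟨ordering q, h⟩, ?_, proj_ordering q⟩
      rwa [Set.mem_preimage, Set.mem_preimage, proj_ordering]
    · rintro ⟨y, -, x, hxA, rfl⟩
      exact hxA
  rw [hU]
  refine MeasurableSet.biUnion hT fun y _ => ?_
  have hemb : Topology.IsOpenEmbedding ((W y).domRestrict (proj : OConf N d → UConf N d)) :=
    .of_continuous_injective_isOpenMap
      (isQuotientMap_proj.continuous.comp continuous_subtype_val)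
      (Set.injOn_iff_injective.1 (hWinj y)) (isOpenMap_proj.domRestrict (hWo y))
  exact hemb.measurableEmbedding.measurableSet_image.2 (measurable_subtype_coe hA)

theorem measurableEmbedding_val :
    MeasurableEmbedding (Subtype.val : OConf N d → Conf N d) :=
  MeasurableEmbedding.subtype_coe isOpen_setOf_injective.measurableSet

theorem map_val_comap_val (hd : 1 ≤ d) :
    Measure.map Subtype.val (Measure.comap (Subtype.val : OConf N d → Conf N d) volume) =
      volume := by
  rw [measurableEmbedding_val.map_comap, Subtype.range_coe_subtype]
  exact Measure.restrict_eq_self_of_ae_mem (ae_injective hd)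

theorem integrable_conf_iff (hd : 1 ≤ d) {g : UConf N d → ℝ} (hg : Measurable g)
    {f : Conf N d → ℝ} (hfg : ∀ x : OConf N d, f x.1 = g (proj x)) :
    Integrable f ↔ Integrable g := by
  have h1 : f ∘ (Subtype.val : OConf N d → Conf N d) = g ∘ proj := funext hfg
  rw [← map_val_comap_val hd, measurableEmbedding_val.integrable_map_iff, h1]
  change _ ↔ Integrable g ((N.factorial : ENNReal)⁻¹ • Measure.map proj _)
  rw [integrable_smul_measure (by simp) (by simp [N.factorial_ne_zero]),
    integrable_map_measure hg.aestronglyMeasurable measurable_proj.aemeasurable]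

/-- Integration over `ℝᴺᵈ` counts every unordered configuration `N!` times. -/
theorem integral_conf_eq (hd : 1 ≤ d) {g : UConf N d → ℝ} (hg : Measurable g)
    {f : Conf N d → ℝ} (hfg : ∀ x : OConf N d, f x.1 = g (proj x)) :
    ∫ x, f x = N.factorial * ∫ q, g q := by
  have h2 : ∫ q, g q = (N.factorial : ℝ)⁻¹ *
      ∫ x, g x ∂(Measure.map proj (Measure.comap (Subtype.val : OConf N d → Conf N d) volume)) := by
    change ∫ q, g q ∂((N.factorial : ENNReal)⁻¹ • Measure.map proj _) = _
    rw [integral_smul_measure]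
    simp
  have hN : (N.factorial : ℝ) ≠ 0 := by exact_mod_cast N.factorial_ne_zero
  rw [h2, mul_inv_cancel_left₀ hN,
    integral_map measurable_proj.aemeasurable hg.aestronglyMeasurable]
  conv_lhs => rw [← map_val_comap_val hd, measurableEmbedding_val.integral_map]
  exact integral_congr_ae (Filter.Eventually.of_forall hfg)

/-! ### The unitary map onto anti-symmetric functions -/

theorem norm_sq_lp_two (f : Lp ℂ 2 (volume : Measure (Conf N d))) :
    ‖f‖ ^ 2 = ∫ x, ‖f x‖ ^ 2 := by
  have h : ⟪f, f⟫_ℂ = ((∫ x, ‖f x‖ ^ 2 : ℝ) : ℂ) := by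
    rw [L2.inner_def, ← integral_complex_ofReal]
    congr 1
    ext x
    rw [inner_self_eq_norm_sq_to_K]
    simp
  rw [inner_self_eq_norm_sq_to_K] at h
  exact Complex.ofReal_injective (by simpa using h)

/-- A norm-preserving surjection becomes unitary on the quotient by the vectors of norm zero. -/
def separationQuotientIsometry {E E' : Type*} [SeminormedAddCommGroup E] [InnerProductSpace ℂ E]
    [NormedAddCommGroup E'] [InnerProductSpace ℂ E'] (f : E →ₗ[ℂ] E') (hn : ∀ x, ‖f x‖ = ‖x‖)
    (hs : Surjective f) : SeparationQuotient E ≃ₗᵢ[ℂ] E' :=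
  LinearIsometryEquiv.ofSurjective
    { toLinearMap := (SeparationQuotient.liftCLM (f.mkContinuous 1 fun x => by
          rw [hn, one_mul]) fun _ _ h => (h.map (ContinuousLinearMap.continuous _)).eq :
          SeparationQuotient E →L[ℂ] E')
      norm_map' := fun p => by
        obtain ⟨x, rfl⟩ := SeparationQuotient.surjective_mk p
        exact hn x }
    fun y => by
      obtain ⟨x, rfl⟩ := hs y
      exact ⟨SeparationQuotient.mk x, rfl⟩

theorem separationQuotientIsometry_mk {E E' : Type*} [SeminormedAddCommGroup E]
    [InnerProductSpace ℂ E] [NormedAddCommGroup E'] [InnerProductSpace ℂ E'] (f : E →ₗ[ℂ] E')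
    (hn : ∀ x, ‖f x‖ = ‖x‖) (hs : Surjective f) (x : E) :
    separationQuotientIsometry f hn hs (SeparationQuotient.mk x) = f x := rfl

namespace HermitianLineBundle

variable {F : HermitianLineBundle.{u, v} N d}

variable (F) in
theorem exists_countable_cover :
    ∃ T : Set F.Index, T.Countable ∧ ∀ q, ∃ i ∈ T, q ∈ F.baseSet i := by
  obtain ⟨T, hT, hTU⟩ := TopologicalSpace.isOpen_iUnion_countable F.baseSet F.isOpen_baseSet
  refine ⟨T, hT, fun q => ?_⟩
  have : q ∈ ⋃ i, F.baseSet i := Set.mem_iUnion.2 ⟨_, F.mem_baseSet_at q⟩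
  rw [← hTU] at this
  simpa using this

namespace Trivialization

theorem measurable_phase (I : F.Trivialization) (i : F.Index) :
    Measurable fun x : (proj ⁻¹' F.baseSet i : Set (OConf N d)) => I.phase i x.1.1 :=
  ((I.contDiffOn_phase i).continuousOn.comp_continuous
    (continuous_subtype_val.comp continuous_subtype_val) fun x =>
      (mem_preim_iff _ x.1).2 x.2).measurable

theorem measurable_lift (I : F.Trivialization) {ψ : ∀ q, F.Fiber q} (hψ : F.IsMeasurable ψ) :
    Measurable (I.lift ψ) := by
  classical
  obtain ⟨T, hT, hcov⟩ := F.exists_countable_cover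
  have hB : ∀ i, MeasurableSet (proj ⁻¹' F.baseSet i : Set (OConf N d)) := fun i =>
    measurable_proj (F.isOpen_baseSet i).measurableSet
  have h1 : Measurable fun x : OConf N d => I.toFun x (ψ (proj x)) := by
    refine measurable_of_countable_cover hT hB (fun x => hcov (proj x)) fun i _ => ?_
    have h2 : (fun x : (proj ⁻¹' F.baseSet i : Set (OConf N d)) => I.toFun x.1 (ψ (proj x.1))) =
        fun x => I.phase i x.1.1 * F.coeff i ψ (proj x.1) := by
      funext x
      rw [← pullback_apply (F.coeff i ψ) x.1, ← I.lift_apply ψ x.1,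
        I.lift_eq_phase_mul i ψ ((mem_preim_iff _ x.1).2 x.2)]
    rw [h2]
    have h3 : Measurable fun x : (proj ⁻¹' F.baseSet i : Set (OConf N d)) =>
        (⟨proj x.1, x.2⟩ : F.baseSet i) :=
      (measurable_proj.comp measurable_subtype_coe).subtype_mk
    exact (I.measurable_phase i).mul ((hψ i).comp h3)
  exact Measurable.dite (s := {x : Conf N d | Injective x}) h1
    (measurable_const (a := (0 : ℂ))) isOpen_setOf_injective.measurableSet

/-- A cross-section is measurable if its lift is, because the phases of the local frames are
continuous and measurability descends along `proj`. -/
theorem isMeasurable_of_lift (I : F.Trivialization) {ψ : ∀ q, F.Fiber q}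
    (h : Measurable (I.lift ψ)) : F.IsMeasurable ψ := by
  intro i S hS
  have hB : MeasurableSet (proj ⁻¹' F.baseSet i : Set (OConf N d)) :=
    measurable_proj (F.isOpen_baseSet i).measurableSet
  have hA : MeasurableSet {q | q ∈ F.baseSet i ∧ F.coeff i ψ q ∈ S} := by
    refine measurableSet_of_preimage_proj ?_
    have h1 : Measurable fun x : (proj ⁻¹' F.baseSet i : Set (OConf N d)) =>
        (starRingEnd ℂ) (I.phase i x.1.1) * I.lift ψ x.1.1 :=
      (Complex.continuous_conj.measurable.comp (I.measurable_phase i)).mul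
        (h.comp (measurable_subtype_coe.comp measurable_subtype_coe))
    convert MeasurableSet.subtype_image hB (h1 hS) using 1
    ext x
    have key : proj x ∈ F.baseSet i →
        (starRingEnd ℂ) (I.phase i x.1) * I.lift ψ x.1 = F.coeff i ψ (proj x) := fun hx => by
      rw [I.lift_eq_phase_mul i ψ ((mem_preim_iff _ x).2 hx), ← mul_assoc, mul_comm _ (I.phase i _),
        Complex.mul_conj, Complex.normSq_eq_norm_sq, I.norm_phase i ((mem_preim_iff _ x).2 hx),
        pullback_apply]
      simp
    constructor
    · rintro ⟨hx, hxS⟩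
      refine ⟨⟨x, hx⟩, ?_, rfl⟩
      change (starRingEnd ℂ) (I.phase i x.1) * I.lift ψ x.1 ∈ S
      rwa [key hx]
    · rintro ⟨⟨x, hx⟩, hxS, rfl⟩
      change (starRingEnd ℂ) (I.phase i x.1) * I.lift ψ x.1 ∈ S at hxS
      exact ⟨hx, by rwa [← (show _ = _ from key hx)]⟩
  have h2 : (fun q : F.baseSet i => F.coeff i ψ q) ⁻¹' S =
      Subtype.val ⁻¹' {q | q ∈ F.baseSet i ∧ F.coeff i ψ q ∈ S} := by
    ext q
    simp
  rw [h2]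
  exact measurable_subtype_coe hA

theorem integrable_norm_lift_iff (I : F.Trivialization) (hd : 1 ≤ d) {ψ : ∀ q, F.Fiber q}
    (hψ : F.IsMeasurable ψ) :
    Integrable (fun x => ‖I.lift ψ x‖ ^ 2) ↔ Integrable fun q => ‖ψ q‖ ^ 2 :=
  integrable_conf_iff hd (hψ.norm.pow_const 2) fun x => by rw [I.norm_lift]

theorem memLp_lift (I : F.Trivialization) (hd : 1 ≤ d) (ψ : F.SqIntSection) :
    MemLp (fun x => ((1 / Real.sqrt (N.factorial : ℝ) : ℝ) : ℂ) * I.lift ψ.1 x) 2 volume := by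
  refine MemLp.const_mul ?_ _
  rw [memLp_two_iff_integrable_sq_norm (I.measurable_lift ψ.2.1).aestronglyMeasurable]
  exact (I.integrable_norm_lift_iff hd ψ.2.1).2 ψ.2.2

theorem lift_mem_antiL2 (I : F.Trivialization) (hd : 2 ≤ d) (hF : F.IsFermionic)
    (ψ : F.SqIntSection) : (I.memLp_lift (one_le_two.trans hd) ψ).toLp ∈ AntiL2 N d := by
  intro σ
  have h := (I.memLp_lift (one_le_two.trans hd) ψ).coeFn_toLp
  filter_upwards [h, ae_permute h σ] with x h1 h2
  rw [h1, h2, I.lift_permute hd hF]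
  ring

theorem lift_add (I : F.Trivialization) (φ ψ : ∀ q, F.Fiber q) (x : Conf N d) :
    I.lift (φ + ψ) x = I.lift φ x + I.lift ψ x := by
  by_cases hx : Injective x
  · simp [lift, hx]
  · simp [lift, hx]

theorem lift_smul (I : F.Trivialization) (c : ℂ) (ψ : ∀ q, F.Fiber q) (x : Conf N d) :
    I.lift (c • ψ) x = c * I.lift ψ x := by
  by_cases hx : Injective x
  · simp [lift, hx]
  · simp [lift, hx]

/-- The anti-symmetric function `(N!)^(-1/2) I ψ ∘ π`. -/
def liftL2 (I : F.Trivialization) (hd : 2 ≤ d) (hF : F.IsFermionic) (ψ : F.SqIntSection) :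
    AntiL2 N d := ⟨_, I.lift_mem_antiL2 hd hF ψ⟩

theorem liftL2_ae (I : F.Trivialization) (hd : 2 ≤ d) (hF : F.IsFermionic) (ψ : F.SqIntSection) :
    ∀ᵐ x, (I.liftL2 hd hF ψ).1 x = ((1 / Real.sqrt (N.factorial : ℝ) : ℝ) : ℂ) * I.lift ψ.1 x :=
  (I.memLp_lift (one_le_two.trans hd) ψ).coeFn_toLp

/-- The map `ψ ↦ (N!)^(-1/2) I ψ ∘ π` from cross-sections to anti-symmetric functions. -/
def liftLM (I : F.Trivialization) (hd : 2 ≤ d) (hF : F.IsFermionic) :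
    F.SqIntSection →ₗ[ℂ] AntiL2 N d where
  toFun := I.liftL2 hd hF
  map_add' φ ψ := by
    apply Subtype.ext
    apply Lp.ext
    filter_upwards [I.liftL2_ae hd hF φ, I.liftL2_ae hd hF ψ, I.liftL2_ae hd hF (φ + ψ),
      Lp.coeFn_add (I.liftL2 hd hF φ).1 (I.liftL2 hd hF ψ).1] with x h1 h2 h3 h4
    rw [Submodule.coe_add, h4, h3, Pi.add_apply, h1, h2,
      show (φ + ψ).1 = φ.1 + ψ.1 from rfl, I.lift_add, mul_add]
  map_smul' c ψ := by
    apply Subtype.ext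
    apply Lp.ext
    filter_upwards [I.liftL2_ae hd hF ψ, I.liftL2_ae hd hF (c • ψ),
      Lp.coeFn_smul c (I.liftL2 hd hF ψ).1] with x h1 h2 h3
    rw [RingHom.id_apply, Submodule.coe_smul, h3, h2, Pi.smul_apply, h1,
      show (c • ψ).1 = c • ψ.1 from rfl, I.lift_smul, smul_eq_mul]
    ring

theorem liftLM_ae (I : F.Trivialization) (hd : 2 ≤ d) (hF : F.IsFermionic) (ψ : F.SqIntSection) :
    ∀ᵐ x, (I.liftLM hd hF ψ).1 x = ((1 / Real.sqrt (N.factorial : ℝ) : ℝ) : ℂ) * I.lift ψ.1 x :=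
  I.liftL2_ae hd hF ψ

theorem norm_liftLM (I : F.Trivialization) (hd : 2 ≤ d) (hF : F.IsFermionic)
    (ψ : F.SqIntSection) : ‖I.liftLM hd hF ψ‖ = ‖ψ‖ := by
  have hN : (0 : ℝ) < N.factorial := by exact_mod_cast N.factorial_pos
  rw [← sq_eq_sq₀ (norm_nonneg _) (norm_nonneg _), norm_sq_sqIntSection, Submodule.coe_norm,
    norm_sq_lp_two]
  have h1 : ∫ x, ‖(I.liftLM hd hF ψ).1 x‖ ^ 2 =
      ∫ x, (N.factorial : ℝ)⁻¹ * ‖I.lift ψ.1 x‖ ^ 2 := by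
    refine integral_congr_ae ?_
    filter_upwards [I.liftLM_ae hd hF ψ] with x hx
    rw [hx, norm_mul, mul_pow, Complex.norm_real, Real.norm_eq_abs, sq_abs, div_pow, one_pow,
      Real.sq_sqrt hN.le, one_div]
  rw [h1, integral_const_mul, integral_conf_eq (one_le_two.trans hd) (ψ.2.1.norm.pow_const 2)
    (f := fun x => ‖I.lift ψ.1 x‖ ^ 2) (fun x => by rw [I.norm_lift]),
    inv_mul_cancel_left₀ hN.ne']

/-- Every anti-symmetric function is the lift of a cross-section, whose value at `q` is determined
by the value of the function at the chosen ordering of `q`. -/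
theorem exists_liftLM_eq (I : F.Trivialization) (hd : 2 ≤ d) (hF : F.IsFermionic)
    (f : AntiL2 N d) : ∃ ψ, I.liftLM hd hF ψ = f := by
  have hN : (0 : ℝ) < N.factorial := by exact_mod_cast N.factorial_pos
  have hsq : ((1 / Real.sqrt (N.factorial : ℝ) : ℝ) : ℂ) *
      (Real.sqrt (N.factorial : ℝ) : ℂ) = 1 := by
    rw [← Complex.ofReal_mul, one_div, inv_mul_cancel₀ (Real.sqrt_pos.2 hN).ne', Complex.ofReal_one]
  -- a representative that is anti-symmetric at every point
  let g : Conf N d → ℂ := fun x => (N.factorial : ℂ)⁻¹ * antisymmetrize f.1 x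
  have hgm : Measurable g := by
    refine Measurable.const_mul ?_ _
    refine Finset.measurable_sum _ fun σ _ => Measurable.const_mul ?_ _
    exact (Lp.stronglyMeasurable f.1).measurable.comp (permute σ).continuous.measurable
  have hgf : ∀ᵐ x, g x = f.1 x := by
    filter_upwards [ae_all_iff.2 f.2] with x hx
    simp only [g, antisymmetrize, hx, ← mul_assoc, sign_cast_mul_self, one_mul, Finset.sum_const,
      Finset.card_univ, Fintype.card_perm, Fintype.card_fin, nsmul_eq_mul]
    rw [mul_assoc, inv_mul_cancel_left₀ (by exact_mod_cast N.factorial_ne_zero)]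
  have hgp : ∀ (σ : Equiv.Perm (Fin N)) (x : Conf N d),
      g (permute σ x) = ((Equiv.Perm.sign σ : ℤ) : ℂ) * g x := fun σ x => by
    simp only [g, antisymmetrize_permute]
    ring
  let k : UConf N d → ℂ := fun q =>
    (starRingEnd ℂ) (I.toFun (ordering q) (F.refVec (proj (ordering q)))) *
      ((Real.sqrt (N.factorial : ℝ) : ℂ) * g (ordering q).1)
  let ψ : ∀ q, F.Fiber q := fun q => k q • F.refVec q
  have hψo : ∀ q, I.toFun (ordering q) (ψ (proj (ordering q))) =
      (Real.sqrt (N.factorial : ℝ) : ℂ) * g (ordering q).1 := by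
    intro q
    have h1 : (starRingEnd ℂ) (I.toFun (ordering q) (F.refVec (proj (ordering q)))) *
        I.toFun (ordering q) (F.refVec (proj (ordering q))) = 1 := by
      rw [mul_comm, Complex.mul_conj, Complex.normSq_eq_norm_sq, I.norm_apply_refVec]
      simp
    simp only [ψ]
    rw [map_smul, smul_eq_mul, congrArg k (proj_ordering q)]
    simp only [k]
    linear_combination ((Real.sqrt (N.factorial : ℝ) : ℂ) * g (ordering q).1) * h1
  have hψ : ∀ x : OConf N d, I.lift ψ x.1 = (Real.sqrt (N.factorial : ℝ) : ℂ) * g x.1 := by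
    intro x
    obtain ⟨σ, hσ⟩ := (proj_eq_iff (ordering (proj x)) x).1 (proj_ordering _)
    rw [hσ]
    change I.lift ψ (permute σ _) = _ * g (permute σ _)
    rw [I.lift_permute hd hF, hgp, I.lift_apply, hψo]
    ring
  have hψae : ∀ᵐ x, I.lift ψ x = (Real.sqrt (N.factorial : ℝ) : ℂ) * f.1 x := by
    filter_upwards [ae_injective (N := N) (one_le_two.trans hd), hgf] with x hx hx'
    rw [hψ ⟨x, hx⟩, hx']
  have hψm : F.IsMeasurable ψ := by
    refine I.isMeasurable_of_lift ?_
    have h1 : I.lift ψ = {x : Conf N d | Injective x}.indicator fun x =>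
        (Real.sqrt (N.factorial : ℝ) : ℂ) * g x := by
      funext x
      by_cases hx : Injective x
      · rw [Set.indicator_of_mem hx, hψ ⟨x, hx⟩]
      · rw [Set.indicator_of_notMem hx, I.lift_of_not_injective ψ hx]
    rw [h1]
    exact (hgm.const_mul _).indicator isOpen_setOf_injective.measurableSet
  have hint : Integrable fun q => ‖ψ q‖ ^ 2 := by
    refine (I.integrable_norm_lift_iff (one_le_two.trans hd) hψm).1 ?_
    have h1 := ((memLp_two_iff_integrable_sq_norm (Lp.memLp f.1).1).1 (Lp.memLp f.1)).const_mul
      (N.factorial : ℝ)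
    refine h1.congr ?_
    filter_upwards [hψae] with x hx
    rw [hx, norm_mul, mul_pow, Complex.norm_real, Real.norm_eq_abs, sq_abs, Real.sq_sqrt hN.le]
  refine ⟨⟨ψ, hψm, hint⟩, Subtype.ext (Lp.ext ?_)⟩
  filter_upwards [I.liftLM_ae hd hF ⟨ψ, hψm, hint⟩, hψae] with x h1 h2
  rw [h1, h2, ← mul_assoc, hsq, one_mul]

/-- The unitary map `L²(F) → Anti L²(ℝᴺᵈ)`, `ψ ↦ (N!)^(-1/2) I ψ ∘ π`. -/
def unitary (I : F.Trivialization) (hd : 2 ≤ d) (hF : F.IsFermionic) :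
    F.L2 ≃ₗᵢ[ℂ] AntiL2 N d :=
  separationQuotientIsometry (I.liftLM hd hF) (I.norm_liftLM hd hF) (I.exists_liftLM_eq hd hF)

theorem unitary_toL2 (I : F.Trivialization) (hd : 2 ≤ d) (hF : F.IsFermionic)
    (ψ : F.SqIntSection) : I.unitary hd hF (toL2 ψ) = I.liftLM hd hF ψ :=
  separationQuotientIsometry_mk (I.liftLM hd hF) _ _ ψ

theorem unitary_toL2_ae (I : F.Trivialization) (hd : 2 ≤ d) (hF : F.IsFermionic)
    (ψ : F.SqIntSection) : ∀ᵐ x, (I.unitary hd hF (toL2 ψ)).1 x =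
      ((1 / Real.sqrt (N.factorial : ℝ) : ℝ) : ℂ) * I.lift ψ.1 x := by
  rw [unitary_toL2]
  exact I.liftLM_ae hd hF ψ

theorem unitary_posObs (I : F.Trivialization) (hd : 2 ≤ d) (hF : F.IsFermionic)
    {A : Set (UConf N d)} (hA : MeasurableSet A) (p : F.L2) :
    I.unitary hd hF (F.posObs A hA p) = antiPosObs A hA (I.unitary hd hF p) := by
  obtain ⟨ψ, rfl⟩ := SeparationQuotient.surjective_mk p
  apply Subtype.ext
  apply Lp.ext
  rw [posObs_toL2]
  filter_upwards [I.unitary_toL2_ae hd hF ⟨F.cutoff A ψ.1, cutoff_mem hA ψ.2⟩,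
    I.unitary_toL2_ae hd hF ψ, antiPosObs_ae hA (I.unitary hd hF (toL2 ψ)),
    ae_injective (N := N) (one_le_two.trans hd)] with x h1 h2 h3 hx
  rw [h1, h3, I.lift_apply _ ⟨x, hx⟩]
  by_cases hxA : proj ⟨x, hx⟩ ∈ A
  · rw [Set.indicator_of_mem (show x ∈ preim A from ⟨hx, hxA⟩), h2, I.lift_apply _ ⟨x, hx⟩, cutoff,
      if_pos hxA]
  · rw [Set.indicator_of_notMem (fun h : x ∈ preim A => hxA h.2), cutoff, if_neg hxA, map_zero,
      mul_zero]

/-- Two trivializations give unitary maps that differ by a phase. -/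
theorem unitary_eq_smul (I I' : F.Trivialization) (hd : 2 ≤ d) (hF : F.IsFermionic) :
    ∃ c : ℂ, ‖c‖ = 1 ∧ ∀ p, I'.unitary hd hF p = c • I.unitary hd hF p := by
  obtain ⟨c, hc, h⟩ := I.exists_phase I' hd
  refine ⟨c, hc, fun p => ?_⟩
  obtain ⟨ψ, rfl⟩ := SeparationQuotient.surjective_mk p
  apply Subtype.ext
  apply Lp.ext
  rw [Submodule.coe_smul]
  filter_upwards [I.unitary_toL2_ae hd hF ψ, I'.unitary_toL2_ae hd hF ψ,
    Lp.coeFn_smul c (I.unitary hd hF (toL2 ψ)).1] with x h1 h2 h3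
  have h4 : I'.lift ψ.1 x = c * I.lift ψ.1 x := by
    by_cases hx : Injective x
    · rw [I.lift_apply _ ⟨x, hx⟩, I'.lift_apply _ ⟨x, hx⟩, h]
    · rw [I.lift_of_not_injective _ hx, I'.lift_of_not_injective _ hx, mul_zero]
  rw [h2, h3, Pi.smul_apply, h1, h4, smul_eq_mul]
  ring

end Trivialization

end HermitianLineBundle

/-! ### The Laplacian of a lifted cross-section -/

section Gauge

variable {G : Type*} [NormedAddCommGroup G] [NormedSpace ℝ G]

theorem fderiv_mul_of_hasFDerivAt_I_mul {A : G →L[ℝ] ℝ} {u f : G → ℂ} {x : G}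
    (hu : HasFDerivAt u ((Complex.I * u x) • Complex.ofRealCLM.comp A) x)
    (hf : DifferentiableAt ℝ f x) (v : G) :
    fderiv ℝ (fun y => u y * f y) x v = u x * (fderiv ℝ f x v + Complex.I * A v * f x) := by
  change fderiv ℝ (u * f) x v = _
  rw [(hu.mul hf.hasFDerivAt).fderiv]
  simp
  ring

/-- A phase with `du = i A u` intertwines the covariant derivative `d + i A` with `d`. -/
theorem fderiv_fderiv_of_eqOn_mul {O : Set G} (hO : IsOpen O) {A : G → G →L[ℝ] ℝ}
    (hA : ContDiffOn ℝ ∞ A O) {u f h : G → ℂ}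
    (hu : ∀ x ∈ O, HasFDerivAt u ((Complex.I * u x) • Complex.ofRealCLM.comp (A x)) x)
    (hf : ContDiffOn ℝ ∞ f O) (hh : ∀ x ∈ O, h x = u x * f x) {x : G} (hx : x ∈ O) (v w : G) :
    fderiv ℝ (fun y => fderiv ℝ h y v) x w =
      u x * (fderiv ℝ (fun y => fderiv ℝ f y v + Complex.I * A y v * f y) x w +
        Complex.I * A x w * (fderiv ℝ f x v + Complex.I * A x v * f x)) := by
  have hdf : ∀ y ∈ O, DifferentiableAt ℝ f y := fun y hy =>
    (hf.differentiableOn (by simp)).differentiableAt (hO.mem_nhds hy)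
  have h1 : (fun y => fderiv ℝ h y v) =ᶠ[nhds x]
      fun y => u y * (fderiv ℝ f y v + Complex.I * A y v * f y) := by
    filter_upwards [hO.mem_nhds hx] with y hy
    have h2 : h =ᶠ[nhds y] fun z => u z * f z := by
      filter_upwards [hO.mem_nhds hy] with z hz using hh z hz
    rw [h2.fderiv_eq, fderiv_mul_of_hasFDerivAt_I_mul (hu y hy) (hdf y hy)]
  have h3 : DifferentiableAt ℝ (fun y => fderiv ℝ f y v + Complex.I * A y v * f y) x := by
    have h4 : DifferentiableAt ℝ (fun y => fderiv ℝ f y) x :=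
      (((contDiffOn_infty_iff_fderiv_of_isOpen hO).1 hf).2.differentiableOn
        (by simp)).differentiableAt (hO.mem_nhds hx)
    have h5 : DifferentiableAt ℝ A x :=
      (hA.differentiableOn (by simp)).differentiableAt (hO.mem_nhds hx)
    have h6 : DifferentiableAt ℝ (fun y => (A y v : ℂ)) x :=
      Complex.ofRealCLM.differentiableAt.comp x (h5.clm_apply (differentiableAt_const v))
    exact (h4.clm_apply (differentiableAt_const v)).add ((h6.const_mul _).mul (hdf x hx))
  rw [h1.fderiv_eq, fderiv_mul_of_hasFDerivAt_I_mul (hu x hx) h3]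

end Gauge

theorem laplacian_eq_sum_fderiv_fderiv {G : Type*} [NormedAddCommGroup G] [InnerProductSpace ℝ G]
    [FiniteDimensional ℝ G] {ι : Type*} [Fintype ι] (b : OrthonormalBasis ι ℝ G) {h : G → ℂ}
    (hh : ContDiff ℝ ∞ h) (x : G) :
    Laplacian.laplacian h x = ∑ i, fderiv ℝ (fun y => fderiv ℝ h y (b i)) x (b i) := by
  rw [InnerProductSpace.laplacian_eq_iteratedFDeriv_orthonormalBasis h b]
  refine Finset.sum_congr rfl fun i _ => ?_
  have h1 : DifferentiableAt ℝ (fderiv ℝ h) x :=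
    ((hh.fderiv_right (m := ∞) (by simp)).differentiable (by simp)) x
  rw [iteratedFDeriv_two_apply, fderiv_clm_apply h1 (differentiableAt_const _)]
  simp

theorem orthonormalBasis_unitVec_apply (p : (_ : Fin N) × Fin d) :
    Pi.orthonormalBasis (𝕜 := ℝ) (fun _ : Fin N => EuclideanSpace.basisFun (Fin d) ℝ) p =
      unitVec p.1 p.2 := by
  rw [Pi.orthonormalBasis_apply]
  simp [unitVec]

theorem laplacian_conf_eq {h : Conf N d → ℂ} (hh : ContDiff ℝ ∞ h) (x : Conf N d) :
    Laplacian.laplacian h x = ∑ j : Fin N, ∑ k : Fin d,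
      fderiv ℝ (fun y => fderiv ℝ h y (unitVec j k)) x (unitVec j k) := by
  rw [laplacian_eq_sum_fderiv_fderiv
    (Pi.orthonormalBasis fun _ : Fin N => EuclideanSpace.basisFun (Fin d) ℝ) hh x,
    Fintype.sum_sigma]
  simp only [orthonormalBasis_unitVec_apply]

/-! ### Compactly supported cross-sections -/

/-- The preimage of a compact set of unordered configurations lies in a compact set away from the
collisions. -/
theorem exists_isCompact_preim_subset {K : Set (UConf N d)} (hK : IsCompact K) :
    ∃ C : Set (Conf N d), IsCompact C ∧ (∀ x ∈ C, Injective x) ∧ preim K ⊆ C := by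
  have : LocallyCompactSpace (OConf N d) := isOpen_setOf_injective.locallyCompactSpace
  choose L hL hLx using fun x : OConf N d => exists_compact_mem_nhds x
  obtain ⟨T, -, hT⟩ := hK.elim_nhds_subcover (fun q => proj '' L (ordering q)) fun q _ => by
    have := isOpenMap_proj.image_mem_nhds (hLx (ordering q))
    rwa [proj_ordering] at this
  refine ⟨⋃ q ∈ T, ⋃ σ : Equiv.Perm (Fin N),
    (fun x : OConf N d => (OConf.permute σ x).1) '' L (ordering q), ?_, ?_, ?_⟩
  · refine T.isCompact_biUnion fun q _ => isCompact_iUnion fun σ => (hL _).image ?_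
    exact continuous_subtype_val.comp (continuous_permute σ)
  · intro x hx
    simp only [Set.mem_iUnion] at hx
    obtain ⟨q, -, σ, y, -, rfl⟩ := hx
    exact (OConf.permute σ y).2
  · rintro x ⟨hx, hxK⟩
    have h1 := hT hxK
    simp only [Set.mem_iUnion] at h1 ⊢
    obtain ⟨q, hq, y, hy, hyx⟩ := h1
    obtain ⟨σ, hσ⟩ := (proj_eq_iff _ _).1 hyx
    exact ⟨q, hq, σ, y, hy, congrArg Subtype.val hσ.symm⟩

namespace HermitianLineBundle

variable {F : HermitianLineBundle.{u, v} N d}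

namespace Trivialization

theorem exists_isCompact_support_lift (I : F.Trivialization) {ψ : ∀ q, F.Fiber q}
    (hc : F.HasCompactSupp ψ) : ∃ C : Set (Conf N d), IsCompact C ∧ (∀ x ∈ C, Injective x) ∧
      Function.support (I.lift ψ) ⊆ C := by
  obtain ⟨K, hK, hKψ⟩ := hc
  obtain ⟨C, hC, hCi, hKC⟩ := exists_isCompact_preim_subset hK
  refine ⟨C, hC, hCi, fun x hx => ?_⟩
  by_cases hi : Injective x
  · refine hKC ⟨hi, ?_⟩
    by_contra hxK
    rw [Function.mem_support, I.lift_apply ψ ⟨x, hi⟩, hKψ _ hxK, map_zero] at hx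
    exact hx rfl
  · exact absurd (I.lift_of_not_injective ψ hi) hx

theorem hasCompactSupport_lift (I : F.Trivialization) {ψ : ∀ q, F.Fiber q}
    (hc : F.HasCompactSupp ψ) : HasCompactSupport (I.lift ψ) := by
  obtain ⟨C, hC, -, hs⟩ := I.exists_isCompact_support_lift hc
  exact HasCompactSupport.of_support_subset_isCompact hC hs

theorem contDiff_lift (I : F.Trivialization) {ψ : ∀ q, F.Fiber q} (hs : F.IsSmooth ψ)
    (hc : F.HasCompactSupp ψ) : ContDiff ℝ ∞ (I.lift ψ) := by
  obtain ⟨C, hC, hCi, hsC⟩ := I.exists_isCompact_support_lift hc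
  refine contDiff_iff_contDiffAt.2 fun x => ?_
  by_cases hi : Injective x
  · have hopen := (isOpen_preim (F.isOpen_baseSet (F.indexAt (proj ⟨x, hi⟩)))).mem_nhds
      ((mem_preim_iff _ ⟨x, hi⟩).2 (F.mem_baseSet_at (proj ⟨x, hi⟩)))
    refine (((I.contDiffOn_phase _).mul (hs _)).contDiffAt hopen).congr_of_eventuallyEq ?_
    filter_upwards [hopen] with y hy using I.lift_eq_phase_mul _ ψ hy
  · have hx : x ∉ C := fun h => hi (hCi x h)
    refine (contDiffAt_const (c := (0 : ℂ))).congr_of_eventuallyEq ?_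
    filter_upwards [hC.isClosed.isOpen_compl.mem_nhds hx] with y hy
    by_contra h
    exact hy (hsC h)

theorem fderiv_fderiv_lift (I : F.Trivialization) {ψ : ∀ q, F.Fiber q} (hs : F.IsSmooth ψ)
    (i : F.Index) {x : Conf N d} (hx : x ∈ preim (F.baseSet i)) (v : Conf N d) :
    fderiv ℝ (fun y => fderiv ℝ (I.lift ψ) y v) x v =
      I.phase i x * F.covDeriv i v (F.covDeriv i v (pullback (F.coeff i ψ))) x :=
  fderiv_fderiv_of_eqOn_mul (isOpen_preim (F.isOpen_baseSet i)) (F.smooth_form i)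
    (fun _ hy => I.hasFDerivAt_phase i hy) (hs i) (fun _ hy => I.lift_eq_phase_mul i ψ hy) hx v v

theorem coeff_laplacian (ψ : ∀ q, F.Fiber q) (q : UConf N d) :
    F.coeff (F.indexAt q) (F.laplacian ψ) q = ∑ j : Fin N, ∑ k : Fin d,
      F.covDeriv (F.indexAt q) (unitVec j k)
        (F.covDeriv (F.indexAt q) (unitVec j k) (pullback (F.coeff (F.indexAt q) ψ)))
        (ordering q).1 := by
  rw [coeff, laplacian, inner_smul_right, inner_self_eq_norm_sq_to_K,
    F.norm_frame _ _ (F.mem_baseSet_at q)]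
  simp

/-- The lift intertwines the Laplacian of the connection with the usual one. -/
theorem laplacian_lift (I : F.Trivialization) (hd : 2 ≤ d) (hF : F.IsFermionic)
    {ψ : ∀ q, F.Fiber q} (hs : F.IsSmooth ψ) (hc : F.HasCompactSupp ψ) (x : OConf N d) :
    Laplacian.laplacian (I.lift ψ) x.1 = I.lift (F.laplacian ψ) x.1 := by
  have hsm := I.contDiff_lift hs hc
  have h1 : ∀ q, Laplacian.laplacian (I.lift ψ) (ordering q).1 =
      I.lift (F.laplacian ψ) (ordering q).1 := by
    intro q
    have hq : (ordering q).1 ∈ preim (F.baseSet (F.indexAt q)) := by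
      rw [mem_preim_iff, proj_ordering]
      exact F.mem_baseSet_at q
    rw [laplacian_conf_eq hsm, I.lift_eq_phase_mul _ _ hq, pullback_apply,
      congrArg (F.coeff (F.indexAt q) (F.laplacian ψ)) (proj_ordering q), coeff_laplacian]
    simp only [Finset.mul_sum, I.fderiv_fderiv_lift hs _ hq]
  obtain ⟨σ, hσ⟩ := (proj_eq_iff (ordering (proj x)) x).1 (proj_ordering _)
  rw [hσ]
  change Laplacian.laplacian (I.lift ψ) (permute σ _) = I.lift _ (permute σ _)
  rw [I.lift_permute hd hF, ← h1]
  have h2 : (fun y => I.lift ψ (permute σ y)) = ((Equiv.Perm.sign σ : ℤ) : ℂ) • I.lift ψ :=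
    funext fun y => I.lift_permute hd hF ψ σ y
  have hsm2 : ContDiff ℝ 2 (I.lift ψ) := contDiff_infty.1 hsm 2
  rw [← laplacian_comp_linearIsometryEquiv hsm2 (permute σ), h2,
    InnerProductSpace.laplacian_smul _ hsm2.contDiffAt, smul_eq_mul]

/-- The unitary map takes the Hamiltonian on smooth compactly supported cross-sections into the one
on anti-symmetric test functions. -/
theorem unitary_mem_antiRawHamiltonian (I : F.Trivialization) (hd : 2 ≤ d) (hF : F.IsFermionic)
    {ħ m : ℝ} {V : Conf N d → ℝ}
    (hVsymm : ∀ (σ : Equiv.Perm (Fin N)) (x : Conf N d), V (permute σ x) = V x)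
    {p : F.L2 × F.L2} (hp : p ∈ F.rawHamiltonian ħ m V) :
    (I.unitary hd hF p.1, I.unitary hd hF p.2) ∈ antiRawHamiltonian ħ m V := by
  obtain ⟨φ, χ, hs, hc, hχ, rfl⟩ := hp
  have hsm := I.contDiff_lift hs hc
  set k : ℂ := ((1 / Real.sqrt (N.factorial : ℝ) : ℝ) : ℂ)
  refine ⟨k • I.lift φ.1, hsm.const_smul k, (I.hasCompactSupport_lift hc).smul_left
    (f := fun _ => k), fun σ x => ?_, I.unitary_toL2_ae hd hF φ, ?_⟩
  · rw [Pi.smul_apply, Pi.smul_apply, I.lift_permute hd hF, smul_eq_mul, smul_eq_mul]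
    ring
  · filter_upwards [I.unitary_toL2_ae hd hF χ, ae_injective (N := N) (one_le_two.trans hd)]
      with x hx hi
    have hV : V (ordering (proj ⟨x, hi⟩)).1 = V x := by
      obtain ⟨σ, hσ⟩ := (proj_eq_iff (ordering (proj ⟨x, hi⟩)) ⟨x, hi⟩).1 (proj_ordering _)
      have h5 : V x = V (permute σ (ordering (proj ⟨x, hi⟩)).1) :=
        congrArg (fun z : OConf N d => V z.1) hσ
      exact (h5.trans (hVsymm _ _)).symm
    rw [hx, InnerProductSpace.laplacian_smul _ (contDiff_infty.1 hsm 2).contDiffAt,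
      I.laplacian_lift hd hF hs hc ⟨x, hi⟩, I.lift_apply _ ⟨x, hi⟩, I.lift_apply _ ⟨x, hi⟩, hχ, hV,
      map_add, map_smul, map_smul, Pi.smul_apply, I.lift_apply _ ⟨x, hi⟩]
    simp only [smul_eq_mul]
    ring

end Trivialization

end HermitianLineBundle

/-! ### Transport of quantum triples along a unitary map -/

section UnitaryTransport

variable {E : Type*} [NormedAddCommGroup E] [InnerProductSpace ℂ E]
  {E' : Type*} [NormedAddCommGroup E'] [InnerProductSpace ℂ E']

/-- The operator `U⁻¹ H U`, with domain `U⁻¹ (D(H))`. -/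
def unitaryConj (U : E ≃ₗᵢ[ℂ] E') (H : E' →ₗ.[ℂ] E') : E →ₗ.[ℂ] E where
  domain := H.domain.comap (U : E →ₗ[ℂ] E')
  toFun := (U.symm : E' →ₗ[ℂ] E) ∘ₗ H.toFun ∘ₗ
    (U : E →ₗ[ℂ] E').restrict (p := H.domain.comap (U : E →ₗ[ℂ] E')) (q := H.domain) fun _ h => h

theorem apply_unitaryConj (U : E ≃ₗᵢ[ℂ] E') (H : E' →ₗ.[ℂ] E') (φ : (unitaryConj U H).domain) :
    U (unitaryConj U H φ) = H ⟨U φ, φ.2⟩ :=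
  U.apply_symm_apply _

theorem mem_graph_unitaryConj (U : E ≃ₗᵢ[ℂ] E') (H : E' →ₗ.[ℂ] E') (p : E × E) :
    p ∈ (unitaryConj U H).graph ↔ (U p.1, U p.2) ∈ H.graph := by
  simp only [LinearPMap.mem_graph_iff]
  constructor
  · rintro ⟨φ, h1, h2⟩
    exact ⟨⟨U φ, φ.2⟩, by rw [← h1], by rw [← h2, apply_unitaryConj]⟩
  · rintro ⟨⟨φ, hφ⟩, h1, h2⟩
    simp only at h1
    subst h1
    exact ⟨⟨p.1, hφ⟩, rfl, U.injective (by rw [apply_unitaryConj]; exact h2)⟩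

theorem unitaryConj_eq_of_eq_smul {U U' : E ≃ₗᵢ[ℂ] E'} {c : ℂ} (hc : c ≠ 0)
    (h : ∀ p, U' p = c • U p) (H : E' →ₗ.[ℂ] E') : unitaryConj U' H = unitaryConj U H := by
  apply LinearPMap.eq_of_eq_graph
  ext p
  rw [mem_graph_unitaryConj, mem_graph_unitaryConj, h, h]
  exact Submodule.smul_mem_iff (x := (U p.1, U p.2)) _ hc

theorem completeSpace_of_unitary (U : E ≃ₗᵢ[ℂ] E') [CompleteSpace E'] : CompleteSpace E :=
  (completeSpace_congr (e := U.toEquiv) U.isometry.isUniformEmbedding).2 inferInstance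

theorem isSelfAdjointOp_unitaryConj (U : E ≃ₗᵢ[ℂ] E') {H : E' →ₗ.[ℂ] E'}
    (hH : IsSelfAdjointOp H) : IsSelfAdjointOp (unitaryConj U H) := by
  have hg := hH.graph_eq
  obtain ⟨hc', hs⟩ := hH
  have hc := completeSpace_of_unitary U
  refine ⟨hc, ?_⟩
  have hdom : Dense ((unitaryConj U H).domain : Set E) :=
    hs.dense_domain.preimage U.toHomeomorph.isOpenMap
  rw [LinearPMap.isSelfAdjoint_def]
  apply LinearPMap.eq_of_eq_graph
  rw [LinearPMap.adjoint_graph_eq_graph_adjoint hdom, coe_adjoint_eq_adjointRel]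
  ext p
  rw [mem_graph_unitaryConj, hg]
  constructor
  · intro hp q hq
    have h1 := hp (U.symm q.1, U.symm q.2) ((mem_graph_unitaryConj U H _).2 (by simpa using hq))
    rw [← U.inner_map_map, ← U.inner_map_map (U.symm q.1)] at h1
    simpa using h1
  · intro hp q hq
    have h1 := hp _ ((mem_graph_unitaryConj U H q).1 hq)
    simpa using h1

variable {Ω : Type*} [MeasurableSpace Ω]

theorem isPVM_of_unitary (U : E ≃ₗᵢ[ℂ] E') {Q : ∀ A : Set Ω, MeasurableSet A → (E →L[ℂ] E)}
    {Q' : ∀ A : Set Ω, MeasurableSet A → (E' →L[ℂ] E')} (hQ' : IsPVM Q')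
    (h : ∀ A hA p, U (Q A hA p) = Q' A hA (U p)) : IsPVM Q where
  isProjection A hA := by
    have hp := hQ'.isProjection A hA
    constructor
    · ext p
      apply U.injective
      have h1 := LinearMap.congr_fun hp.isIdempotentElem (U p)
      simpa [h] using h1
    · intro p q
      have h1 := hp.isSymmetric (U p) (U q)
      rw [← U.inner_map_map, ← U.inner_map_map p]
      simpa [h] using h1
  univ := by
    ext p
    apply U.injective
    rw [h, hQ'.univ]
    rfl
  iUnion A hA hdisj p := by
    have h1 := (hQ'.iUnion A hA hdisj (U p)).mapL
      (U.symm.toContinuousLinearEquiv : E' →L[ℂ] E)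
    simpa [← h] using h1

theorem isTripleEquiv_unitaryConj (U : E ≃ₗᵢ[ℂ] E') (H : E' →ₗ.[ℂ] E')
    {Q : ∀ A : Set Ω, MeasurableSet A → (E →L[ℂ] E)}
    {Q' : ∀ A : Set Ω, MeasurableSet A → (E' →L[ℂ] E')}
    (h : ∀ A hA p, U (Q A hA p) = Q' A hA (U p)) :
    IsTripleEquiv U (unitaryConj U H) Q H Q' where
  domain := Set.image_preimage_eq _ U.surjective
  hamiltonian φ φ' hφ := by
    rw [apply_unitaryConj]
    congr 1
    exact Subtype.ext hφ
  observable A hA φ' := by rw [h, U.apply_symm_apply]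

end UnitaryTransport

end

theorem mainTheorem1 (N d : ℕ) (hN : 1 ≤ N) (hd : 2 ≤ d) (ħ m : ℝ) (hħ : 0 < ħ) (hm : 0 < m)
    (V : Conf N d → ℝ) (hVmeas : Measurable V) (hVbdd : ∃ C : ℝ, ∀ x, |V x| ≤ C)
    (hVsymm : ∀ (σ : Equiv.Perm (Fin N)) (x : Conf N d), V (permute σ x) = V x)
    (F : HermitianLineBundle.{u, v} N d) (hF : F.IsFermionic) :
    ∃ H_Anti : AntiL2 N d →ₗ.[ℂ] AntiL2 N d,
      IsSelfAdjointExtension (antiRawHamiltonian ħ m V) H_Anti ∧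
      (∀ H' : AntiL2 N d →ₗ.[ℂ] AntiL2 N d,
        IsSelfAdjointExtension (antiRawHamiltonian ħ m V) H' → H' = H_Anti) ∧
      ∃ H_F : F.L2 →ₗ.[ℂ] F.L2,
        IsSelfAdjointExtension (F.rawHamiltonian ħ m V) H_F ∧
        IsQuantumTriple H_F F.posObs ∧
        IsQuantumTriple H_Anti (antiPosObs (N := N) (d := d)) ∧
        Nonempty F.Trivialization ∧
        ∀ I : F.Trivialization, ∃ U : F.L2 ≃ₗᵢ[ℂ] AntiL2 N d,
          (∀ ψ : F.SqIntSection, ∀ᵐ x : Conf N d, ∀ hx : Function.Injective x,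
            (U (HermitianLineBundle.toL2 ψ)).1 x =
              ((1 / Real.sqrt (N.factorial : ℝ) : ℝ) : ℂ) *
                I.toFun ⟨x, hx⟩ (ψ.1 (proj ⟨x, hx⟩))) ∧
          IsTripleEquiv U H_F F.posObs H_Anti antiPosObs := by
  have hd1 : 1 ≤ d := one_le_two.trans hd
  have hPVM : IsPVM (antiPosObs (N := N) (d := d)) := isPVM_antiPosObs hd1
  obtain ⟨H, hH, huniq⟩ := exists_unique_selfAdjointExtension
    (antiRawHamiltonian_dense (ħ := ħ) (m := m) hVmeas hVbdd hVsymm)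
    (antiRawHamiltonian_subset_adjointRel hVmeas hVbdd)
    fun _ hp _ hq => adjointRel_antiRawHamiltonian_symm hħ hm hVmeas hVbdd hVsymm hp hq
  obtain ⟨I₀⟩ := HermitianLineBundle.nonempty_trivialization hd hF
  refine ⟨H, hH, huniq, unitaryConj (I₀.unitary hd hF) H,
    ⟨isSelfAdjointOp_unitaryConj _ hH.1, fun p hp => ?_⟩,
    ⟨completeSpace_of_unitary (I₀.unitary hd hF), isSelfAdjointOp_unitaryConj _ hH.1,
      isPVM_of_unitary (I₀.unitary hd hF) hPVM fun A hA p => I₀.unitary_posObs hd hF hA p⟩,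
    ⟨inferInstance, hH.1, hPVM⟩, ⟨I₀⟩, fun I => ⟨I.unitary hd hF, fun ψ => ?_, ?_⟩⟩
  · exact (mem_graph_unitaryConj _ _ _).2 (hH.2 (I₀.unitary_mem_antiRawHamiltonian hd hF hVsymm hp))
  · filter_upwards [I.unitary_toL2_ae hd hF ψ] with x hx hi
    rw [hx, I.lift_apply _ ⟨x, hi⟩]
  · -- Another trivialization changes the unitary map by a phase, which does not affect `U⁻¹ H U`.
    obtain ⟨c, hc, hcI⟩ := I₀.unitary_eq_smul I hd hF
    have hc0 : c ≠ 0 := by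
      rintro rfl
      simp at hc
    rw [← unitaryConj_eq_of_eq_smul hc0 hcI H]
    exact isTripleEquiv_unitaryConj _ H fun A hA p => I.unitary_posObs hd hF hA p
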